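/- **Setting.** Let $d\in\{1,2\}$, $\mathbb T^d=\mathbb R^d/\mathbb Z^d$, let $H:\mathbb T^d\to(0,\infty)$ be smooth, and let $\mathrm{Re},\mathrm{We}\ge 0$, $0<r<1$, $-1\le a\le 1$, $\mathrm D>0$. For $0<\varepsilon\le 1$ put $\omega_\varepsilon=\{(x,y): x\in\mathbb T^d,\ -\varepsilon H(x/\varepsilon)<y<1\}$, $\omega_0=\{0<y<1\}$, $\Omega=\{(X,Y):Y>-H(X)\}$, $\Gamma=\partial\Omega$. Vectors have $d+1$ components, the last one vertical. Write $z=(x,y)$, $Z=(X,Y)$. For a function of $z$ alone, $\nabla,\operatorname{div},\Delta$ are the usual operators in $z$. For a function of $(z,Z)$, $\nabla,\operatorname{div},\Delta$ act on $Z$, and $\nabla_x,\operatorname{div}_x,\Delta_x$ act on the horizontal macroscopic variable $x\in\mathbb T^d$ only (the vertical component of $\nabla_x$ is $0$); $(\nabla u)_{ij}=\partial_ju_i$, $\mathbb D,\mathbb W$ are the symmetric and skew-symmetric parts of the gradient ($\mathbb D_x$: of $\nabla_x$), $\partial_N=-\sum_{\ell\le d}\partial_\ell H\,\partial_{X_\ell}-\partial_Y$,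 and $g_a(\nabla u,\sigma)=\sigma\mathbb W(u)-\mathbb W(u)\sigma-a(\sigma\mathbb D(u)+\mathbb D(u)\sigma)$. **Elementary solutions.** Let $f$ be a given force, and let $(u_k,p_k,\sigma_k)_{k\ge0}$ (functions of $z$) and $(U_k,P_k,\Sigma_k)_{k\ge 0}$ (functions of $(z,Z)$), with $\sigma_k,\Sigma_k$ symmetric and $U_0=P_0=\Sigma_0=0$, be elementary solutions: all fields are periodic in the horizontal variables, $u_k,p_k,\sigma_k$ are real analytic in a neighbourhood of $\overline{\omega_0}$, $U_k,P_k,\Sigma_k$ are smooth in $(z,Z)$ up to the boundary ($0\le y\le1$, $Y\ge -H(X)$), for each $z$ one has $\nabla U_k,P_k,\Sigma_k\in L^2(\Omega)$, and, for some functions $a_k,b_k,c_k$ of $z$ alone ($c_k=0$ is allowed; $a_j=c_j=0$ for $j<0$), the following hold. * Order $0$ in $\omega_0$: $\mathrm{Re}\,u_0\cdot\nabla u_0-(1-r)\Delta u_0+\nabla p_0-\operatorname{div}\sigma_0=f+a_0$, $\operatorname{div}u_0=0$, $\mathrm{We}(u_0\cdot\nabla\sigma_0+g_a(\nabla u_0,\sigma_0))+\sigma_0-\mathrm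 D\Delta\sigma_0=2r\mathbb D(u_0)+c_0$; $u_0=0$ at $y=0,1$; $\partial_y\sigma_0=0$ at $y=1$; $-\partial_y\sigma_0=b_0$ at $y=0$. * Order $k\ge1$ in $\omega_0$: $\mathrm{Re}(u_k\cdot\nabla u_0+u_0\cdot\nabla u_k)-(1-r)\Delta u_k+\nabla p_k=\operatorname{div}\sigma_k-\mathrm{Re}\sum_{i=1}^{k-1}u_i\cdot\nabla u_{k-i}+a_k$, $\operatorname{div}u_k=0$, $\mathrm{We}(u_k\cdot\nabla\sigma_0+g_a(\nabla u_k,\sigma_0)+u_0\cdot\nabla\sigma_k+g_a(\nabla u_0,\sigma_k))+\sigma_k-\mathrm D\Delta\sigma_k=2r\mathbb D(u_k)-\mathrm{We}\sum_{i=1}^{k-1}(u_i\cdot\nabla\sigma_{k-i}+g_a(\nabla u_i,\sigma_{k-i}))+c_k$; $u_k=-\lim_{Y\to\infty}\int_{\mathbb T^d}U_k\,dX$ at $y=1$; $u_k=0$ at $y=0$; $\partial_y\sigma_k=0$ at $y=1$; $-\partial_y\sigma_k=b_k$ at $y=0$. * Boundary layer of order $k\ge1$, for every $z$ with $0\le y\le1$: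 $-(1-r)\Delta U_k+\nabla P_k=F_k-a_{k-2}$, $\operatorname{div}U_k=0$, $-\mathrm D\Delta\Sigma_k=G_k-c_{k-2}$ in $\Omega$; $U_k=D_k$, $\partial_N\Sigma_k=N_k-b_{k-1}$ on $\Gamma$. Here $F_1=G_1=0$, and for $k\ge2$ $$F_k=\operatorname{div}\Sigma_{k-1}+2(1-r)\nabla_x\cdot\nabla U_{k-1}+(1-r)\Delta_xU_{k-2}-\nabla_xP_{k-1}+\operatorname{div}_x\Sigma_{k-2}-\mathrm{Re}\sum_{i=0}^{k-2}\big((u_i+U_i)\cdot(\nabla U_{k-1-i}+\nabla_xU_{k-2-i})+U_i\cdot\nabla u_{k-2-i}\big),$$ $$\begin{aligned}G_k={}&2r\mathbb D(U_{k-1})+2r\mathbb D_x(U_{k-2})-\Sigma_{k-2}+2\mathrm D\nabla_x\cdot\nabla\Sigma_{k-1}+\mathrm D\Delta_x\Sigma_{k-2}\\&-\mathrm{We}\sum_{i=0}^{k-2}\big(u_i\cdot(\nabla\Sigma_{k-1-i}+\nabla_x\Sigma_{k-2-i})+U_i\cdot(\nabla\sigma_{k-2-i}+\nabla\Sigma_{k-1-i}+\nabla_x\Sigma_{k-2-i})\\&\qquad+g_a(\nabla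 u_i,\Sigma_{k-2-i})+g_a(\nabla U_{i+1}+\nabla_xU_i,\sigma_{k-2-i}+\Sigma_{k-2-i})\big),\end{aligned}$$ and for $k\ge1$ $$D_k=-\sum_{p=1}^k\frac{(-H)^p}{p!}\partial_y^pu_{k-p}|_{y=0},\qquad N_k=(\nabla H\cdot\nabla_x)\sigma_{k-1}|_{y=0}+(\nabla H\cdot\nabla_x)\Sigma_{k-1}+\sum_{p=1}^{k-1}\frac{(-H)^p}{p!}\partial_y^p\big((\nabla H\cdot\nabla_x)\sigma_{k-1-p}+\partial_y\sigma_{k-1-p}\big)|_{y=0}.$$ **Remainder data of order $N\ge0$.** Microscopic fields being evaluated at $Z=z/\varepsilon$, let $$\begin{aligned}\mathcal F_\varepsilon={}&-\mathrm{Re}\sum_{k=1}^N(u_k+U_k)\cdot(\nabla u_{N-k}+\nabla_xU_{N-k}+\nabla U_{N+1-k})-\mathrm{Re}\,u_0\cdot(\nabla u_N+\nabla_xU_N)\\&+(1-r)\Delta u_N+(1-r)\Delta_xU_N-\nabla p_N-\nabla_xP_{N+1}+\operatorname{div}\sigma_N+\operatorname{div}_x\Sigma_N,\\ \mathcal G_\varepsilon={}&2r\mathbb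 D(u_N)+2r\mathbb D_x(U_N)-\sigma_N-\Sigma_N+\mathrm D\Delta\sigma_N+\mathrm D\Delta_x\Sigma_N\\&-\mathrm{We}\sum_{k=1}^N(u_k+U_k)\cdot(\nabla\sigma_{N-k}+\nabla_x\Sigma_{N-k}+\nabla\Sigma_{N+1-k})-\mathrm{We}\,u_0\cdot(\nabla\sigma_N+\nabla_x\Sigma_N)\\&-\mathrm{We}\sum_{k=0}^{N-1}g_a(\nabla u_k+\nabla_xU_k+\nabla U_{k+1},\sigma_{N-k}+\Sigma_{N-k})-\mathrm{We}\,g_a(\nabla u_N+\nabla_xU_N,\sigma_0),\end{aligned}$$ and, as functions of $x$, with $H=H(x/\varepsilon)$, $\nabla H=(\nabla H)(x/\varepsilon)$, $$\mathcal D^{(+)}_\varepsilon=\sum_{k=0}^N\varepsilon^{k-N}\Big(\lim_{Y\to\infty}\int_{\mathbb T^d}U_k\,dX\Big|_{y=1}-U_k\Big|_{y=1,X=x/\varepsilon,Y=1/\varepsilon}\Big),\qquad\mathcal N^{(+)}_\varepsilon=-\sum_{k=0}^{N-1}\varepsilon^{k-N}\partial_Y\Sigma_{k+1}\Big|_{y=1,X=x/\varepsilon,Y=1/\varepsilon},$$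 $$\mathcal D^{(-)}_\varepsilon=-\varepsilon^{-N}\sum_{k=0}^N\varepsilon^k\sum_{i=N-k+1}^\infty\frac{(-\varepsilon H)^i}{i!}\partial_y^iu_k|_{y=0},\qquad\mathcal N^{(-)}_\varepsilon=-\varepsilon^{-N}\sum_{k=0}^N\varepsilon^k\sum_{i=N-k+1}^\infty\frac{(-\varepsilon H)^i}{i!}\partial_y^i\big((\nabla H\cdot\nabla_x)\sigma_k+\partial_y\sigma_k\big)|_{y=0}.$$ **Proposition.** For every $N\ge 0$ there is $\varepsilon_0\in(0,1]$ such that, for $0<\varepsilon\le\varepsilon_0$, the limits and series above converge, $\mathcal F_\varepsilon,\mathcal G_\varepsilon\in L^2(\omega_\varepsilon)$, the four boundary data are smooth in $x$, and, with $C$ independent of $\varepsilon$, $$\|\mathcal F_\varepsilon\|_{L^2(\omega_\varepsilon)}\le C,\qquad\|\mathcal G_\varepsilon\|_{L^2(\omega_\varepsilon)}\le C.$$ Moreover, for every $\ell\ge0$ there are a constant $C$ and a real polynomial $Q$, independent of $\varepsilon$ and $x$, such that for all $0<\varepsilon\le\varepsilon_0$ and all $x$ $$|\nabla_x^\ell\mathcal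 D^{(+)}_\varepsilon(x)|,\ |\nabla_x^\ell\mathcal N^{(+)}_\varepsilon(x)|\le Q(1/\varepsilon)e^{-1/\varepsilon},\qquad|\nabla_x^\ell\mathcal D^{(-)}_\varepsilon(x)|,\ |\nabla_x^\ell\mathcal N^{(-)}_\varepsilon(x)|\le C\varepsilon^{1-\ell}.$$ (On the torus $1/\varepsilon$ has to be an integer; the estimates hold for every real $\varepsilon\in(0,\varepsilon_0]$ when all functions are regarded as periodic functions on $\mathbb R^d\times\mathbb R$ and $L^2(\omega_\varepsilon)$ is taken over $x\in[0,1]^d$.) -/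

import Mathlib

open Set Filter Topology MeasureTheory
open scoped ContDiff

noncomputable section

namespace RoughChannel

/-! Functions on the torus are functions on the space of the `Fin d → ℝ` that have period `1` in
each coordinate. Vectors and tensors have `d + 1` coordinates, the last one being the vertical
one; finite dimensional spaces carry the sup norm. -/

/-- A point `(x, y)` (macroscopic) or `(X, Y)` (microscopic): `d` horizontal coordinates and a
vertical one. -/
abbrev Pt (d : ℕ) := (Fin d → ℝ) × ℝ

/-- `(d + 1) × (d + 1)` real matrices. -/
abbrev Ten (d : ℕ) := Matrix (Fin (d + 1)) (Fin (d + 1)) ℝ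

/-- Scalar, vector and tensor fields of the macroscopic variable `z = (x, y)`. -/
abbrev MacS (d : ℕ) := Pt d → ℝ
abbrev MacV (d : ℕ) := Fin (d + 1) → MacS d
abbrev MacT (d : ℕ) := Fin (d + 1) → Fin (d + 1) → MacS d

/-- Scalar, vector and tensor fields of the macroscopic variable `z = (x, y)` and of the
microscopic variable `Z = (X, Y)`, in this order. -/
abbrev MicS (d : ℕ) := Pt d → Pt d → ℝ
abbrev MicV (d : ℕ) := Fin (d + 1) → MicS d
abbrev MicT (d : ℕ) := Fin (d + 1) → Fin (d + 1) → MicS d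

variable {d : ℕ}

/-- The `j`-th coordinate vector; the last one is the vertical direction. -/
def dir (j : Fin (d + 1)) : Pt d :=
  Fin.lastCases (motive := fun _ => Pt d) (0, 1) (fun l => (Pi.single l 1, 0)) j

/-- The partial derivative in the `j`-th coordinate. -/
def pd (j : Fin (d + 1)) (g : Pt d → ℝ) (z : Pt d) : ℝ := fderiv ℝ g z (dir j)

/-- The microscopic partial derivative `∂_{X_j}` (`∂_Y` for the last index). -/
def pdX (j : Fin (d + 1)) (W : MicS d) : MicS d := fun z Z => pd j (W z) Z

/-- The `j`-th component of the macroscopic gradient `∇_x` of a microscopic field: it is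
horizontal, so the last component is zero. -/
def pdx (j : Fin (d + 1)) (W : MicS d) : MicS d :=
  fun z Z => if j = Fin.last d then 0 else pd j (fun w => W w Z) z

/-- The partial derivative `∂_l H` of a function of the horizontal variable. -/
def dH (H : (Fin d → ℝ) → ℝ) (l : Fin d) (X : Fin d → ℝ) : ℝ := fderiv ℝ H X (Pi.single l 1)

/-- The gradient matrices, with entries `∂_j v_i`. -/
def grad (v : MacV d) (z : Pt d) : Ten d := Matrix.of fun i j => pd j (v i) z
def gradX (V : MicV d) (z Z : Pt d) : Ten d := Matrix.of fun i j => pdX j (V i) z Z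
def gradx (V : MicV d) (z Z : Pt d) : Ten d := Matrix.of fun i j => pdx j (V i) z Z

/-- The values of tensor fields as matrices. -/
def valT (s : MacT d) (z : Pt d) : Ten d := Matrix.of fun i j => s i j z
def valS (s : MicT d) (z Z : Pt d) : Ten d := Matrix.of fun i j => s i j z Z

/-- Symmetric and skew-symmetric parts of a velocity gradient. -/
def sym (L : Ten d) : Ten d := (1 / 2 : ℝ) • (L + L.transpose)
def skew (L : Ten d) : Ten d := (1 / 2 : ℝ) • (L - L.transpose)

/-- The bilinear map `g_a (∇u, σ) = σ W(u) - W(u) σ - a (σ D(u) + D(u) σ)`. -/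
def gA (a : ℝ) (L s : Ten d) : Ten d :=
  s * skew L - skew L * s - a • (s * sym L + sym L * s)

/-- The physical constants of the diffusive Oldroyd model: Reynolds and Weissenberg numbers,
relaxation parameter, interpolation parameter, stress diffusion. -/
structure Params where
  Re : ℝ
  We : ℝ
  r : ℝ
  a : ℝ
  D : ℝ
  Re_nonneg : 0 ≤ Re
  We_nonneg : 0 ≤ We
  r_pos : 0 < r
  r_lt_one : r < 1
  a_mem : a ∈ Icc (-1 : ℝ) 1
  D_pos : 0 < D

/-- The unknowns of the elementary problems at all orders: main flow `u, p, σ`, boundary layer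
correctors `U, P, S` (`S` is the tensor written as a capital sigma), and the compensators `a, b, c`,
which depend on the macroscopic variable only. -/
structure Expansion (d : ℕ) where
  u : ℕ → MacV d
  p : ℕ → MacS d
  σ : ℕ → MacT d
  U : ℕ → MicV d
  P : ℕ → MicS d
  S : ℕ → MicT d
  a : ℕ → MacV d
  b : ℕ → MacT d
  c : ℕ → MacT d

/-! ### Domains -/

/-- The closed smooth channel `0 ≤ y ≤ 1`. -/
def slab (d : ℕ) : Set (Pt d) := {z | 0 ≤ z.2 ∧ z.2 ≤ 1}

/-- One period of the boundary layer domain `-H(X) < Y`. -/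
def layerCell (H : (Fin d → ℝ) → ℝ) : Set (Pt d) :=
  {Z | Z.1 ∈ Icc (0 : Fin d → ℝ) 1 ∧ -H Z.1 < Z.2}

/-- One period of the rough channel `-ε H(x/ε) < y < 1`. -/
def roughCell (H : (Fin d → ℝ) → ℝ) (ε : ℝ) : Set (Pt d) :=
  {z | z.1 ∈ Icc (0 : Fin d → ℝ) 1 ∧ -(ε * H (ε⁻¹ • z.1)) < z.2 ∧ z.2 < 1}

/-- Period `1` in every horizontal coordinate. -/
def XPeriodic (g : Pt d → ℝ) : Prop := ∀ (z : Pt d) (l : Fin d), g (z + dir l.castSucc) = g z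

/-- A main flow field: periodic, real analytic on (a neighbourhood of) the closed channel. -/
def RegularMac (g : MacS d) : Prop := XPeriodic g ∧ AnalyticOnNhd ℝ g (slab d)

/-- A boundary layer field: periodic in `x` and `X`, smooth up to the boundary. -/
def RegularMic (H : (Fin d → ℝ) → ℝ) (W : MicS d) : Prop :=
  (∀ z, XPeriodic (W z)) ∧ (∀ Z, XPeriodic fun z => W z Z) ∧
    ∀ z ∈ slab d, ∀ Z : Pt d, -H Z.1 ≤ Z.2 →
      ContDiffAt ℝ ∞ (fun q : Pt d × Pt d => W q.1 q.2) (z, Z)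

/-- The mean over one period in `X` at height `Y`. -/
def meanX (W : MicS d) (z : Pt d) (Y : ℝ) : ℝ := ∫ X in Icc (0 : Fin d → ℝ) 1, W z (X, Y)

/-- The far field `lim_{Y → ∞} ∫ W(z, X, Y) dX`. -/
def farField (W : MicS d) (z : Pt d) : ℝ := limUnder atTop (meanX W z)

/-! ### Data of the elementary problems -/

namespace Expansion

variable (par : Params) (H : (Fin d → ℝ) → ℝ) (E : Expansion d)

/-- Source term `F_k` of the momentum equation of the boundary layer problem of order `k`
(zero for `k = 1`). -/
def layerF : ℕ → MicV d
  | 0 => 0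
  | 1 => 0
  | k + 2 => fun i z Z =>
      (∑ j, pdX j (E.S (k + 1) i j) z Z)
      + 2 * (1 - par.r) * (∑ j, pdx j (pdX j (E.U (k + 1) i)) z Z)
      + (1 - par.r) * (∑ j, pdx j (pdx j (E.U k i)) z Z)
      - pdx i (E.P (k + 1)) z Z
      + (∑ j, pdx j (E.S k i j) z Z)
      - par.Re * ∑ m ∈ Finset.range (k + 1),
          ((∑ j, (E.u m j z + E.U m j z Z)
              * (pdX j (E.U (k + 1 - m) i) z Z + pdx j (E.U (k - m) i) z Z))
            + ∑ j, E.U m j z Z * pd j (E.u (k - m) i) z)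

/-- Source term `G_k` of the stress equation of the boundary layer problem of order `k`
(zero for `k = 1`). -/
def layerG : ℕ → MicT d
  | 0 => 0
  | 1 => 0
  | k + 2 => fun i j z Z =>
      2 * par.r * sym (gradX (E.U (k + 1)) z Z) i j
      + 2 * par.r * sym (gradx (E.U k) z Z) i j
      - E.S k i j z Z
      + 2 * par.D * (∑ l, pdx l (pdX l (E.S (k + 1) i j)) z Z)
      + par.D * (∑ l, pdx l (pdx l (E.S k i j)) z Z)
      - par.We * ∑ m ∈ Finset.range (k + 1),
          ((∑ l, E.u m l z
              * (pdX l (E.S (k + 1 - m) i j) z Z + pdx l (E.S (k - m) i j) z Z))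
            + (∑ l, E.U m l z Z
              * (pd l (E.σ (k - m) i j) z + pdX l (E.S (k + 1 - m) i j) z Z
                  + pdx l (E.S (k - m) i j) z Z))
            + gA par.a (grad (E.u m) z) (valS (E.S (k - m)) z Z) i j
            + gA par.a (gradX (E.U (m + 1)) z Z + gradx (E.U m) z Z)
                (valT (E.σ (k - m)) z + valS (E.S (k - m)) z Z) i j)

/-- Dirichlet datum `D_k` on the rough wall `Y = -H(X)`. -/
def layerD (k : ℕ) (i : Fin (d + 1)) (z : Pt d) (X : Fin d → ℝ) : ℝ :=
  -∑ q ∈ Finset.Icc 1 k, (-1) ^ q / (q.factorial : ℝ) * H X ^ q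
      * iteratedDeriv q (fun t => E.u (k - q) i (z.1, t)) 0

/-- `(∇H(X) · ∇_x) σ_k + ∂_y σ_k` at the point `(x, t)`. -/
def slopeσ (k : ℕ) (i j : Fin (d + 1)) (X x : Fin d → ℝ) (t : ℝ) : ℝ :=
  (∑ l : Fin d, dH H l X * pd l.castSucc (E.σ k i j) (x, t))
    + pd (Fin.last d) (E.σ k i j) (x, t)

/-- Neumann datum `N_k` on the rough wall, for `k ≥ 1`. -/
def layerN (k : ℕ) (i j : Fin (d + 1)) (z : Pt d) (X : Fin d → ℝ) : ℝ :=
  (∑ l : Fin d, dH H l X * pd l.castSucc (E.σ (k - 1) i j) (z.1, 0))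
  + (∑ l : Fin d, dH H l X * pdx l.castSucc (E.S (k - 1) i j) z (X, -H X))
  + ∑ q ∈ Finset.Icc 1 (k - 1), (-1) ^ q / (q.factorial : ℝ) * H X ^ q
      * iteratedDeriv q (E.slopeσ H (k - 1 - q) i j X z.1) 0

/-- The sequence `k ↦ s (k - 2)`, zero for `k < 2`. -/
def lag {α : Type} [Zero α] (s : ℕ → α) : ℕ → α
  | 0 => 0
  | 1 => 0
  | k + 2 => s k

/-! ### The elementary problems -/

/-- The main problem of order `0` in the smooth channel. -/
structure MainZero (f : MacV d) : Prop where
  momentum : ∀ z : Pt d, 0 < z.2 → z.2 < 1 → ∀ i,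
    par.Re * (∑ j, E.u 0 j z * pd j (E.u 0 i) z) - (1 - par.r) * (∑ j, pd j (pd j (E.u 0 i)) z)
      + pd i (E.p 0) z - (∑ j, pd j (E.σ 0 i j) z) = f i z + E.a 0 i z
  incompressible : ∀ z : Pt d, 0 < z.2 → z.2 < 1 → ∑ j, pd j (E.u 0 j) z = 0
  constitutive : ∀ z : Pt d, 0 < z.2 → z.2 < 1 → ∀ i j,
    par.We * ((∑ l, E.u 0 l z * pd l (E.σ 0 i j) z)
        + gA par.a (grad (E.u 0) z) (valT (E.σ 0) z) i j)
      + E.σ 0 i j z - par.D * (∑ l, pd l (pd l (E.σ 0 i j)) z)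
      = 2 * par.r * sym (grad (E.u 0) z) i j + E.c 0 i j z
  velocity_top : ∀ x i, E.u 0 i (x, 1) = 0
  velocity_bottom : ∀ x i, E.u 0 i (x, 0) = 0
  stress_top : ∀ x i j, pd (Fin.last d) (E.σ 0 i j) (x, 1) = 0
  stress_bottom : ∀ x i j, -pd (Fin.last d) (E.σ 0 i j) (x, 0) = E.b 0 i j (x, 0)

/-- The (linearized) main problem of order `k ≥ 1` in the smooth channel. -/
structure Main (k : ℕ) : Prop where
  momentum : ∀ z : Pt d, 0 < z.2 → z.2 < 1 → ∀ i,
    par.Re * (∑ j, (E.u k j z * pd j (E.u 0 i) z + E.u 0 j z * pd j (E.u k i) z))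
      - (1 - par.r) * (∑ j, pd j (pd j (E.u k i)) z) + pd i (E.p k) z
      = (∑ j, pd j (E.σ k i j) z)
        - par.Re * (∑ m ∈ Finset.Icc 1 (k - 1), ∑ j, E.u m j z * pd j (E.u (k - m) i) z)
        + E.a k i z
  incompressible : ∀ z : Pt d, 0 < z.2 → z.2 < 1 → ∑ j, pd j (E.u k j) z = 0
  constitutive : ∀ z : Pt d, 0 < z.2 → z.2 < 1 → ∀ i j,
    par.We * ((∑ l, E.u k l z * pd l (E.σ 0 i j) z)
        + gA par.a (grad (E.u k) z) (valT (E.σ 0) z) i j)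
      + par.We * ((∑ l, E.u 0 l z * pd l (E.σ k i j) z)
        + gA par.a (grad (E.u 0) z) (valT (E.σ k) z) i j)
      + E.σ k i j z - par.D * (∑ l, pd l (pd l (E.σ k i j)) z)
      = 2 * par.r * sym (grad (E.u k) z) i j
        - par.We * (∑ m ∈ Finset.Icc 1 (k - 1),
            ((∑ l, E.u m l z * pd l (E.σ (k - m) i j) z)
              + gA par.a (grad (E.u m) z) (valT (E.σ (k - m)) z) i j))
        + E.c k i j z
  velocity_top : ∀ x i, E.u k i (x, 1) = -farField (E.U k i) (x, 1)
  velocity_bottom : ∀ x i, E.u k i (x, 0) = 0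
  stress_top : ∀ x i j, pd (Fin.last d) (E.σ k i j) (x, 1) = 0
  stress_bottom : ∀ x i j, -pd (Fin.last d) (E.σ k i j) (x, 0) = E.b k i j (x, 0)

/-- The boundary layer problem of order `k ≥ 1`, in the variable `Z = (X, Y)`, for every value of
the macroscopic parameter `z`, with solutions in the class `∇U, P, S ∈ L²`. -/
structure Layer (k : ℕ) : Prop where
  momentum : ∀ z ∈ slab d, ∀ Z : Pt d, -H Z.1 < Z.2 → ∀ i,
    -(1 - par.r) * (∑ j, pdX j (pdX j (E.U k i)) z Z) + pdX i (E.P k) z Z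
      = E.layerF par k i z Z - lag E.a k i z
  incompressible : ∀ z ∈ slab d, ∀ Z : Pt d, -H Z.1 < Z.2 → ∑ j, pdX j (E.U k j) z Z = 0
  velocity_wall : ∀ z ∈ slab d, ∀ X i, E.U k i z (X, -H X) = E.layerD H k i z X
  stress : ∀ z ∈ slab d, ∀ Z : Pt d, -H Z.1 < Z.2 → ∀ i j,
    -par.D * (∑ l, pdX l (pdX l (E.S k i j)) z Z) = E.layerG par k i j z Z - lag E.c k i j z
  stress_wall : ∀ z ∈ slab d, ∀ X i j,
    -(∑ l : Fin d, dH H l X * pdX l.castSucc (E.S k i j) z (X, -H X))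
      - pdX (Fin.last d) (E.S k i j) z (X, -H X)
      = E.layerN H k i j z X - E.b (k - 1) i j z
  gradU_memLp : ∀ z ∈ slab d, ∀ i j, MemLp (pdX j (E.U k i) z) 2 (volume.restrict (layerCell H))
  P_memLp : ∀ z ∈ slab d, MemLp (E.P k z) 2 (volume.restrict (layerCell H))
  S_memLp : ∀ z ∈ slab d, ∀ i j, MemLp (E.S k i j z) 2 (volume.restrict (layerCell H))

/-- `E` is a family of (regular) elementary solutions, for the force `f`. The compensators are only
required to make the problems hold: the class of solutions in `Layer` leaves no choice for
`a k`, `c k` (limits at `Y = ∞` of the mean sources of order `k + 2`) and `b k`. The case `c = 0`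
is the one of stress equations without compensators. -/
structure IsElementary (f : MacV d) : Prop where
  u_regular : ∀ k i, RegularMac (E.u k i)
  p_regular : ∀ k, RegularMac (E.p k)
  σ_regular : ∀ k i j, RegularMac (E.σ k i j)
  σ_symm : ∀ k i j, E.σ k i j = E.σ k j i
  U_regular : ∀ k i, RegularMic H (E.U k i)
  P_regular : ∀ k, RegularMic H (E.P k)
  S_regular : ∀ k i j, RegularMic H (E.S k i j)
  S_symm : ∀ k i j, E.S k i j = E.S k j i
  U_zero : E.U 0 = 0
  P_zero : E.P 0 = 0
  S_zero : E.S 0 = 0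
  main_zero : E.MainZero par f
  main : ∀ k, 1 ≤ k → E.Main par k
  layer : ∀ k, 1 ≤ k → E.Layer par H k

/-! ### Source terms and boundary data of the remainder of order `N` -/

variable (N : ℕ) (ε : ℝ)

/-- The source term of the momentum equation, before the substitution `Z = z / ε`. -/
def srcF (i : Fin (d + 1)) (z Z : Pt d) : ℝ :=
  -par.Re * (∑ k ∈ Finset.Icc 1 N, ∑ j, (E.u k j z + E.U k j z Z)
      * (pd j (E.u (N - k) i) z + pdx j (E.U (N - k) i) z Z + pdX j (E.U (N + 1 - k) i) z Z))
  - par.Re * (∑ j, E.u 0 j z * (pd j (E.u N i) z + pdx j (E.U N i) z Z))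
  + (1 - par.r) * (∑ j, pd j (pd j (E.u N i)) z)
  + (1 - par.r) * (∑ j, pdx j (pdx j (E.U N i)) z Z)
  - pd i (E.p N) z - pdx i (E.P (N + 1)) z Z
  + (∑ j, pd j (E.σ N i j) z) + ∑ j, pdx j (E.S N i j) z Z

/-- The source term of the constitutive equation, before the substitution `Z = z / ε`. -/
def srcG (i j : Fin (d + 1)) (z Z : Pt d) : ℝ :=
  2 * par.r * sym (grad (E.u N) z) i j + 2 * par.r * sym (gradx (E.U N) z Z) i j
  - E.σ N i j z - E.S N i j z Z
  + par.D * (∑ l, pd l (pd l (E.σ N i j)) z) + par.D * (∑ l, pdx l (pdx l (E.S N i j)) z Z)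
  - par.We * (∑ k ∈ Finset.Icc 1 N, ∑ l, (E.u k l z + E.U k l z Z)
      * (pd l (E.σ (N - k) i j) z + pdx l (E.S (N - k) i j) z Z
          + pdX l (E.S (N + 1 - k) i j) z Z))
  - par.We * (∑ l, E.u 0 l z * (pd l (E.σ N i j) z + pdx l (E.S N i j) z Z))
  - par.We * (∑ k ∈ Finset.range N,
      gA par.a (grad (E.u k) z + gradx (E.U k) z Z + gradX (E.U (k + 1)) z Z)
        (valT (E.σ (N - k)) z + valS (E.S (N - k)) z Z) i j)
  - par.We * gA par.a (grad (E.u N) z + gradx (E.U N) z Z) (valT (E.σ 0) z) i j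

/-- The source terms `F_ε` and `G_ε` of the remainder system, as functions of `z = (x, y)`. -/
def Fε (z : Pt d) : Fin (d + 1) → ℝ := fun i => E.srcF par N i z (ε⁻¹ • z)
def Gε (z : Pt d) : Fin (d + 1) → Fin (d + 1) → ℝ := fun i j => E.srcG par N i j z (ε⁻¹ • z)

/-- Dirichlet datum at the upper boundary. -/
def Dplus (x : Fin d → ℝ) : Fin (d + 1) → ℝ := fun i =>
  ∑ k ∈ Finset.range (N + 1), ε ^ ((k : ℤ) - N)
    * (farField (E.U k i) (x, 1) - E.U k i (x, 1) (ε⁻¹ • x, ε⁻¹))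

/-- Neumann datum at the upper boundary. -/
def Nplus (x : Fin d → ℝ) : Fin (d + 1) → Fin (d + 1) → ℝ := fun i j =>
  -∑ k ∈ Finset.range N, ε ^ ((k : ℤ) - N)
    * pdX (Fin.last d) (E.S (k + 1) i j) (x, 1) (ε⁻¹ • x, ε⁻¹)

/-- The term of index `q` in the Taylor expansion of `u_k` (at `y = 0`, evaluated at
`y = -ε H(x/ε)`). -/
def taylorU (k : ℕ) (i : Fin (d + 1)) (x : Fin d → ℝ) (q : ℕ) : ℝ :=
  (-(ε * H (ε⁻¹ • x))) ^ q / (q.factorial : ℝ) * iteratedDeriv q (fun t => E.u k i (x, t)) 0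

/-- The term of index `q` in the Taylor expansion of `(∇H(x/ε) · ∇_x) σ_k + ∂_y σ_k`. -/
def taylorσ (k : ℕ) (i j : Fin (d + 1)) (x : Fin d → ℝ) (q : ℕ) : ℝ :=
  (-(ε * H (ε⁻¹ • x))) ^ q / (q.factorial : ℝ)
    * iteratedDeriv q (E.slopeσ H k i j (ε⁻¹ • x) x) 0

/-- Dirichlet datum at the oscillating boundary; the inner sum runs over `q ≥ N - k + 1`. -/
def Dminus (x : Fin d → ℝ) : Fin (d + 1) → ℝ := fun i =>
  -(ε ^ (-(N : ℤ)) * ∑ k ∈ Finset.range (N + 1), ε ^ k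
    * ∑' n : ℕ, E.taylorU H ε k i x (N - k + 1 + n))

/-- Neumann datum at the oscillating boundary; the inner sum runs over `q ≥ N - k + 1`. -/
def Nminus (x : Fin d → ℝ) : Fin (d + 1) → Fin (d + 1) → ℝ := fun i j =>
  -(ε ^ (-(N : ℤ)) * ∑ k ∈ Finset.range (N + 1), ε ^ k
    * ∑' n : ℕ, E.taylorσ H ε k i j x (N - k + 1 + n))

end Expansion

end RoughChannel

end

/-! Everything rests on one fact (`Expansion.layerDecay`): as Y → ∞ the layer correctors converge at
the rate exp(-Y), together with all derivatives in Z and all horizontal macroscopic derivatives,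
uniformly in z. The hypotheses give much less: ∇U, P, Σ are square integrable for each z separately,
with no uniformity in z.

The rate comes from Poisson's equation. The compensators depend on z alone, so one derivative in Z
removes them: ΔP = div F because div ΔU = 0, Δ∂_jU is a combination of ∂_j∂_iP and ∂_jF, and ∂_lΔΣ
is a multiple of ∂_lG. By strong induction on the order, F and G are polynomial expressions in lower
correctors and bounded macroscopic fields, so their Z-derivatives decay (this is what `Tame`
records). It remains to know that an L², horizontally periodic w with |Δw| ≤ K exp(-Y), and |w| ≤ K
for 0 ≤ Y ≤ 1, is at most C K exp(-Y) with C depending only on d (`decay_of_memLp`). The proof uses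
maximum principles. Doubling the variables bounds the oscillation of w on horizontal slices
(`symm_difference_le`); comparison with almost affine functions on long strips turns this into decay
of w itself when w vanishes at infinity (`upper_decay`); averaging over small boxes replaces
vanishing at infinity by square integrability. Because C depends on d only, the estimate applies
uniformly to difference quotients in any admissible direction of (z, Z), and in the limit to
derivatives (`bddW_Dv`). Thus the macroscopic derivatives are reached although no L² information on
them is given.

The consequences are then short. The sources are bounded fields: for y ≥ 0 by the decay theory, and
for -εH < y < 0 by compactness, since Z then stays in a bounded strip and z close to the slab. At
the top the microscopic height is 1/ε, so the data carry exp(-1/ε), and each x-derivative costs at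
most a factor 1/ε; the far field, a mere limit, is differentiated through a telescoping series
(`Tame.osc_farField`). At the wall, the Taylor tail starting at index N-k+1 is a field vanishing to
that order at y = 0 (`NearWall.flat_taylorTail`). Its trace on y = -εH(x/ε) is O(ε^(N-k+1)), and
each derivative loses at most one power of ε (`Flat.osc_wallTrace`); with the weight ε^(k-N) this
leaves ε^(1-ℓ). -/

noncomputable section

namespace RoughChannel

variable {d : ℕ} {H : (Fin d → ℝ) → ℝ}

/-! ### Regular fields and their directional derivatives -/

/-- A microscopic field as a function on the product space. -/
def unc (W : MicS d) (q : Pt d × Pt d) : ℝ := W q.1 q.2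

/-- The derivative of a microscopic field in the direction `v` of the product space. -/
def Dv (v : Pt d × Pt d) (W : MicS d) : MicS d := fun z Z => fderiv ℝ (unc W) (z, Z) v

/-- The part of a coordinate vector in the horizontal space. -/
def hdir (j : Fin (d + 1)) : Pt d := if j = Fin.last d then 0 else dir j

/-- Fields which agree for macroscopic variables in the channel and microscopic ones in the
boundary layer. -/
def LEq (H : (Fin d → ℝ) → ℝ) (W W' : MicS d) : Prop :=
  ∀ z ∈ slab d, ∀ Z : Pt d, -H Z.1 < Z.2 → W z Z = W' z Z

@[simp] lemma dir_last : (dir (Fin.last d) : Pt d) = (0, 1) := by simp [dir]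

@[simp] lemma dir_castSucc (l : Fin d) : (dir l.castSucc : Pt d) = (Pi.single l 1, 0) := by
  simp [dir]

lemma hdir_snd (j : Fin (d + 1)) : (hdir j : Pt d).2 = 0 := by
  unfold hdir
  split_ifs with h
  · rfl
  · obtain ⟨l, rfl⟩ := Fin.exists_castSucc_eq.2 h
    simp

lemma two_le_infty : (2 : ℕ∞ω) ≤ ∞ := WithTop.coe_le_coe.2 (le_top (a := (2 : ℕ∞)))

lemma RegularMic.contDiffAt {W : MicS d} (h : RegularMic H W) {z Z : Pt d} (hz : z ∈ slab d)
    (hZ : -H Z.1 ≤ Z.2) : ContDiffAt ℝ ∞ (unc W) (z, Z) := h.2.2 z hz Z hZ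

lemma RegularMic.differentiableAt {W : MicS d} (h : RegularMic H W) {z Z : Pt d}
    (hz : z ∈ slab d) (hZ : -H Z.1 ≤ Z.2) : DifferentiableAt ℝ (unc W) (z, Z) :=
  (h.contDiffAt hz hZ).differentiableAt (by simp)

/-- Smoothness at a boundary point concerns a full neighbourhood, including points below the wall or
outside the slab. Hence partial derivatives and `fderiv` of the joint function agree as germs, and
`pdX`, `pdx` preserve regularity up to the boundary. -/
lemma RegularMic.eventually_differentiableAt {W : MicS d} (h : RegularMic H W) {z Z : Pt d}
    (hz : z ∈ slab d) (hZ : -H Z.1 ≤ Z.2) :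
    ∀ᶠ q in 𝓝 (z, Z), DifferentiableAt ℝ (unc W) q := by
  have h1 : ContDiffAt ℝ 1 (unc W) (z, Z) := (h.contDiffAt hz hZ).of_le (by exact_mod_cast le_top)
  filter_upwards [h1.eventually (by simp)] with q hq using hq.differentiableAt (by simp)

lemma pdX_eq_fderiv {W : MicS d} {z Z : Pt d} (h : DifferentiableAt ℝ (unc W) (z, Z))
    (j : Fin (d + 1)) : pdX j W z Z = fderiv ℝ (unc W) (z, Z) (0, dir j) := by
  have h1 : HasFDerivAt (W z) ((fderiv ℝ (unc W) (z, Z)).comp (ContinuousLinearMap.inr ℝ _ _)) Z :=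
    h.hasFDerivAt.comp Z (hasFDerivAt_prodMk_right z Z)
  simp [pdX, pd, h1.fderiv]

lemma pdx_eq_fderiv {W : MicS d} {z Z : Pt d} (h : DifferentiableAt ℝ (unc W) (z, Z))
    (j : Fin (d + 1)) : pdx j W z Z = fderiv ℝ (unc W) (z, Z) (hdir j, 0) := by
  have h1 : HasFDerivAt (fun w => W w Z)
      ((fderiv ℝ (unc W) (z, Z)).comp (ContinuousLinearMap.inl ℝ _ _)) z :=
    HasFDerivAt.comp (g := unc W) (f := fun w => (w, Z)) z h.hasFDerivAt
      (hasFDerivAt_prodMk_left z Z)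
  unfold pdx hdir
  split_ifs with hj
  · rw [show ((0 : Pt d), (0 : Pt d)) = 0 from rfl, map_zero]
  · simp [pd, h1.fderiv]

lemma LEq.symm {W W' : MicS d} (h : LEq H W W') : LEq H W' W := fun z hz Z hZ => (h z hz Z hZ).symm

lemma LEq.trans {W W' W'' : MicS d} (h : LEq H W W') (h' : LEq H W' W'') : LEq H W W'' :=
  fun z hz Z hZ => (h z hz Z hZ).trans (h' z hz Z hZ)

lemma RegularMic.pdX_leq {W : MicS d} (h : RegularMic H W) (j : Fin (d + 1)) :
    LEq H (pdX j W) (Dv (0, dir j) W) := fun _ hz _ hZ =>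
  pdX_eq_fderiv (h.differentiableAt hz hZ.le) j

lemma RegularMic.pdx_leq {W : MicS d} (h : RegularMic H W) (j : Fin (d + 1)) :
    LEq H (pdx j W) (Dv (hdir j, 0) W) := fun _ hz _ hZ =>
  pdx_eq_fderiv (h.differentiableAt hz hZ.le) j

lemma RegularMic.shift_fst {W : MicS d} (h : RegularMic H W) (l : Fin d) (z : Pt d) :
    W (z + dir l.castSucc) = W z := funext fun Z => h.2.1 Z z l

lemma RegularMic.unc_shift_fst {W : MicS d} (h : RegularMic H W) (l : Fin d) :
    (fun q => unc W (q + (dir l.castSucc, 0))) = unc W := by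
  funext q
  simp only [unc, Prod.fst_add, Prod.snd_add, add_zero]
  rw [h.shift_fst]

lemma RegularMic.unc_shift_snd {W : MicS d} (h : RegularMic H W) (l : Fin d) :
    (fun q => unc W (q + (0, dir l.castSucc))) = unc W := by
  funext q
  simp only [unc, Prod.fst_add, Prod.snd_add, add_zero]
  exact h.1 _ _ l

lemma RegularMic.Dv {W : MicS d} (h : RegularMic H W) (v : Pt d × Pt d) :
    RegularMic H (Dv v W) := by
  refine ⟨fun z Z l => ?_, fun Z z l => ?_, fun z hz Z hZ => ?_⟩
  · have := fderiv_comp_add_right (𝕜 := ℝ) (f := unc W) (x := (z, Z)) (0, dir l.castSucc)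
    rw [h.unc_shift_snd] at this
    simp only [RoughChannel.Dv, this, Prod.mk_add_mk, add_zero]
  · have := fderiv_comp_add_right (𝕜 := ℝ) (f := unc W) (x := (z, Z)) (dir l.castSucc, 0)
    rw [h.unc_shift_fst] at this
    simp only [RoughChannel.Dv, this, Prod.mk_add_mk, add_zero]
  · exact ((h.contDiffAt hz hZ).fderiv_right (m := ∞) (by simp)).clm_apply contDiffAt_const

lemma RegularMic.of_eventuallyEq {W W' : MicS d} (h : RegularMic H W)
    (h1 : ∀ z, XPeriodic (W' z)) (h2 : ∀ Z, XPeriodic fun z => W' z Z)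
    (h3 : ∀ z ∈ slab d, ∀ Z : Pt d, -H Z.1 ≤ Z.2 → unc W' =ᶠ[𝓝 (z, Z)] unc W) :
    RegularMic H W' :=
  ⟨h1, h2, fun z hz Z hZ => (h.contDiffAt hz hZ).congr_of_eventuallyEq (h3 z hz Z hZ)⟩

lemma XPeriodic.pd {g : Pt d → ℝ} (h : XPeriodic g) (j : Fin (d + 1)) : XPeriodic (pd j g) := by
  intro z l
  have := fderiv_comp_add_right (𝕜 := ℝ) (f := g) (x := z) (dir l.castSucc)
  rw [show (fun x => g (x + dir l.castSucc)) = g from funext fun x => h x l] at this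
  simp only [RoughChannel.pd, this]

lemma RegularMic.pdX {W : MicS d} (h : RegularMic H W) (j : Fin (d + 1)) :
    RegularMic H (pdX j W) := by
  refine (h.Dv (0, dir j)).of_eventuallyEq (fun z => (h.1 z).pd j) (fun Z z l => ?_)
    fun z hz Z hZ => ?_
  · simp only [RoughChannel.pdX, h.shift_fst]
  · filter_upwards [h.eventually_differentiableAt hz hZ] with q hq
    exact pdX_eq_fderiv hq j

lemma RegularMic.pdx {W : MicS d} (h : RegularMic H W) (j : Fin (d + 1)) :
    RegularMic H (pdx j W) := by
  refine (h.Dv (hdir j, 0)).of_eventuallyEq (fun z Z l => ?_) (fun Z z l => ?_)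
    fun z hz Z hZ => ?_
  · simp only [RoughChannel.pdx, h.1 _ Z l]
  · simp only [RoughChannel.pdx]
    split_ifs
    · rfl
    · exact (h.2.1 Z).pd j z l
  · filter_upwards [h.eventually_differentiableAt hz hZ] with q hq
    exact pdx_eq_fderiv hq j

lemma RegularMic.add {W W' : MicS d} (h : RegularMic H W) (h' : RegularMic H W') :
    RegularMic H (fun z Z => W z Z + W' z Z) :=
  ⟨fun z Z l => by simp only [h.1 z Z l, h'.1 z Z l],
    fun Z z l => by simp only [h.2.1 Z z l, h'.2.1 Z z l],
    fun z hz Z hZ => (h.contDiffAt hz hZ).add (h'.contDiffAt hz hZ)⟩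

lemma RegularMic.mul {W W' : MicS d} (h : RegularMic H W) (h' : RegularMic H W') :
    RegularMic H (fun z Z => W z Z * W' z Z) :=
  ⟨fun z Z l => by simp only [h.1 z Z l, h'.1 z Z l],
    fun Z z l => by simp only [h.2.1 Z z l, h'.2.1 Z z l],
    fun z hz Z hZ => (h.contDiffAt hz hZ).mul (h'.contDiffAt hz hZ)⟩

lemma RegularMic.const (c : ℝ) : RegularMic (d := d) H (fun _ _ => c) :=
  ⟨fun _ _ _ => rfl, fun _ _ _ => rfl, fun _ _ _ _ => contDiffAt_const⟩

lemma RegularMac.regularMic {g : MacS d} (h : RegularMac g) : RegularMic H (fun z _ => g z) :=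
  ⟨fun _ _ _ => rfl, fun _ z l => h.1 z l, fun z hz Z _ =>
    ContDiffAt.comp (z, Z) (g := g) (f := Prod.fst) ((h.2 z hz).contDiffAt) contDiffAt_fst⟩

lemma RegularMac.pd {g : MacS d} (h : RegularMac g) (j : Fin (d + 1)) : RegularMac (pd j g) :=
  ⟨h.1.pd j, fun z hz =>
    ((ContinuousLinearMap.apply ℝ ℝ (dir j : Pt d)).analyticAt _).comp (h.2 z hz).fderiv⟩

/-! ### Lines in the product space -/

lemma add_smul_mem_slab {z a : Pt d} (hz : z ∈ slab d) (ha : a.2 = 0) (t : ℝ) :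
    z + t • a ∈ slab d := by
  simpa [slab, ha] using hz

lemma hasDerivAt_line {W : MicS d} {z Z : Pt d} (v : Pt d × Pt d) (t : ℝ)
    (h : DifferentiableAt ℝ (unc W) (z + t • v.1, Z + t • v.2)) :
    HasDerivAt (fun s : ℝ => W (z + s • v.1) (Z + s • v.2))
      (Dv v W (z + t • v.1) (Z + t • v.2)) t := by
  have h1 : HasDerivAt (fun s : ℝ => (z, Z) + s • v) v t := by
    simpa using ((hasDerivAt_id t).smul_const v).const_add (z, Z)
  have h2 : HasFDerivAt (unc W) (fderiv ℝ (unc W) (z + t • v.1, Z + t • v.2)) ((z, Z) + t • v) :=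
    h.hasFDerivAt
  exact h2.comp_hasDerivAt t h1

/-- The two fields coincide along a short segment in the direction v: the layer is open, and v.1.2 =
0 keeps z in the slab even when y = 0 or y = 1. A vertical macroscopic direction would leave the set
where equality is known, which is why the whole calculus admits only horizontal ones. -/
lemma LEq.Dv (hHc : Continuous H) {W W' : MicS d} (h : LEq H W W') (hW : RegularMic H W)
    (hW' : RegularMic H W') {v : Pt d × Pt d} (hv : v.1.2 = 0) : LEq H (Dv v W) (Dv v W') := by
  intro z hz Z hZ
  have e : (z + (0 : ℝ) • v.1, Z + (0 : ℝ) • v.2) = (z, Z) := by simp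
  have h1 := hasDerivAt_line v 0 (by rw [e]; exact hW.differentiableAt hz hZ.le)
  have h2 := hasDerivAt_line v 0 (by rw [e]; exact hW'.differentiableAt hz hZ.le)
  have h3 : (fun s : ℝ => W (z + s • v.1) (Z + s • v.2)) =ᶠ[𝓝 0]
      fun s : ℝ => W' (z + s • v.1) (Z + s • v.2) := by
    have hc : Continuous fun s : ℝ => Z + s • v.2 := by fun_prop
    have ho : IsOpen {Z : Pt d | -H Z.1 < Z.2} :=
      isOpen_lt (hHc.comp continuous_fst).neg continuous_snd
    have : ∀ᶠ s : ℝ in 𝓝 0, Z + s • v.2 ∈ {Z : Pt d | -H Z.1 < Z.2} :=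
      hc.continuousAt.eventually_mem (by simpa using ho.mem_nhds hZ)
    filter_upwards [this] with s hs using h _ (add_smul_mem_slab hz hv s) _ hs
  simpa using h1.unique (h2.congr_of_eventuallyEq h3)

lemma Dv_comm {W : MicS d} (h : RegularMic H W) (v w : Pt d × Pt d) :
    LEq H (Dv v (Dv w W)) (Dv w (Dv v W)) := by
  intro z hz Z hZ
  have hc := h.contDiffAt hz hZ.le
  have hd : DifferentiableAt ℝ (fderiv ℝ (unc W)) (z, Z) :=
    (hc.fderiv_right (m := ∞) (by simp)).differentiableAt (by simp)
  have key : ∀ v w : Pt d × Pt d, Dv v (Dv w W) z Z = fderiv ℝ (fderiv ℝ (unc W)) (z, Z) v w := by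
    intro v w
    have : HasFDerivAt (unc (Dv w W))
        ((ContinuousLinearMap.apply ℝ ℝ w).comp (fderiv ℝ (fderiv ℝ (unc W)) (z, Z))) (z, Z) :=
      ((ContinuousLinearMap.apply ℝ ℝ w).hasFDerivAt).comp (z, Z) hd.hasFDerivAt
    change fderiv ℝ (unc (Dv w W)) (z, Z) v = _
    rw [this.fderiv]
    rfl
  rw [key, key]
  exact (hc.isSymmSndFDerivAt (by
    rw [minSmoothness_of_isRCLikeNormedField]; exact two_le_infty)) v w

lemma Dv_add {W W' : MicS d} (h : RegularMic H W) (h' : RegularMic H W') (v : Pt d × Pt d) :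
    LEq H (Dv v (fun z Z => W z Z + W' z Z)) (fun z Z => Dv v W z Z + Dv v W' z Z) := by
  intro z hz Z hZ
  have := ((h.differentiableAt hz hZ.le).hasFDerivAt.add
    (h'.differentiableAt hz hZ.le).hasFDerivAt).fderiv
  change fderiv ℝ (unc W + unc W') (z, Z) v = _
  rw [this]
  rfl

lemma Dv_mul {W W' : MicS d} (h : RegularMic H W) (h' : RegularMic H W') (v : Pt d × Pt d) :
    LEq H (Dv v (fun z Z => W z Z * W' z Z))
      (fun z Z => Dv v W z Z * W' z Z + W z Z * Dv v W' z Z) := by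
  intro z hz Z hZ
  have := ((h.differentiableAt hz hZ.le).hasFDerivAt.mul
    (h'.differentiableAt hz hZ.le).hasFDerivAt).fderiv
  change fderiv ℝ (unc W * unc W') (z, Z) v = _
  rw [this]
  simp [unc, Dv, mul_comm, add_comm]

lemma Dv_const (c : ℝ) (v : Pt d × Pt d) : Dv (d := d) v (fun _ _ => c) = fun _ _ => 0 := by
  funext z Z
  change fderiv ℝ (fun _ => c) (z, Z) v = 0
  simp

/-! ### Bounds on compact sets of microscopic variables -/

lemma periodic_int_shift {α : Type} {g : Pt d → α}
    (hg : ∀ (z : Pt d) (l : Fin d), g (z + dir l.castSucc) = g z) (n : Fin d → ℤ) (Z : Pt d) :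
    g (Z + ((fun l => (n l : ℝ)), 0)) = g Z := by
  have hsum : ∀ (s : Finset (Fin d)) (z : Pt d),
      g (z + ∑ l ∈ s, n l • dir l.castSucc) = g z := by
    intro s
    induction s using Finset.induction_on with
    | empty => simp
    | insert a s ha ih =>
      intro z
      have hp : Function.Periodic g (dir a.castSucc) := fun z => hg z a
      rw [Finset.sum_insert ha, ← add_assoc, ih, hp.zsmul (n a)]
  rw [← hsum Finset.univ Z]
  congr 2
  refine Prod.ext (funext fun l => ?_) ?_
  · simp [Prod.fst_sum, Finset.sum_apply, Pi.single_apply]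
  · simp [Prod.snd_sum]

/-- One representative serves all periodic functions at once, with values in any type, so tuples of
numbers and propositions can be transported together. -/
lemma exists_mem_Icc_of_periodic (Z : Pt d) : ∃ X ∈ Icc (0 : Fin d → ℝ) 1,
    ∀ {α : Type} (g : Pt d → α), (∀ (z : Pt d) (l : Fin d), g (z + dir l.castSucc) = g z) →
      g Z = g (X, Z.2) := by
  refine ⟨fun l => Int.fract (Z.1 l), ⟨fun l => Int.fract_nonneg _, fun l => (Int.fract_lt_one _).le⟩,
    fun {α} g hg => ?_⟩
  rw [← periodic_int_shift hg (fun l => -⌊Z.1 l⌋) Z]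
  congr 1
  refine Prod.ext (funext fun l => ?_) (by simp)
  simp [Int.fract, sub_eq_add_neg]

/-- The rough channel reaches below y = 0, where no regularity is assumed. Regularity at y = 0 holds
on neighbourhoods, and compactness of a period cell makes their size uniform. Continuity is recorded
as well since it later gives measurability. -/
lemma RegularMic.exists_bound (hHc : Continuous H)
    (hHp : ∀ (X : Fin d → ℝ) (l : Fin d), H (X + Pi.single l 1) = H X)
    {W : MicS d} (h : RegularMic H W) (R : ℝ) :
    ∃ δ > 0, ∃ C, ∀ z : Pt d, -δ < z.2 → z.2 ≤ 1 → ∀ Z : Pt d, -H Z.1 ≤ Z.2 → Z.2 ≤ R →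
      ContinuousAt (unc W) (z, Z) ∧ |W z Z| ≤ C := by
  obtain ⟨M, hM⟩ := (isCompact_Icc (a := (0 : Fin d → ℝ)) (b := 1)).bddAbove_image hHc.continuousOn
  set K : Set (Pt d × Pt d) := {q | q.1 ∈ Icc (0 : Fin d → ℝ) 1 ×ˢ Icc (0 : ℝ) 1 ∧
    q.2.1 ∈ Icc (0 : Fin d → ℝ) 1 ∧ -H q.2.1 ≤ q.2.2 ∧ q.2.2 ≤ R} with hKdef
  have hK : IsCompact K := by
    have hc : IsCompact ((Icc (0 : Fin d → ℝ) 1 ×ˢ Icc (0 : ℝ) 1) ×ˢ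
        (Icc (0 : Fin d → ℝ) 1 ×ˢ Icc (-M) R)) :=
      (isCompact_Icc.prod isCompact_Icc).prod (isCompact_Icc.prod isCompact_Icc)
    refine hc.of_isClosed_subset ?_ ?_
    · refine IsClosed.inter ((isClosed_Icc.prod isClosed_Icc).preimage continuous_fst) ?_
      refine IsClosed.inter (isClosed_Icc.preimage (by fun_prop)) ?_
      refine IsClosed.inter ?_ ?_
      · exact isClosed_le (f := fun q : Pt d × Pt d => -H q.2.1) (g := fun q => q.2.2)
          (by fun_prop) (by fun_prop)
      · exact isClosed_le (f := fun q : Pt d × Pt d => q.2.2) (by fun_prop) (by fun_prop)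
    · rintro q ⟨h1, h2, h3, h4⟩
      exact ⟨h1, h2, by have := hM (mem_image_of_mem H h2); linarith, h4⟩
  have hloc : ∀ q ∈ K, ∃ C, ∀ᶠ q' in 𝓝 q, ContinuousAt (unc W) q' ∧ |unc W q'| ≤ C := by
    rintro ⟨z, Z⟩ ⟨h1, _, h3, _⟩
    have hc := h.contDiffAt (z := z) ⟨h1.2.1, h1.2.2⟩ h3
    refine ⟨|unc W (z, Z)| + 1, ?_⟩
    have := hc.continuousAt.abs.eventually_lt_const (lt_add_one |unc W (z, Z)|)
    filter_upwards [this, h.eventually_differentiableAt (z := z) ⟨h1.2.1, h1.2.2⟩ h3] with q h1 h2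
    exact ⟨h2.continuousAt, h1.le⟩
  -- Compactness in the form of induction on subsets of K: the local bounds merge into one valid on
  -- a neighbourhood of K.
  have hglob : ∃ C, ∀ᶠ q' in 𝓝ˢ K, ContinuousAt (unc W) q' ∧ |unc W q'| ≤ C := by
    refine hK.induction_on (p := fun s => ∃ C, ∀ᶠ q' in 𝓝ˢ s, ContinuousAt (unc W) q' ∧
      |unc W q'| ≤ C) ⟨0, by simp⟩ ?_ ?_ ?_
    · rintro s t hst ⟨C, hC⟩
      exact ⟨C, hC.filter_mono (nhdsSet_mono hst)⟩
    · rintro s t ⟨C, hC⟩ ⟨C', hC'⟩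
      refine ⟨max C C', ?_⟩
      rw [nhdsSet_union, eventually_sup]
      exact ⟨hC.mono fun q hq => ⟨hq.1, hq.2.trans (le_max_left _ _)⟩,
        hC'.mono fun q hq => ⟨hq.1, hq.2.trans (le_max_right _ _)⟩⟩
    · intro q hq
      obtain ⟨C, hC⟩ := hloc q hq
      exact ⟨_, mem_nhdsWithin_of_mem_nhds (eventually_eventually_nhds.2 hC), C,
        eventually_nhdsSet_iff_forall.2 fun y hy => hy⟩
  obtain ⟨C, hC⟩ := hglob
  obtain ⟨V, hVo, hKV, hV⟩ := eventually_nhdsSet_iff_exists.1 hC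
  obtain ⟨δ, hδ, hδV⟩ := hK.exists_thickening_subset_open hVo hKV
  refine ⟨δ, hδ, C, fun z hz1 hz2 Z hZ1 hZ2 => ?_⟩
  obtain ⟨x, hx, hxg⟩ := exists_mem_Icc_of_periodic z
  obtain ⟨X, hX, hXg⟩ := exists_mem_Icc_of_periodic Z
  have e1 := hXg (fun Z => (H Z.1, ContinuousAt (unc W) (z, Z), W z Z)) (by
    intro Z l
    have h1 : ContinuousAt (unc W) (z, Z + dir l.castSucc) ↔ ContinuousAt (unc W) (z, Z) := by
      conv_rhs => rw [← h.unc_shift_snd l]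
      have := (Homeomorph.addRight ((0 : Pt d), (dir l.castSucc : Pt d))).comp_continuousAt_iff'
        (unc W) (z, Z)
      simpa [Function.comp_def] using this.symm
    simp only [h1, h.1 z Z l]
    simp [hHp])
  have e2 := hxg (fun z => (ContinuousAt (unc W) (z, (X, Z.2)), W z (X, Z.2))) (by
    intro z l
    have h1 : ContinuousAt (unc W) (z + dir l.castSucc, (X, Z.2)) ↔
        ContinuousAt (unc W) (z, (X, Z.2)) := by
      conv_rhs => rw [← h.unc_shift_fst l]
      have := (Homeomorph.addRight ((dir l.castSucc : Pt d), (0 : Pt d))).comp_continuousAt_iff'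
        (unc W) (z, (X, Z.2))
      simpa [Function.comp_def] using this.symm
    simp only [h1, h.shift_fst])
  simp only [Prod.mk.injEq] at e1 e2
  rw [e1.2.1, e1.2.2, e2.1, e2.2]
  -- Raising a negative height to 0 moves the point by less than δ and puts it in K.
  refine hV _ (hδV (Metric.mem_thickening_iff.2 ⟨((x, max z.2 0), (X, Z.2)), ?_, ?_⟩))
  · exact ⟨⟨hx, le_max_right _ _, max_le hz2 zero_le_one⟩, hX, by rw [← e1.1]; exact hZ1, hZ2⟩
  · rw [Prod.dist_eq, dist_self, Prod.dist_eq, dist_self]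
    simp only [Real.dist_eq, max_lt_iff, hδ, and_true, true_and]
    rcases le_total z.2 0 with h0 | h0
    · rw [max_eq_right h0, sub_zero, abs_of_nonpos h0]; linarith
    · rw [max_eq_left h0, sub_self, abs_zero]; exact hδ

lemma RegularMic.exists_bound_slab (hHc : Continuous H)
    (hHp : ∀ (X : Fin d → ℝ) (l : Fin d), H (X + Pi.single l 1) = H X)
    {W : MicS d} (h : RegularMic H W) (R : ℝ) :
    ∃ C, ∀ z ∈ slab d, ∀ Z : Pt d, -H Z.1 ≤ Z.2 → Z.2 ≤ R → |W z Z| ≤ C := by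
  obtain ⟨δ, hδ, C, hC⟩ := h.exists_bound hHc hHp R
  exact ⟨C, fun z hz Z h1 h2 => (hC z (by have := hz.1; linarith) hz.2 Z h1 h2).2⟩

end RoughChannel

end

noncomputable section

namespace RoughChannel

variable {d : ℕ} {H : (Fin d → ℝ) → ℝ}

/-! ### Exponentially decaying and exponentially convergent fields -/

/-- The standing assumptions on the rough wall. -/
structure Wall (H : (Fin d → ℝ) → ℝ) : Prop where
  cont : Continuous H
  per : ∀ (X : Fin d → ℝ) (l : Fin d), H (X + Pi.single l 1) = H X
  pos : ∀ X, 0 < H X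

lemma Wall.lt_of_nonneg (hH : Wall H) {Z : Pt d} (hZ : 0 ≤ Z.2) : -H Z.1 < Z.2 := by
  have := hH.pos Z.1
  linarith

/-- A field bounded by a multiple of `exp (-κ Y)`. -/
def BddW (κ : ℝ) (W : MicS d) : Prop :=
  ∃ C, 0 ≤ C ∧ ∀ z ∈ slab d, ∀ Z : Pt d, 0 ≤ Z.2 → |W z Z| ≤ C * Real.exp (-(κ * Z.2))

/-- All derivatives of order at most `n` are bounded by multiples of `exp (-κ Y)`; macroscopic
derivatives are horizontal. -/
def DecN (κ : ℝ) : ℕ → MicS d → Prop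
  | 0, W => BddW κ W
  | n + 1, W => BddW κ W ∧ ∀ v : Pt d × Pt d, v.1.2 = 0 → DecN κ n (Dv v W)

/-- All derivatives are bounded by multiples of `exp (-κ Y)`. -/
structure Decays (H : (Fin d → ℝ) → ℝ) (κ : ℝ) (W : MicS d) : Prop where
  reg : RegularMic H W
  bd : ∀ n, DecN κ n W

/-- All derivatives are bounded, those involving a microscopic derivative decay like
`exp (-Y)`. -/
structure Tame (H : (Fin d → ℝ) → ℝ) (W : MicS d) : Prop where
  bdd : Decays H 0 W
  dec : ∀ b : Pt d, Decays H 1 (Dv (0, b) W)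

lemma BddW.congr (hH : Wall H) {κ : ℝ} {W W' : MicS d} (h : BddW κ W) (he : LEq H W W') :
    BddW κ W' := by
  obtain ⟨C, hC, h⟩ := h
  exact ⟨C, hC, fun z hz Z hZ => by rw [← he z hz Z (hH.lt_of_nonneg hZ)]; exact h z hz Z hZ⟩

lemma BddW.add {κ : ℝ} {W W' : MicS d} (h : BddW κ W) (h' : BddW κ W') :
    BddW κ (fun z Z => W z Z + W' z Z) := by
  obtain ⟨C, hC, h⟩ := h
  obtain ⟨C', hC', h'⟩ := h'
  refine ⟨C + C', by positivity, fun z hz Z hZ => (abs_add_le _ _).trans ?_⟩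
  rw [add_mul]
  exact add_le_add (h z hz Z hZ) (h' z hz Z hZ)

lemma BddW.mul {κ κ' : ℝ} {W W' : MicS d} (h : BddW κ W) (h' : BddW κ' W') :
    BddW (κ + κ') (fun z Z => W z Z * W' z Z) := by
  obtain ⟨C, hC, h⟩ := h
  obtain ⟨C', hC', h'⟩ := h'
  refine ⟨C * C', by positivity, fun z hz Z hZ => ?_⟩
  rw [abs_mul, show -((κ + κ') * Z.2) = -(κ * Z.2) + -(κ' * Z.2) by ring, Real.exp_add,
    mul_mul_mul_comm]
  exact mul_le_mul (h z hz Z hZ) (h' z hz Z hZ) (abs_nonneg _) (by positivity)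

lemma BddW.mono {κ κ' : ℝ} (hκ : κ' ≤ κ) {W : MicS d} (h : BddW κ W) : BddW κ' W := by
  obtain ⟨C, hC, h⟩ := h
  refine ⟨C, hC, fun z hz Z hZ => (h z hz Z hZ).trans ?_⟩
  gcongr

lemma DecN.mono {κ κ' : ℝ} (hκ : κ' ≤ κ) {n : ℕ} {W : MicS d} (h : DecN κ n W) : DecN κ' n W := by
  induction n generalizing W with
  | zero => exact BddW.mono hκ h
  | succ n ih => exact ⟨h.1.mono hκ, fun v hv => ih (h.2 v hv)⟩

lemma DecN.congr (hH : Wall H) {κ : ℝ} {n : ℕ} {W W' : MicS d} (h : DecN κ n W)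
    (hW : RegularMic H W) (hW' : RegularMic H W') (he : LEq H W W') : DecN κ n W' := by
  induction n generalizing W W' with
  | zero => exact BddW.congr hH h he
  | succ n ih =>
    exact ⟨h.1.congr hH he, fun v hv => ih (h.2 v hv) (hW.Dv v) (hW'.Dv v)
      (he.Dv hH.cont hW hW' hv)⟩

lemma DecN.of_succ {κ : ℝ} {n : ℕ} {W : MicS d} (h : DecN κ (n + 1) W) : DecN κ n W := by
  induction n generalizing W with
  | zero => exact h.1
  | succ n ih => exact ⟨h.1, fun v hv => ih (h.2 v hv)⟩

lemma DecN.add (hH : Wall H) {κ : ℝ} {n : ℕ} {W W' : MicS d} (h : DecN κ n W)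
    (h' : DecN κ n W') (hW : RegularMic H W) (hW' : RegularMic H W') :
    DecN κ n (fun z Z => W z Z + W' z Z) := by
  induction n generalizing W W' with
  | zero => exact BddW.add h h'
  | succ n ih =>
    refine ⟨h.1.add h'.1, fun v hv => ?_⟩
    exact (ih (h.2 v hv) (h'.2 v hv) (hW.Dv v) (hW'.Dv v)).congr hH
      ((hW.Dv v).add (hW'.Dv v)) ((hW.add hW').Dv v) (Dv_add hW hW' v).symm

lemma DecN.mul (hH : Wall H) {κ κ' : ℝ} {n : ℕ} {W W' : MicS d} (h : DecN κ n W)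
    (h' : DecN κ' n W') (hW : RegularMic H W) (hW' : RegularMic H W') :
    DecN (κ + κ') n (fun z Z => W z Z * W' z Z) := by
  induction n generalizing W W' with
  | zero => exact BddW.mul h h'
  | succ n ih =>
    refine ⟨h.1.mul h'.1, fun v hv => ?_⟩
    have h1 := ih (h.2 v hv) h'.of_succ (hW.Dv v) hW'
    have h2 := ih h.of_succ (h'.2 v hv) hW (hW'.Dv v)
    exact (h1.add hH h2 ((hW.Dv v).mul hW') (hW.mul (hW'.Dv v))).congr hH
      (((hW.Dv v).mul hW').add (hW.mul (hW'.Dv v))) ((hW.mul hW').Dv v) (Dv_mul hW hW' v).symm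

lemma DecN.zero (κ : ℝ) (n : ℕ) : DecN (d := d) κ n (fun _ _ => 0) := by
  induction n with
  | zero => exact ⟨0, le_rfl, fun z _ Z _ => by simp⟩
  | succ n ih => exact ⟨⟨0, le_rfl, fun z _ Z _ => by simp⟩, fun v _ => by rw [Dv_const]; exact ih⟩

lemma DecN.const (c : ℝ) (n : ℕ) : DecN (d := d) 0 n (fun _ _ => c) := by
  cases n with
  | zero => exact ⟨|c|, abs_nonneg _, fun z _ Z _ => by simp⟩
  | succ n =>
    exact ⟨⟨|c|, abs_nonneg _, fun z _ Z _ => by simp⟩, fun v _ => by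
      rw [Dv_const]; exact DecN.zero 0 n⟩

/-! ### Algebra of decaying and of tame fields -/

namespace Decays

variable {κ κ' : ℝ} {W W' : MicS d}

lemma bddW (h : Decays H κ W) : BddW κ W := h.bd 0

lemma Dv (h : Decays H κ W) {v : Pt d × Pt d} (hv : v.1.2 = 0) : Decays H κ (Dv v W) :=
  ⟨h.reg.Dv v, fun n => (h.bd (n + 1)).2 v hv⟩

lemma congr (hH : Wall H) (h : Decays H κ W) (hW' : RegularMic H W') (he : LEq H W W') :
    Decays H κ W' := ⟨hW', fun n => (h.bd n).congr hH h.reg hW' he⟩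

lemma mono (h : Decays H κ W) (hκ : κ' ≤ κ) : Decays H κ' W := ⟨h.reg, fun n => (h.bd n).mono hκ⟩

lemma add (hH : Wall H) (h : Decays H κ W) (h' : Decays H κ W') :
    Decays H κ (fun z Z => W z Z + W' z Z) :=
  ⟨h.reg.add h'.reg, fun n => (h.bd n).add hH (h'.bd n) h.reg h'.reg⟩

lemma mul (hH : Wall H) (h : Decays H κ W) (h' : Decays H κ' W') :
    Decays H (κ + κ') (fun z Z => W z Z * W' z Z) :=
  ⟨h.reg.mul h'.reg, fun n => (h.bd n).mul hH (h'.bd n) h.reg h'.reg⟩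

lemma zero (κ : ℝ) : Decays H κ (fun _ _ => 0) := ⟨.const 0, DecN.zero κ⟩

lemma const (c : ℝ) : Decays H 0 (fun _ _ => c) := ⟨.const c, DecN.const c⟩

lemma const_mul (hH : Wall H) (c : ℝ) (h : Decays H κ W) : Decays H κ (fun z Z => c * W z Z) := by
  simpa using (Decays.const c).mul hH h

lemma sum (hH : Wall H) {ι : Type*} (s : Finset ι) {F : ι → MicS d}
    (h : ∀ i ∈ s, Decays H κ (F i)) : Decays H κ (fun z Z => ∑ i ∈ s, F i z Z) := by
  classical
  induction s using Finset.induction_on with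
  | empty => simpa using Decays.zero κ
  | insert a s ha ih =>
    simp only [Finset.sum_insert ha]
    exact (h a (by simp)).add hH (ih fun i hi => h i (by simp [hi]))

lemma pdX (hH : Wall H) (h : Decays H κ W) (j : Fin (d + 1)) : Decays H κ (pdX j W) :=
  (h.Dv (v := (0, dir j)) rfl).congr hH (h.reg.pdX j) (h.reg.pdX_leq j).symm

end Decays

lemma RegularMac.fderiv_apply {g : MacS d} (h : RegularMac g) (a : Pt d) :
    RegularMac (fun z => fderiv ℝ g z a) := by
  refine ⟨fun z l => ?_, fun z hz => ((ContinuousLinearMap.apply ℝ ℝ a).analyticAt _).comp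
    (h.2 z hz).fderiv⟩
  have := fderiv_comp_add_right (𝕜 := ℝ) (f := g) (x := z) (dir l.castSucc)
  rw [show (fun x => g (x + dir l.castSucc)) = g from funext fun x => h.1 x l] at this
  simp only [this]

lemma RegularMac.decN (hH : Wall H) {g : MacS d} (h : RegularMac g) (n : ℕ) :
    DecN 0 n (fun z _ => g z) := by
  have hb : ∀ {g : MacS d}, RegularMac g → BddW 0 (fun z (_ : Pt d) => g z) := by
    intro g h
    obtain ⟨C, hC⟩ := (h.regularMic (H := H)).exists_bound_slab hH.cont hH.per 0
    refine ⟨|C|, abs_nonneg _, fun z hz Z _ => ?_⟩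
    have := hC z hz (0, 0) (by simpa using (hH.pos 0).le) le_rfl
    simpa using this.trans (le_abs_self C)
  induction n generalizing g with
  | zero => exact hb h
  | succ n ih =>
    refine ⟨hb h, fun v hv => (ih (h.fderiv_apply v.1)).congr hH (h.fderiv_apply v.1).regularMic
      (h.regularMic.Dv v) fun z hz Z _ => ?_⟩
    have : HasFDerivAt (unc fun z _ => g z) ((fderiv ℝ g z).comp (ContinuousLinearMap.fst ℝ _ _))
        (z, Z) :=
      HasFDerivAt.comp (g := g) (f := Prod.fst) (z, Z) (h.2 z hz).differentiableAt.hasFDerivAt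
        hasFDerivAt_fst
    simp [RoughChannel.Dv, this.fderiv]

lemma RegularMac.decays (hH : Wall H) {g : MacS d} (h : RegularMac g) :
    Decays H 0 (fun z _ => g z) := ⟨h.regularMic, h.decN hH⟩

namespace Tame

variable {W W' : MicS d}

lemma congr (hH : Wall H) (h : Tame H W) (hW' : RegularMic H W') (he : LEq H W W') : Tame H W' :=
  ⟨h.bdd.congr hH hW' he, fun b => (h.dec b).congr hH (hW'.Dv _) (he.Dv hH.cont h.bdd.reg hW' rfl)⟩

lemma add (hH : Wall H) (h : Tame H W) (h' : Tame H W') : Tame H (fun z Z => W z Z + W' z Z) :=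
  ⟨h.bdd.add hH h'.bdd, fun b => ((h.dec b).add hH (h'.dec b)).congr hH
    ((h.bdd.reg.add h'.bdd.reg).Dv _) (Dv_add h.bdd.reg h'.bdd.reg _).symm⟩

/-- Each Leibniz term of a microscopic derivative has one decaying and one bounded factor, so
nothing need be known about the limits at infinity. -/
lemma mul (hH : Wall H) (h : Tame H W) (h' : Tame H W') : Tame H (fun z Z => W z Z * W' z Z) := by
  refine ⟨by simpa using h.bdd.mul hH h'.bdd, fun b => ?_⟩
  have h1 := (h.dec b).mul hH h'.bdd
  have h2 := h.bdd.mul hH (h'.dec b)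
  rw [add_zero] at h1
  rw [zero_add] at h2
  exact (h1.add hH h2).congr hH ((h.bdd.reg.mul h'.bdd.reg).Dv _)
    (Dv_mul h.bdd.reg h'.bdd.reg _).symm

lemma const (c : ℝ) : Tame H (fun _ _ => c) :=
  ⟨.const c, fun b => by rw [Dv_const]; exact .zero 1⟩

lemma const_mul (hH : Wall H) (c : ℝ) (h : Tame H W) : Tame H (fun z Z => c * W z Z) :=
  (const c).mul hH h

lemma neg (hH : Wall H) (h : Tame H W) : Tame H (fun z Z => -W z Z) := by
  simpa using h.const_mul hH (-1)

lemma sub (hH : Wall H) (h : Tame H W) (h' : Tame H W') : Tame H (fun z Z => W z Z - W' z Z) := by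
  simpa [sub_eq_add_neg] using h.add hH (h'.neg hH)

lemma sum (hH : Wall H) {ι : Type*} (s : Finset ι) {F : ι → MicS d}
    (h : ∀ i ∈ s, Tame H (F i)) : Tame H (fun z Z => ∑ i ∈ s, F i z Z) := by
  classical
  induction s using Finset.induction_on with
  | empty => simpa using const 0
  | insert a s ha ih =>
    simp only [Finset.sum_insert ha]
    exact (h a (by simp)).add hH (ih fun i hi => h i (by simp [hi]))

end Tame

lemma Decays.tame (h : Decays H 1 W) : Tame H W := ⟨h.mono zero_le_one, fun _ => h.Dv rfl⟩

namespace Tame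

variable {W : MicS d}

/-- Derivatives commute, so the microscopic derivative can be taken first, and it already decays
with all its derivatives. -/
lemma Dv (hH : Wall H) (h : Tame H W) {v : Pt d × Pt d} (hv : v.1.2 = 0) : Tame H (Dv v W) :=
  ⟨h.bdd.Dv hv, fun b => ((h.dec b).Dv hv).congr hH ((h.bdd.reg.Dv v).Dv _)
    (Dv_comm h.bdd.reg _ _)⟩

lemma decays_pdX (hH : Wall H) (h : Tame H W) (j : Fin (d + 1)) : Decays H 1 (pdX j W) :=
  (h.dec (dir j)).congr hH (h.bdd.reg.pdX j) (h.bdd.reg.pdX_leq j).symm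

lemma pdX (hH : Wall H) (h : Tame H W) (j : Fin (d + 1)) : Tame H (pdX j W) :=
  (h.decays_pdX hH j).tame

lemma pdx (hH : Wall H) (h : Tame H W) (j : Fin (d + 1)) : Tame H (pdx j W) :=
  (h.Dv hH (v := (hdir j, 0)) (hdir_snd j)).congr hH (h.bdd.reg.pdx j) (h.bdd.reg.pdx_leq j).symm

end Tame

lemma RegularMac.tame (hH : Wall H) {g : MacS d} (h : RegularMac g) : Tame H (fun z _ => g z) := by
  refine ⟨h.decays hH, fun b => (Decays.zero 1).congr hH (h.regularMic.Dv _) fun z hz Z _ => ?_⟩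
  have : HasFDerivAt (unc fun z _ => g z) ((fderiv ℝ g z).comp (ContinuousLinearMap.fst ℝ _ _))
      (z, Z) :=
    HasFDerivAt.comp (g := g) (f := Prod.fst) (z, Z) (h.2 z hz).differentiableAt.hasFDerivAt
      hasFDerivAt_fst
  simp [RoughChannel.Dv, this.fderiv]

end RoughChannel

end

namespace RoughChannel

variable {d : ℕ}

/-! ### Maximum principles for periodic functions on a half space -/

/-- Functions which are twice differentiable above the height `-δ`. -/
structure TwiceDiff (δ : ℝ) (w : Pt d → ℝ) : Prop where
  diff : ∀ Z : Pt d, -δ < Z.2 → DifferentiableAt ℝ w Z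
  diff_pd : ∀ (j : Fin (d + 1)) (Z : Pt d), -δ < Z.2 → DifferentiableAt ℝ (pd j w) Z

/-- The Laplacian. -/
noncomputable def lap (w : Pt d → ℝ) (Z : Pt d) : ℝ := ∑ j, pd j (pd j w) Z

/-- If f'' were positive, 0 would also be a local minimum, so f would be locally constant and f''
zero. -/
lemma deriv2_nonpos_of_isLocalMax {f f' : ℝ → ℝ} {f'' : ℝ}
    (hf : ∀ᶠ t in 𝓝 0, HasDerivAt f (f' t) t) (hf' : HasDerivAt f' f'' 0)
    (hmax : IsLocalMax f 0) : f'' ≤ 0 := by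
  by_contra! hpos
  have h1 : deriv f =ᶠ[𝓝 0] f' := hf.mono fun t ht => ht.deriv
  have h2 : deriv (deriv f) 0 = f'' := by rw [h1.deriv_eq, hf'.deriv]
  have hmin := isLocalMin_of_deriv_deriv_pos (h2 ▸ hpos) hmax.deriv_eq_zero
    hf.self_of_nhds.continuousAt
  have h3 : f =ᶠ[𝓝 0] fun _ => f 0 := by
    filter_upwards [hmax, hmin] with t h4 h5 using le_antisymm h4 h5
  have h4 : deriv (deriv f) 0 = 0 := by
    rw [h3.deriv.deriv_eq]
    simp
  linarith

lemma hasDerivAt_comp_line {w : Pt d → ℝ} {Z : Pt d} (v : Pt d) (t : ℝ)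
    (h : DifferentiableAt ℝ w (Z + t • v)) :
    HasDerivAt (fun s : ℝ => w (Z + s • v)) (fderiv ℝ w (Z + t • v) v) t := by
  have h1 : HasDerivAt (fun s : ℝ => Z + s • v) v t := by
    simpa using ((hasDerivAt_id t).smul_const v).const_add Z
  exact h.hasFDerivAt.comp_hasDerivAt t h1

namespace TwiceDiff

variable {δ : ℝ} {w : Pt d → ℝ}

lemma line (h : TwiceDiff δ w) {Z : Pt d} (hZ : -δ < Z.2) (j : Fin (d + 1)) :
    ∀ᶠ t : ℝ in 𝓝 0, HasDerivAt (fun s : ℝ => w (Z + s • dir j)) (pd j w (Z + t • dir j)) t := by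
  have hc : Continuous fun t : ℝ => (Z + t • dir j).2 := by fun_prop
  filter_upwards [hc.continuousAt.eventually_const_lt (by simpa using hZ)] with t ht
  exact hasDerivAt_comp_line _ t (h.diff _ ht)

lemma line_pd (h : TwiceDiff δ w) {Z : Pt d} (hZ : -δ < Z.2) (j : Fin (d + 1)) :
    HasDerivAt (fun t : ℝ => pd j w (Z + t • dir j)) (pd j (pd j w) Z) 0 := by
  have := hasDerivAt_comp_line (w := pd j w) (Z := Z) (dir j) 0 (by simpa using h.diff_pd j Z hZ)
  simpa [pd] using this

lemma neg (h : TwiceDiff δ w) : TwiceDiff δ (fun Z => -w Z) := by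
  refine ⟨fun Z hZ => (h.diff Z hZ).neg, fun j Z hZ => ?_⟩
  have : pd j (fun Z => -w Z) = fun Z => -pd j w Z := by
    funext Z
    change fderiv ℝ (-w) Z (dir j) = _
    rw [fderiv_neg]
    rfl
  rw [this]
  exact (h.diff_pd j Z hZ).neg

lemma continuousOn (h : TwiceDiff δ w) : ContinuousOn w {Z | -δ < Z.2} :=
  fun Z hZ => (h.diff Z hZ).continuousAt.continuousWithinAt

end TwiceDiff

lemma lap_neg (w : Pt d → ℝ) (Z : Pt d) : lap (fun Z => -w Z) Z = -lap w Z := by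
  have : ∀ (w : Pt d → ℝ) (j : Fin (d + 1)), pd j (fun Z => -w Z) = fun Z => -pd j w Z := by
    intro w j
    funext Z
    change fderiv ℝ (-w) Z (dir j) = _
    rw [fderiv_neg]
    rfl
  simp [lap, this]

lemma isLocalMax_line {α : Type*} [TopologicalSpace α] {f : α → ℝ} {S : Set α} {p : α}
    (hS : S ∈ 𝓝 p) (hmax : ∀ q ∈ S, f q ≤ f p) {γ : ℝ → α} (hγ : Continuous γ) (h0 : γ 0 = p) :
    IsLocalMax (fun t => f (γ t)) 0 := by
  have : ∀ᶠ t in 𝓝 0, γ t ∈ S := hγ.continuousAt.eventually_mem (by rwa [h0])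
  filter_upwards [this] with t ht
  rw [h0]
  exact hmax _ ht

/-- A strict subsolution `β(Y) - w` on a strip attains its maximum on the boundary. -/
theorem strip_max_principle {δ a b m : ℝ} {w : Pt d → ℝ} {β β' β'' : ℝ → ℝ} (hδa : -δ < a)
    (hw : TwiceDiff δ w) (hper : XPeriodic w)
    (hβ : ∀ t, HasDerivAt β (β' t) t) (hβ' : ∀ t, HasDerivAt β' (β'' t) t)
    (hlap : ∀ Z : Pt d, a < Z.2 → Z.2 < b → lap w Z < β'' Z.2)
    (ha : ∀ Z : Pt d, Z.2 = a → β a - w Z ≤ m) (hb : ∀ Z : Pt d, Z.2 = b → β b - w Z ≤ m)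
    (Z : Pt d) (h1 : a ≤ Z.2) (h2 : Z.2 ≤ b) : β Z.2 - w Z ≤ m := by
  set f : Pt d → ℝ := fun Z => β Z.2 - w Z with hf
  have hperf : ∀ (Z : Pt d) (l : Fin d), f (Z + dir l.castSucc) = f Z := fun Z l => by
    simp only [hf, hper Z l, Prod.snd_add]
    simp
  have hcont : ContinuousOn f (Icc (0 : Fin d → ℝ) 1 ×ˢ Icc a b) := by
    have hβc : Continuous β := continuous_iff_continuousAt.2 fun t => (hβ t).continuousAt
    exact (hβc.comp continuous_snd).continuousOn.sub
      (hw.continuousOn.mono fun Z hZ => lt_of_lt_of_le hδa hZ.2.1)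
  obtain ⟨p, hp, hpmax⟩ := (isCompact_Icc.prod isCompact_Icc).exists_isMaxOn
    ⟨((0 : Fin d → ℝ), a), ⟨⟨le_rfl, zero_le_one⟩, le_rfl, h1.trans h2⟩⟩ hcont
  have hglob : ∀ q : Pt d, a ≤ q.2 → q.2 ≤ b → f q ≤ f p := by
    intro q hqa hqb
    obtain ⟨X, hX, hXg⟩ := exists_mem_Icc_of_periodic q
    rw [hXg f hperf]
    exact hpmax (show (X, q.2) ∈ _ from ⟨hX, hqa, hqb⟩)
  refine (hglob Z h1 h2).trans ?_
  by_contra! hlt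
  have hpa : a < p.2 := lt_of_le_of_ne hp.2.1 fun h => by
    have := ha p h.symm
    rw [h] at this
    exact absurd this (not_le.2 hlt)
  have hpb : p.2 < b := lt_of_le_of_ne hp.2.2 fun h => by
    have := hb p h
    rw [← h] at this
    exact absurd this (not_le.2 hlt)
  have hS : {q : Pt d | a < q.2 ∧ q.2 < b} ∈ 𝓝 p :=
    ((isOpen_lt continuous_const continuous_snd).inter
      (isOpen_lt continuous_snd continuous_const)).mem_nhds ⟨hpa, hpb⟩
  have hmax : ∀ q ∈ {q : Pt d | a < q.2 ∧ q.2 < b}, f q ≤ f p := fun q hq =>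
    hglob q hq.1.le hq.2.le
  have hp2 : -δ < p.2 := hδa.trans hpa
  have hloc : ∀ j : Fin (d + 1), IsLocalMax (fun t : ℝ => f (p + t • dir j)) 0 := fun j =>
    isLocalMax_line hS hmax (γ := fun t : ℝ => p + t • dir j) (by fun_prop) (by simp)
  have hhor : ∀ l : Fin d, 0 ≤ pd l.castSucc (pd l.castSucc w) p := by
    intro l
    have := deriv2_nonpos_of_isLocalMax (f' := fun t => -pd l.castSucc w (p + t • dir l.castSucc))
      (f'' := -pd l.castSucc (pd l.castSucc w) p) ?_ ?_ (hloc l.castSucc)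
    · linarith
    · filter_upwards [hw.line hp2 l.castSucc] with t ht
      simpa [hf] using ht.const_sub (β p.2)
    · exact (hw.line_pd hp2 l.castSucc).neg
  have hver : β'' p.2 ≤ pd (Fin.last d) (pd (Fin.last d) w) p := by
    have := deriv2_nonpos_of_isLocalMax
      (f' := fun t => β' (p.2 + t) - pd (Fin.last d) w (p + t • dir (Fin.last d)))
      (f'' := β'' p.2 - pd (Fin.last d) (pd (Fin.last d) w) p) ?_ ?_ (hloc (Fin.last d))
    · linarith
    · filter_upwards [hw.line hp2 (Fin.last d)] with t ht
      refine (((hβ (p.2 + t)).comp_const_add p.2 t).sub ht).congr_of_eventuallyEq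
        (Eventually.of_forall fun t => ?_)
      simp [hf]
    · have := HasDerivAt.comp_const_add p.2 0 (by simpa using hβ' p.2)
      exact this.sub (hw.line_pd hp2 (Fin.last d))
  -- At an interior maximum β'' ≤ ∂_Y²w ≤ Δw, since the horizontal second derivatives of w are
  -- nonnegative; this contradicts the strict inequality.
  have h3 := hlap p hpa hpb
  rw [lap, Fin.sum_univ_castSucc] at h3
  have h4 : 0 ≤ ∑ l : Fin d, pd l.castSucc (pd l.castSucc w) p :=
    Finset.sum_nonneg fun l _ => hhor l
  linarith

/-- Differences of values at points which are symmetric in one horizontal direction decay. -/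
theorem symm_difference_le {δ K M : ℝ} {w : Pt d → ℝ} (hδ : 0 < δ) (hw : TwiceDiff δ w)
    (hper : XPeriodic w) (hK : 0 ≤ K)
    (hlap : ∀ Z : Pt d, 0 ≤ Z.2 → |lap w Z| ≤ K * Real.exp (-Z.2))
    (h0 : ∀ Z : Pt d, Z.2 = 0 → |w Z| ≤ K) (hM : ∀ Z : Pt d, 0 ≤ Z.2 → |w Z| ≤ M)
    (l : Fin d) {s : ℝ} (hs : 0 ≤ s) (hs' : s ≤ 1 / 2) (Z : Pt d) (hZ : 0 ≤ Z.2) :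
    w (Z + s • dir l.castSucc) - w (Z - s • dir l.castSucc) ≤ 8 * K * Real.exp (-Z.2) := by
  set e : Pt d := dir l.castSucc with he
  have he2 : e.2 = 0 := by simp [he]
  -- Doubling of variables: s becomes an additional coordinate, and w(Z + s e) - w(Z - s e) is
  -- compared with the barrier β(Y)(3/2 - s²). In β the first term gives the rate, and η exp(Y)
  -- handles Y → ∞ and is removed at the end. Concavity in s supplies the -2β which beats the
  -- vertical term β(3/2 - s²); this works since β'' = β and the half period is 1/2.
  have main : ∀ η : ℝ, 0 < η → w (Z + s • e) - w (Z - s • e) ≤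
      (5 * K * Real.exp (-Z.2) + η * Real.exp Z.2) * (3 / 2 - s ^ 2) := by
    intro η hη
    set β : ℝ → ℝ := fun Y => 5 * K * Real.exp (-Y) + η * Real.exp Y with hβdef
    set β' : ℝ → ℝ := fun Y => -(5 * K * Real.exp (-Y)) + η * Real.exp Y with hβ'def
    have hβ : ∀ t, HasDerivAt β (β' t) t := fun t => by
      have h1 : HasDerivAt (fun Y : ℝ => Real.exp (-Y)) (Real.exp (-t) * -1) t :=
        (hasDerivAt_neg t).exp
      exact ((h1.const_mul (5 * K)).add ((Real.hasDerivAt_exp t).const_mul η)).congr_deriv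
        (by simp only [hβ'def]; ring)
    have hβ' : ∀ t, HasDerivAt β' (β t) t := fun t => by
      have h1 : HasDerivAt (fun Y : ℝ => Real.exp (-Y)) (Real.exp (-t) * -1) t :=
        (hasDerivAt_neg t).exp
      exact ((h1.const_mul (5 * K)).neg.add ((Real.hasDerivAt_exp t).const_mul η)).congr_deriv
        (by simp only [hβdef]; ring)
    have hβpos : ∀ t, 0 < β t := fun t => by positivity
    obtain ⟨R, hR0, hR⟩ : ∃ R, Z.2 ≤ R ∧ 2 * M ≤ η * Real.exp R := by
      have : Tendsto (fun R => η * Real.exp R) atTop atTop :=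
        Real.tendsto_exp_atTop.const_mul_atTop hη
      exact ((eventually_ge_atTop Z.2).and (this.eventually_ge_atTop (2 * M))).exists
    set f : Pt d × ℝ → ℝ := fun q =>
      w (q.1 + q.2 • e) - w (q.1 - q.2 • e) - β q.1.2 * (3 / 2 - q.2 ^ 2) with hf
    suffices hle : f (Z, s) ≤ 0 by simp only [hf] at hle; linarith
    have hperf : ∀ (σ : ℝ) (Z : Pt d) (j : Fin d), f (Z + dir j.castSucc, σ) = f (Z, σ) := by
      intro σ Z j
      have h1 := hper (Z + σ • e) j
      have h2 := hper (Z - σ • e) j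
      simp only [hf]
      rw [add_right_comm, h1, add_sub_right_comm, h2]
      simp
    have hcont : ContinuousOn f ((Icc (0 : Fin d → ℝ) 1 ×ˢ Icc 0 R) ×ˢ Icc 0 (1 / 2)) := by
      have hβc : Continuous β := continuous_iff_continuousAt.2 fun t => (hβ t).continuousAt
      refine ContinuousOn.sub (ContinuousOn.sub ?_ ?_) (by fun_prop)
      · exact hw.continuousOn.comp (by fun_prop) fun q hq => by
          have := hq.1.2.1
          simp only [mem_ofPred_eq, Prod.snd_add, Prod.smul_snd, he2, smul_zero, add_zero]
          linarith
      · exact hw.continuousOn.comp (by fun_prop) fun q hq => by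
          have := hq.1.2.1
          simp only [mem_ofPred_eq, Prod.snd_sub, Prod.smul_snd, he2, smul_zero, sub_zero]
          linarith
    obtain ⟨p, hp, hpmax⟩ := ((isCompact_Icc.prod isCompact_Icc).prod isCompact_Icc).exists_isMaxOn
      ⟨(((0 : Fin d → ℝ), (0 : ℝ)), (0 : ℝ)),
        ⟨⟨⟨le_rfl, zero_le_one⟩, le_rfl, hZ.trans hR0⟩, le_rfl, by norm_num⟩⟩ hcont
    have hglob : ∀ q : Pt d × ℝ, 0 ≤ q.1.2 → q.1.2 ≤ R → 0 ≤ q.2 → q.2 ≤ 1 / 2 → f q ≤ f p := by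
      rintro ⟨q, σ⟩ h1 h2 h3 h4
      obtain ⟨X, hX, hXg⟩ := exists_mem_Icc_of_periodic q
      rw [hXg (fun q => f (q, σ)) (hperf σ)]
      exact hpmax (show ((X, q.2), σ) ∈ _ from ⟨⟨hX, h1, h2⟩, h3, h4⟩)
    refine (hglob (Z, s) hZ hR0 hs hs').trans ?_
    by_contra! hpos
    obtain ⟨⟨hpX, hpY0, hpYR⟩, hps0, hps1⟩ := hp
    have hsq : p.2 ^ 2 ≤ 1 / 4 := by nlinarith
    have hP2 : (p.1 + p.2 • e).2 = p.1.2 := by simp [he2]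
    have hQ2 : (p.1 - p.2 • e).2 = p.1.2 := by simp [he2]
    have hfp : f p = w (p.1 + p.2 • e) - w (p.1 - p.2 • e) - β p.1.2 * (3 / 2 - p.2 ^ 2) := rfl
    have hβp := hβpos p.1.2
    have hprod : β p.1.2 ≤ β p.1.2 * (3 / 2 - p.2 ^ 2) := by nlinarith
    -- A positive maximum lies on none of the four faces: at s = 0 the difference vanishes; at s =
    -- 1/2 the two points differ by one period; at Y = 0 the difference is at most 2K < β; at Y = R
    -- the choice of R gives 2M ≤ β.
    have hs0 : 0 < p.2 := lt_of_le_of_ne hps0 fun h => by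
      rw [hfp, ← h] at hpos
      simp only [zero_smul, add_zero, sub_zero, sub_self] at hpos
      nlinarith
    have hs1 : p.2 < 1 / 2 := lt_of_le_of_ne hps1 fun h => by
      have h1 := hper (p.1 - p.2 • e) l
      rw [← he, show p.1 - p.2 • e + e = p.1 + p.2 • e by rw [h]; module] at h1
      rw [hfp, h1] at hpos
      linarith
    have hY0 : 0 < p.1.2 := lt_of_le_of_ne hpY0 fun h => by
      have h1 := abs_le.1 (h0 _ (hP2.trans h.symm))
      have h2 := abs_le.1 (h0 _ (hQ2.trans h.symm))
      have h3 : β p.1.2 = 5 * K + η := by rw [← h]; simp [hβdef]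
      linarith
    have hYR : p.1.2 < R := lt_of_le_of_ne hpYR fun h => by
      have h1 := abs_le.1 (hM _ (by rw [hP2]; exact hpY0))
      have h2 := abs_le.1 (hM _ (by rw [hQ2]; exact hpY0))
      have h3 : η * Real.exp R ≤ β p.1.2 := by
        simp only [hβdef, h]
        have : 0 ≤ 5 * K * Real.exp (-R) := by positivity
        linarith
      linarith
    have hS : {q : Pt d × ℝ | (0 < q.1.2 ∧ q.1.2 < R) ∧ 0 < q.2 ∧ q.2 < 1 / 2} ∈ 𝓝 p :=
      ((isOpen_Ioo.preimage (f := fun q : Pt d × ℝ => q.1.2) (by fun_prop)).inter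
        (isOpen_Ioo.preimage continuous_snd)).mem_nhds ⟨⟨hY0, hYR⟩, hs0, hs1⟩
    have hmax : ∀ q ∈ {q : Pt d × ℝ | (0 < q.1.2 ∧ q.1.2 < R) ∧ 0 < q.2 ∧ q.2 < 1 / 2},
        f q ≤ f p := fun q hq => hglob q hq.1.1.le hq.1.2.le hq.2.1.le hq.2.2.le
    have hPδ : -δ < (p.1 + p.2 • e).2 := by rw [hP2]; linarith
    have hQδ : -δ < (p.1 - p.2 • e).2 := by rw [hQ2]; linarith
    have hloc : ∀ j : Fin (d + 1), IsLocalMax (fun t : ℝ => f (p.1 + t • dir j, p.2)) 0 := fun j =>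
      isLocalMax_line hS hmax (γ := fun t : ℝ => (p.1 + t • dir j, p.2)) (by fun_prop) (by simp)
    have hlocs : IsLocalMax (fun t : ℝ => f (p.1, p.2 + t)) 0 :=
      isLocalMax_line hS hmax (γ := fun t : ℝ => (p.1, p.2 + t)) (by fun_prop) (by simp)
    have r1 : ∀ (j : Fin (d + 1)) (t : ℝ),
        p.1 + t • dir j + p.2 • e = p.1 + p.2 • e + t • dir j := fun j t => by abel
    have r2 : ∀ (j : Fin (d + 1)) (t : ℝ),
        p.1 + t • dir j - p.2 • e = p.1 - p.2 • e + t • dir j := fun j t => by abel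
    set D : Fin (d + 1) → ℝ := fun j =>
      pd j (pd j w) (p.1 + p.2 • e) - pd j (pd j w) (p.1 - p.2 • e) with hD
    have hhor : ∀ j : Fin d, D j.castSucc ≤ 0 := by
      intro j
      refine deriv2_nonpos_of_isLocalMax (f' := fun t =>
        pd j.castSucc w (p.1 + p.2 • e + t • dir j.castSucc)
          - pd j.castSucc w (p.1 - p.2 • e + t • dir j.castSucc)) ?_ ?_ (hloc j.castSucc)
      · filter_upwards [hw.line hPδ j.castSucc, hw.line hQδ j.castSucc] with t h1 h2
        have := (h1.sub h2).sub_const (β p.1.2 * (3 / 2 - p.2 ^ 2))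
        refine this.congr_of_eventuallyEq (Eventually.of_forall fun t => ?_)
        simp only [hf, r1, r2]
        simp
      · exact (hw.line_pd hPδ j.castSucc).sub (hw.line_pd hQδ j.castSucc)
    have hver : D (Fin.last d) - β p.1.2 * (3 / 2 - p.2 ^ 2) ≤ 0 := by
      refine deriv2_nonpos_of_isLocalMax (f' := fun t =>
        pd (Fin.last d) w (p.1 + p.2 • e + t • dir (Fin.last d))
          - pd (Fin.last d) w (p.1 - p.2 • e + t • dir (Fin.last d))
          - β' (p.1.2 + t) * (3 / 2 - p.2 ^ 2)) ?_ ?_ (hloc (Fin.last d))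
      · filter_upwards [hw.line hPδ (Fin.last d), hw.line hQδ (Fin.last d)] with t h1 h2
        have := (h1.sub h2).sub
          (((hβ (p.1.2 + t)).comp_const_add p.1.2 t).mul_const (3 / 2 - p.2 ^ 2))
        refine this.congr_of_eventuallyEq (Eventually.of_forall fun t => ?_)
        simp only [hf, r1, r2]
        simp
      · have h1 := HasDerivAt.comp_const_add p.1.2 0 (by simpa using hβ' p.1.2)
        exact ((hw.line_pd hPδ (Fin.last d)).sub (hw.line_pd hQδ (Fin.last d))).sub
          (h1.mul_const _)
    -- Differentiating twice in s produces the same difference of ∂_l² as differentiating in X_l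
    -- would, but with the extra 2β from -β(3/2 - s²). This replaces the weaker inequality for the
    -- direction l.
    have hsym : D l.castSucc + 2 * β p.1.2 ≤ 0 := by
      have a1 := hw.line hPδ l.castSucc
      have a2 := hw.line hQδ l.castSucc
      have hneg : Tendsto (fun t : ℝ => -t) (𝓝 0) (𝓝 0) := by
        simpa using (continuous_neg.tendsto (0 : ℝ))
      refine deriv2_nonpos_of_isLocalMax (f' := fun t =>
        pd l.castSucc w (p.1 + p.2 • e + t • dir l.castSucc)
          + pd l.castSucc w (p.1 - p.2 • e + (-t) • dir l.castSucc)
          + β p.1.2 * (2 * (p.2 + t))) ?_ ?_ hlocs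
      · filter_upwards [a1, hneg.eventually a2] with t h1 h2
        have h3 : HasDerivAt (fun t : ℝ => (p.2 + t) ^ 2) (2 * (p.2 + t)) t := by
          exact (((hasDerivAt_id t).const_add p.2).pow 2).congr_deriv (by simp)
        have h4 := (h2.comp t (hasDerivAt_neg t))
        have := (h1.sub h4).sub ((h3.const_sub (3 / 2)).const_mul (β p.1.2))
        refine HasDerivAt.congr_of_eventuallyEq (this.congr_deriv (by ring))
          (Eventually.of_forall fun t => ?_)
        simp only [hf, Function.comp, Pi.sub_apply]
        rw [show p.1 + (p.2 + t) • e = p.1 + p.2 • e + t • dir l.castSucc by rw [← he]; module,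
          show p.1 - (p.2 + t) • e = p.1 - p.2 • e + (-t) • dir l.castSucc by rw [← he]; module]
      · have h1 := hw.line_pd hPδ l.castSucc
        have h2 := (HasDerivAt.comp (0 : ℝ) (h := fun t : ℝ => -t)
          (h₂ := fun t : ℝ => pd l.castSucc w (p.1 - p.2 • e + t • dir l.castSucc))
          (by simpa using hw.line_pd hQδ l.castSucc) (hasDerivAt_neg 0))
        have h3 : HasDerivAt (fun t : ℝ => 2 * (p.2 + t)) 2 0 := by
          simpa using ((hasDerivAt_id (0 : ℝ)).const_add p.2).const_mul 2
        refine ((h1.add h2).add (h3.const_mul (β p.1.2))).congr_deriv ?_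
        simp only [hD]
        ring
    have hsum : lap w (p.1 + p.2 • e) - lap w (p.1 - p.2 • e) = ∑ j, D j := by
      simp [hD, lap, Finset.sum_sub_distrib]
    rw [Fin.sum_univ_castSucc, ← Finset.add_sum_erase _ _ (Finset.mem_univ l)] at hsum
    have hrest : ∑ j ∈ Finset.univ.erase l, D (Fin.castSucc j) ≤ 0 :=
      Finset.sum_nonpos fun j _ => hhor j
    have b1 := abs_le.1 (hlap _ (by rw [hP2]; exact hpY0))
    have b2 := abs_le.1 (hlap _ (by rw [hQ2]; exact hpY0))
    rw [hP2] at b1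
    rw [hQ2] at b2
    have hβ5 : β p.1.2 = 5 * (K * Real.exp (-p.1.2)) + η * Real.exp p.1.2 := by
      simp only [hβdef]; ring
    have hKe : 0 ≤ K * Real.exp (-p.1.2) := by positivity
    have hηe : 0 < η * Real.exp p.1.2 := by positivity
    -- Summing, the difference of Laplacians is at most β(3/2 - s²) - 2β ≤ -β/2 < -2K exp(-Y),
    -- whereas the hypothesis bounds it below by -2K exp(-Y). This is where the constant 5 in β is
    -- used.
    nlinarith [mul_nonneg hβp.le (sq_nonneg p.2)]
  -- Let η → 0; the factor left is 5 · 3/2 ≤ 8.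
  have hlim : Tendsto (fun η : ℝ => (5 * K * Real.exp (-Z.2) + η * Real.exp Z.2) * (3 / 2 - s ^ 2))
      (𝓝[>] 0) (𝓝 ((5 * K * Real.exp (-Z.2) + 0 * Real.exp Z.2) * (3 / 2 - s ^ 2))) := by
    refine Tendsto.mono_left ?_ nhdsWithin_le_nhds
    exact Continuous.tendsto (by fun_prop) 0
  have h1 := ge_of_tendsto hlim (eventually_mem_nhdsWithin.mono fun η hη => main η hη)
  have h2 : 0 ≤ K * Real.exp (-Z.2) := by positivity
  nlinarith [sq_nonneg s, mul_nonneg h2 (sq_nonneg s)]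

end RoughChannel

namespace RoughChannel

variable {d : ℕ}

/-! ### Decay of solutions of Poisson's equation which vanish at infinity -/

/-- Two points of a slice, reduced to one period cell, are joined by changing one coordinate at a
time; each change is by at most 1 and costs one application of `symm_difference_le`. -/
lemma oscillation_le {δ K M : ℝ} {w : Pt d → ℝ} (hδ : 0 < δ) (hw : TwiceDiff δ w)
    (hper : XPeriodic w) (hK : 0 ≤ K)
    (hlap : ∀ Z : Pt d, 0 ≤ Z.2 → |lap w Z| ≤ K * Real.exp (-Z.2))
    (h0 : ∀ Z : Pt d, Z.2 = 0 → |w Z| ≤ K) (hM : ∀ Z : Pt d, 0 ≤ Z.2 → |w Z| ≤ M)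
    (X X' : Fin d → ℝ) (Y : ℝ) (hY : 0 ≤ Y) :
    |w (X, Y) - w (X', Y)| ≤ d * (8 * K * Real.exp (-Y)) := by
  have key : ∀ (l : Fin d) (t : ℝ), 0 ≤ t → t ≤ 1 → ∀ X : Fin d → ℝ,
      |w ((X, Y) + t • dir l.castSucc) - w (X, Y)| ≤ 8 * K * Real.exp (-Y) := by
    intro l t ht0 ht1 X
    -- The midpoint: the two points are symmetric about it at distance t/2 ≤ 1/2. Both signs come
    -- from using w and -w.
    set Z : Pt d := (X, Y) + (t / 2) • dir l.castSucc with hZ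
    have hZ2 : Z.2 = Y := by simp [hZ]
    have e1 : (X, Y) + t • dir l.castSucc = Z + (t / 2) • dir l.castSucc := by rw [hZ]; module
    have e2 : ((X, Y) : Pt d) = Z - (t / 2) • dir l.castSucc := by rw [hZ]; module
    have a1 := symm_difference_le hδ hw hper hK hlap h0 hM l (s := t / 2) (by linarith)
      (by linarith) Z (by rw [hZ2]; exact hY)
    have a2 := symm_difference_le hδ hw.neg (fun Z l => congrArg Neg.neg (hper Z l)) hK
      (fun Z hZ => by rw [lap_neg, abs_neg]; exact hlap Z hZ)
      (fun Z hZ => by rw [abs_neg]; exact h0 Z hZ) (fun Z hZ => by rw [abs_neg]; exact hM Z hZ)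
      l (s := t / 2) (by linarith) (by linarith) Z (by rw [hZ2]; exact hY)
    rw [e1, abs_le]
    conv in w (X, Y) => rw [e2]
    conv in w (X, Y) => rw [e2]
    rw [hZ2] at a1 a2
    constructor <;> linarith
  have key2 : ∀ (l : Fin d) (t : ℝ), |t| ≤ 1 → ∀ X : Fin d → ℝ,
      |w ((X, Y) + t • dir l.castSucc) - w (X, Y)| ≤ 8 * K * Real.exp (-Y) := by
    intro l t ht X
    rcases le_total 0 t with h | h
    · exact key l t h (by rwa [abs_of_nonneg h] at ht) X
    · have h1 := key l (-t) (by linarith) (by rwa [abs_of_nonpos h] at ht)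
        ((X, Y) + t • dir l.castSucc : Pt d).1
      have e : (((X, Y) + t • dir l.castSucc : Pt d).1, Y) = (X, Y) + t • dir l.castSucc := by
        ext <;> simp
      rw [e, show (X, Y) + t • dir l.castSucc + (-t) • dir l.castSucc = (X, Y) by module,
        abs_sub_comm] at h1
      exact h1
  have main : ∀ (X X' : Fin d → ℝ), X ∈ Icc (0 : Fin d → ℝ) 1 → X' ∈ Icc (0 : Fin d → ℝ) 1 →
      ∀ s : Finset (Fin d), |w (s.piecewise X' X, Y) - w (X, Y)| ≤
        s.card * (8 * K * Real.exp (-Y)) := by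
    intro X X' hX hX' s
    induction s using Finset.induction_on with
    | empty => simp
    | insert a s ha ih =>
      have e : ((((insert a s).piecewise X' X : Fin d → ℝ), Y) : Pt d)
          = (s.piecewise X' X, Y) + (X' a - X a) • dir a.castSucc := by
        refine Prod.ext (funext fun l => ?_) (by simp)
        rcases eq_or_ne l a with rfl | hl
        · simp [ha]
        · simp [Finset.piecewise, hl]
      have h1 := key2 a (X' a - X a) (by
        have := hX.1 a; have := hX.2 a; have := hX'.1 a; have := hX'.2 a
        simp only [Pi.zero_apply, Pi.one_apply] at *
        rw [abs_le]; constructor <;> linarith) (s.piecewise X' X)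
      rw [e, Finset.card_insert_of_notMem ha, Nat.cast_succ, add_mul, one_mul]
      have := abs_sub_le (w ((s.piecewise X' X, Y) + (X' a - X a) • dir a.castSucc))
        (w (s.piecewise X' X, Y)) (w (X, Y))
      linarith
  obtain ⟨A, hA, hAg⟩ := exists_mem_Icc_of_periodic ((X, Y) : Pt d)
  obtain ⟨B, hB, hBg⟩ := exists_mem_Icc_of_periodic ((X', Y) : Pt d)
  rw [hAg w hper, hBg w hper]
  simpa using main B A hB hA Finset.univ

/-- If w were too large at one point of height Y0, the oscillation bound would make it larger than
3K exp(-Y0) on the whole slice. On a very long strip above, w then stays above an almost affine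
function descending slowly to 0, so it is still large at a height where it should already be small.
In 8d + 3, the part 8d pays for the oscillation and 3 for the source. -/
lemma upper_decay {δ K : ℝ} {w : Pt d → ℝ} (hδ : 0 < δ) (hw : TwiceDiff δ w)
    (hper : XPeriodic w) (hK : 0 < K)
    (hlap : ∀ Z : Pt d, 0 ≤ Z.2 → |lap w Z| ≤ K * Real.exp (-Z.2))
    (h0 : ∀ Z : Pt d, Z.2 = 0 → |w Z| ≤ K)
    (hlim : ∀ η > 0, ∃ R, ∀ Z : Pt d, R ≤ Z.2 → |w Z| ≤ η) (Z : Pt d) (hZ : 0 ≤ Z.2) :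
    w Z ≤ (8 * d + 3) * K * Real.exp (-Z.2) := by
  obtain ⟨M, hM⟩ : ∃ M, ∀ Z : Pt d, 0 ≤ Z.2 → |w Z| ≤ M := by
    obtain ⟨R, hR⟩ := hlim 1 one_pos
    have hc : ContinuousOn (fun Z => |w Z|) (Icc (0 : Fin d → ℝ) 1 ×ˢ Icc 0 R) :=
      (hw.continuousOn.mono fun Z hZ => lt_of_lt_of_le (by linarith) hZ.2.1).abs
    obtain ⟨M, hM⟩ := (isCompact_Icc.prod isCompact_Icc).bddAbove_image hc
    refine ⟨max M 1, fun Z hZ => ?_⟩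
    rcases le_total R Z.2 with h | h
    · exact (hR Z h).trans (le_max_right _ _)
    · obtain ⟨X, hX, hXg⟩ := exists_mem_Icc_of_periodic Z
      rw [hXg w hper]
      exact (hM (mem_image_of_mem (fun Z => |w Z|) (show (X, Z.2) ∈ _ from ⟨hX, hZ, h⟩))).trans
        (le_max_left _ _)
  by_contra! hlt
  set Y0 := Z.2 with hY0
  set E := K * Real.exp (-Y0) with hE
  have hEpos : 0 < E := by positivity
  set m := w Z - d * (8 * K * Real.exp (-Y0)) with hm
  have hmE : 3 * E < m := by simp only [hm, hE]; linarith
  have hbot : ∀ Z' : Pt d, Z'.2 = Y0 → m ≤ w Z' := by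
    intro Z' h
    have := (abs_le.1 (oscillation_le hδ hw hper hK.le hlap h0 hM Z.1 Z'.1 Y0 hZ)).2
    rw [show (Z.1, Y0) = Z from rfl, ← h] at this
    simp only [hm, ← h]
    linarith
  set g := m - 2 * E with hg
  have hgpos : 0 < g := by linarith
  obtain ⟨R0, hR0⟩ := hlim (g / 4) (by linarith)
  set R1 := max R0 (Y0 + 1) with hR1
  have hR1Y : Y0 + 1 ≤ R1 := le_max_right _ _
  -- The strip is twelve times longer than the distance to R1, so the affine function has lost only
  -- one twelfth of its value at R1.
  set L := 12 * (R1 - Y0) with hL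
  have hLpos : 0 < L := by linarith
  set R := Y0 + L with hRdef
  -- The correction makes β'' = 2K exp(-Y), strictly above Δw; it vanishes at Y0 and costs at most
  -- 2E above.
  have hβ : ∀ t, HasDerivAt (fun Y => m * (R - Y) / L - 2 * (E - K * Real.exp (-Y)))
      (m * -1 / L - 2 * (K * Real.exp (-t))) t := fun t => by
    have h1 : HasDerivAt (fun Y : ℝ => Real.exp (-Y)) (Real.exp (-t) * -1) t :=
      (hasDerivAt_neg t).exp
    have h2 := ((((hasDerivAt_id t).const_sub R).const_mul m).div_const L).sub
      (((h1.const_mul K).const_sub E).const_mul 2)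
    exact h2.congr_deriv (by ring)
  have hβ' : ∀ t, HasDerivAt (fun Y => m * -1 / L - 2 * (K * Real.exp (-Y)))
      (2 * (K * Real.exp (-t))) t := fun t => by
    have h1 : HasDerivAt (fun Y : ℝ => Real.exp (-Y)) (Real.exp (-t) * -1) t :=
      (hasDerivAt_neg t).exp
    exact (((h1.const_mul K).const_mul 2).const_sub (m * -1 / L)).congr_deriv (by ring)
  have hend : ∀ Z' : Pt d, R1 ≤ Z'.2 → |w Z'| ≤ g / 4 := fun Z' h =>
    hR0 Z' ((le_max_left _ _).trans h)
  have hmono : ∀ Y, 0 ≤ K * Real.exp (-Y) := fun Y => by positivity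
  have hfin := strip_max_principle (δ := δ) (a := Y0) (b := R) (m := g / 4) (by linarith) hw hper
    hβ hβ' (fun Z' h1 h2 => by
      have h3 := (abs_le.1 (hlap Z' (by linarith))).2
      have : 0 < K * Real.exp (-Z'.2) := by positivity
      linarith)
    (fun Z' h => by
      have h1 := hbot Z' h
      have h2 : m * (R - Y0) / L = m := by rw [hRdef, add_sub_cancel_left]; field_simp
      simp only [h2]
      linarith)
    (fun Z' h => by
      have h1 := (abs_le.1 (hend Z' (by rw [h]; linarith))).1
      have h2 : K * Real.exp (-R) ≤ E := by
        simp only [hE]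
        gcongr
        linarith
      simp only [sub_self, mul_zero, zero_div]
      linarith)
    (Z.1, R1) (show Y0 ≤ R1 by linarith) (show R1 ≤ R by linarith)
  -- At R1 the comparison yields 11m/12 - 2E ≤ g/2 = m/2 - E, that is m ≤ 12E/5, against m > 3E.
  have h1 := (abs_le.1 (hend (Z.1, R1) le_rfl)).2
  have h2 : m * (R - R1) / L = m * (11 / 12) := by
    rw [div_eq_iff hLpos.ne', hRdef, hL]
    ring
  simp only [h2] at hfin
  have h3 := hmono R1
  linarith

theorem decay_of_tendsto {δ K : ℝ} {w : Pt d → ℝ} (hδ : 0 < δ) (hw : TwiceDiff δ w)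
    (hper : XPeriodic w) (hK : 0 < K)
    (hlap : ∀ Z : Pt d, 0 ≤ Z.2 → |lap w Z| ≤ K * Real.exp (-Z.2))
    (h0 : ∀ Z : Pt d, Z.2 = 0 → |w Z| ≤ K)
    (hlim : ∀ η > 0, ∃ R, ∀ Z : Pt d, R ≤ Z.2 → |w Z| ≤ η) (Z : Pt d) (hZ : 0 ≤ Z.2) :
    |w Z| ≤ (8 * d + 3) * K * Real.exp (-Z.2) := by
  have h1 := upper_decay hδ hw hper hK hlap h0 hlim Z hZ
  have h2 := upper_decay hδ hw.neg (fun Z l => congrArg Neg.neg (hper Z l)) hK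
    (fun Z hZ => by rw [lap_neg, abs_neg]; exact hlap Z hZ)
    (fun Z hZ => by rw [abs_neg]; exact h0 Z hZ) (fun η hη => by
      obtain ⟨R, hR⟩ := hlim η hη
      exact ⟨R, fun Z hZ => by rw [abs_neg]; exact hR Z hZ⟩) Z hZ
  rw [abs_le]
  constructor <;> linarith

/-! ### Square integrable solutions -/

/-- One period of the half space `Y > 0`. -/
def halfCell (d : ℕ) : Set (Pt d) := Icc (0 : Fin d → ℝ) 1 ×ˢ Ioi (0 : ℝ)

/-- The box `[0, h]^{d+1}`. -/
def box (d : ℕ) (h : ℝ) : Set (Pt d) := Icc (0 : Fin d → ℝ) (fun _ => h) ×ˢ Icc (0 : ℝ) h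

/-- Integrals over small boxes. -/
noncomputable def boxInt (h : ℝ) (w : Pt d → ℝ) (Z : Pt d) : ℝ := ∫ s in box d h, w (Z + s)

lemma isCompact_box (h : ℝ) : IsCompact (box d h) := isCompact_Icc.prod isCompact_Icc

lemma volume_box {h : ℝ} (hh : 0 ≤ h) : volume.real (box d h) = h ^ (d + 1) := by
  have h1 : volume (box d h) = ENNReal.ofReal (h ^ (d + 1)) := by
    rw [box, Measure.volume_eq_prod, Measure.prod_prod, Real.volume_Icc_pi, Real.volume_Icc,
      sub_zero, pow_succ, ENNReal.ofReal_mul (by positivity)]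
    simp [ENNReal.ofReal_pow hh]
  rw [Measure.real, h1, ENNReal.toReal_ofReal (by positivity)]

/-- Differentiation under the integral sign. The box extends upwards only, so integrating over it
never leaves the half space where w is smooth. -/
lemma boxInt_hasFDerivAt {δ h : ℝ} {w : Pt d → ℝ}
    (hw : ContDiffOn ℝ 1 w {Z | -δ < Z.2}) {Z : Pt d} (hZ : -δ < Z.2) :
    HasFDerivAt (boxInt h w) (∫ s in box d h, fderiv ℝ w (Z + s)) Z := by
  have ho : IsOpen {Z : Pt d | -δ < Z.2} := isOpen_lt continuous_const continuous_snd
  have hcf : ContinuousOn (fderiv ℝ w) {Z | -δ < Z.2} := hw.continuousOn_fderiv_of_isOpen ho le_rfl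
  set η := (Z.2 + δ) / 2 with hη
  have hηpos : 0 < η := by linarith
  have hmem : ∀ Z' ∈ Metric.closedBall Z η, ∀ s ∈ box d h, Z' + s ∈ {Z : Pt d | -δ < Z.2} := by
    intro Z' hZ' s hs
    have h1 : |Z'.2 - Z.2| ≤ η := by
      have := (le_max_right (dist Z'.1 Z.1) (dist Z'.2 Z.2)).trans hZ'
      rwa [Real.dist_eq] at this
    have h2 := (abs_le.1 h1).1
    have h3 : 0 ≤ s.2 := hs.2.1
    simp only [mem_ofPred_eq, Prod.snd_add]
    linarith
  have hcpt : IsCompact (Metric.closedBall Z η ×ˢ box d h) :=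
    (isCompact_closedBall _ _).prod (isCompact_box h)
  have hcont : ContinuousOn (fun q : Pt d × Pt d => ‖fderiv ℝ w (q.1 + q.2)‖)
      (Metric.closedBall Z η ×ˢ box d h) :=
    (hcf.comp (by fun_prop) fun q hq => hmem q.1 hq.1 q.2 hq.2).norm
  obtain ⟨B, hB⟩ := hcpt.bddAbove_image hcont
  have hB' : ∀ Z' ∈ Metric.closedBall Z η, ∀ s ∈ box d h, ‖fderiv ℝ w (Z' + s)‖ ≤ B :=
    fun Z' hZ' s hs => mem_upperBounds.1 hB _ ⟨(Z', s), mk_mem_prod hZ' hs, rfl⟩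
  have hms : MeasurableSet (box d h) := (isCompact_box h).isClosed.measurableSet
  have hcw : ∀ Z' ∈ Metric.closedBall Z η, ContinuousOn (fun s => w (Z' + s)) (box d h) :=
    fun Z' hZ' => hw.continuousOn.comp (by fun_prop) fun s hs => hmem Z' hZ' s hs
  refine hasFDerivAt_integral_of_dominated_of_fderiv_le (μ := volume.restrict (box d h))
    (F := fun Z s => w (Z + s)) (F' := fun Z s => fderiv ℝ w (Z + s)) (bound := fun _ => B)
    (Metric.closedBall_mem_nhds Z hηpos) ?_ ?_ ?_ ?_ ?_ ?_
  · filter_upwards [Metric.closedBall_mem_nhds Z hηpos] with Z' hZ'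
    exact (hcw Z' hZ').aestronglyMeasurable hms
  · exact (hcw Z (Metric.mem_closedBall_self hηpos.le)).integrableOn_compact (isCompact_box h)
  · refine ContinuousOn.aestronglyMeasurable ?_ hms
    exact hcf.comp (by fun_prop) fun s hs => hmem Z (Metric.mem_closedBall_self hηpos.le) s hs
  · refine (ae_restrict_mem hms).mono fun s hs Z' hZ' => ?_
    exact hB' Z' hZ' s hs
  · exact integrableOn_const (isCompact_box h).measure_lt_top.ne
  · refine (ae_restrict_mem hms).mono fun s hs Z' hZ' => ?_
    have h1 : DifferentiableAt ℝ w (Z' + s) :=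
      (hw.contDiffAt (ho.mem_nhds (hmem Z' hZ' s hs))).differentiableAt one_ne_zero
    exact (hasFDerivAt_comp_add_right s).2 h1.hasFDerivAt

lemma pd_boxInt {δ h : ℝ} {w : Pt d → ℝ}
    (hw : ContDiffOn ℝ 1 w {Z | -δ < Z.2}) {Z : Pt d} (hZ : -δ < Z.2) (j : Fin (d + 1)) :
    pd j (boxInt h w) Z = boxInt h (pd j w) Z := by
  have ho : IsOpen {Z : Pt d | -δ < Z.2} := isOpen_lt continuous_const continuous_snd
  have hcf : ContinuousOn (fderiv ℝ w) {Z | -δ < Z.2} := hw.continuousOn_fderiv_of_isOpen ho le_rfl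
  rw [pd, (boxInt_hasFDerivAt hw hZ).fderiv, ContinuousLinearMap.integral_apply]
  · rfl
  · refine ContinuousOn.integrableOn_compact (isCompact_box h) ?_
    refine hcf.comp (by fun_prop) fun s hs => ?_
    have h3 : 0 ≤ s.2 := hs.2.1
    simp only [mem_ofPred_eq, Prod.snd_add]
    linarith

end RoughChannel

/-! ### Box averages and decay of square integrable solutions -/

namespace RoughChannel

variable {d : ℕ}

instance : (volume : Measure (Pt d)).IsAddLeftInvariant :=
  inferInstanceAs (Measure.prod (volume : Measure (Fin d → ℝ))
    (volume : Measure ℝ)).IsAddLeftInvariant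

lemma isOpen_above (δ : ℝ) : IsOpen {Z : Pt d | -δ < Z.2} :=
  isOpen_lt continuous_const continuous_snd

lemma add_mem_above {δ h : ℝ} {Z s : Pt d} (hZ : -δ < Z.2) (hs : s ∈ box d h) :
    Z + s ∈ {Z : Pt d | -δ < Z.2} := by
  have h3 : 0 ≤ s.2 := hs.2.1
  simp only [mem_ofPred_eq, Prod.snd_add]
  linarith

lemma measurableSet_box (h : ℝ) : MeasurableSet (box d h) :=
  (isCompact_box h).isClosed.measurableSet

lemma integrableOn_box {δ h : ℝ} {w : Pt d → ℝ} (hw : ContinuousOn w {Z | -δ < Z.2}) {Z : Pt d}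
    (hZ : -δ < Z.2) : IntegrableOn (fun s => w (Z + s)) (box d h) :=
  (hw.comp (by fun_prop) fun _ hs => add_mem_above hZ hs).integrableOn_compact (isCompact_box h)

lemma contDiffOn_pd {δ : ℝ} {w : Pt d → ℝ} {n m : ℕ∞ω} (hw : ContDiffOn ℝ n w {Z | -δ < Z.2})
    (hmn : m + 1 ≤ n) (j : Fin (d + 1)) : ContDiffOn ℝ m (pd j w) {Z | -δ < Z.2} :=
  (hw.fderiv_of_isOpen (isOpen_above δ) hmn).clm_apply contDiffOn_const

lemma XPeriodic.boxInt {w : Pt d → ℝ} (hper : XPeriodic w) (h : ℝ) : XPeriodic (boxInt h w) := by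
  intro Z l
  simp only [RoughChannel.boxInt, add_right_comm Z, hper _ l]

lemma eventuallyEq_pd_boxInt {δ h : ℝ} {w : Pt d → ℝ} (hw : ContDiffOn ℝ 1 w {Z | -δ < Z.2})
    {Z : Pt d} (hZ : -δ < Z.2) (j : Fin (d + 1)) : pd j (boxInt h w) =ᶠ[𝓝 Z] boxInt h (pd j w) := by
  filter_upwards [(isOpen_above δ).mem_nhds hZ] with Z' hZ' using pd_boxInt hw hZ' j

lemma twiceDiff_boxInt {δ h : ℝ} {w : Pt d → ℝ} (hw : ContDiffOn ℝ 2 w {Z | -δ < Z.2}) :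
    TwiceDiff δ (boxInt h w) := by
  have hw1 : ContDiffOn ℝ 1 w {Z | -δ < Z.2} := hw.of_le one_le_two
  refine ⟨fun Z hZ => (boxInt_hasFDerivAt hw1 hZ).differentiableAt, fun j Z hZ => ?_⟩
  have h2 := boxInt_hasFDerivAt (h := h) (contDiffOn_pd hw (by norm_num : (1 : ℕ∞ω) + 1 ≤ 2) j) hZ
  exact h2.differentiableAt.congr_of_eventuallyEq (eventuallyEq_pd_boxInt hw1 hZ j)

lemma lap_boxInt {δ h : ℝ} {w : Pt d → ℝ} (hw : ContDiffOn ℝ 2 w {Z | -δ < Z.2}) {Z : Pt d}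
    (hZ : -δ < Z.2) : lap (boxInt h w) Z = boxInt h (lap w) Z := by
  have hw1 : ContDiffOn ℝ 1 w {Z | -δ < Z.2} := hw.of_le one_le_two
  have hpd := fun j => contDiffOn_pd hw (by norm_num : (1 : ℕ∞ω) + 1 ≤ 2) j
  have h1 : ∀ j, pd j (pd j (boxInt h w)) Z = boxInt h (pd j (pd j w)) Z := fun j => by
    rw [← pd_boxInt (hpd j) hZ, pd, (eventuallyEq_pd_boxInt hw1 hZ j).fderiv_eq]
    rfl
  simp only [lap, h1]
  simp only [boxInt, lap]
  rw [integral_finsetSum]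
  intro j _
  exact integrableOn_box ((contDiffOn_pd (m := 0) (hpd j) (by norm_num) j).continuousOn) hZ

lemma abs_boxInt_le {h B : ℝ} (hh : 0 ≤ h) {w : Pt d → ℝ} {Z : Pt d}
    (hB : ∀ s ∈ box d h, |w (Z + s)| ≤ B) : |boxInt h w Z| ≤ B * h ^ (d + 1) := by
  have := norm_setIntegral_le_of_norm_le_const (μ := volume) (f := fun s => w (Z + s))
    (isCompact_box h).measure_lt_top hB
  rwa [volume_box hh] at this

/-- Two periods of the half space above the height `R`. -/
def doubleCell (d : ℕ) (R : ℝ) : Set (Pt d) := Icc (0 : Fin d → ℝ) (fun _ => 2) ×ˢ Ioi R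

lemma measurableSet_doubleCell (R : ℝ) : MeasurableSet (doubleCell d R) :=
  measurableSet_Icc.prod measurableSet_Ioi

/-- Integer translations of the torus. -/
def intShift (e : Fin d → Fin 2) (Z : Pt d) : Pt d :=
  Z + ((fun l => ((-((e l : ℕ) : ℤ) : ℤ) : ℝ)), 0)

lemma measurePreserving_intShift (e : Fin d → Fin 2) :
    MeasurePreserving (intShift e) volume volume := measurePreserving_add_right _ _

lemma XPeriodic.comp_intShift {f : Pt d → ℝ} (hper : XPeriodic f) (e : Fin d → Fin 2) :
    f ∘ intShift e = f := funext fun Z => periodic_int_shift hper _ Z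

/-- A box of side at most 1 based in the unit cell may stick out into the next one, but it stays
within two periods, covered by 2^d integer translates of one. -/
lemma doubleCell_subset : doubleCell d 0 ⊆ ⋃ e, intShift e ⁻¹' halfCell d := by
  refine fun Z hZ => mem_iUnion.2 ⟨fun l => if Z.1 l ≤ 1 then 0 else 1, ?_⟩
  refine ⟨⟨fun l => ?_, fun l => ?_⟩, ?_⟩
  · have := hZ.1.1 l
    simp only [intShift, Prod.fst_add, Pi.add_apply, Pi.zero_apply] at this ⊢
    split_ifs with h
    · simpa using this
    · simp only [Fin.val_one, Nat.cast_one, Int.cast_neg, Int.cast_one]; linarith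
  · have := hZ.1.2 l
    simp only [intShift, Prod.fst_add, Pi.add_apply, Pi.one_apply] at this ⊢
    split_ifs with h
    · simpa using h
    · simp only [Fin.val_one, Nat.cast_one, Int.cast_neg, Int.cast_one]; linarith
  · simpa [intShift] using hZ.2

lemma integrableOn_doubleCell {f : Pt d → ℝ} (hper : XPeriodic f)
    (hf : IntegrableOn f (halfCell d)) : IntegrableOn f (doubleCell d 0) := by
  have h1 : ∀ e, IntegrableOn f (intShift e ⁻¹' halfCell d) := by
    intro e
    have := ((measurePreserving_intShift e).integrableOn_comp_preimage
      (measurableEmbedding_addRight _) (f := f) (s := halfCell d)).2 hf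
    rwa [hper.comp_intShift] at this
  exact (integrableOn_finite_iUnion.2 h1).mono_set doubleCell_subset

/-- Young's inequality |w| ≤ η/2 + w²/(2η) bounds the integral over the box by η/2 plus a multiple
of the integral of w² over the tail of two periods, which tends to 0. Pointwise values of w are not
controlled by L² alone, hence the averages. -/
lemma boxInt_tendsto_zero {δ h : ℝ} {w : Pt d → ℝ} (hδ : 0 < δ) (hh : 0 ≤ h) (hh1 : h ≤ 1)
    (hw : ContinuousOn w {Z | -δ < Z.2}) (hper : XPeriodic w)
    (hL2 : MemLp w 2 (volume.restrict (halfCell d))) :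
    ∀ η > 0, ∃ R, ∀ Z : Pt d, R ≤ Z.2 → |boxInt h w Z| ≤ η := by
  intro η hη
  have hper2 : XPeriodic (fun Z => w Z ^ 2) := fun Z l => congrArg (· ^ 2) (hper Z l)
  have hint : IntegrableOn (fun Z => w Z ^ 2) (doubleCell d 0) :=
    integrableOn_doubleCell hper2 hL2.integrable_sq
  have hlim : Tendsto (fun n : ℕ => ∫ Z in doubleCell d n, w Z ^ 2) atTop (𝓝 0) := by
    have h1 := tendsto_setIntegral_of_antitone (μ := volume) (f := fun Z : Pt d => w Z ^ 2)
      (s := fun n : ℕ => doubleCell d n) (fun n => measurableSet_doubleCell _)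
      (fun m n hmn => prod_mono le_rfl (Ioi_subset_Ioi (by exact_mod_cast hmn)))
      ⟨0, by simpa using hint⟩
    have h2 : ⋂ n : ℕ, doubleCell d n = ∅ := by
      refine eq_empty_of_forall_notMem fun Z hZ => ?_
      obtain ⟨n, hn⟩ := exists_nat_ge Z.2
      have := (mem_iInter.1 hZ n).2
      exact absurd this (not_lt.2 hn)
    rw [h2] at h1
    simpa using h1
  obtain ⟨n, hn⟩ := (hlim.eventually_lt_const (by positivity : (0 : ℝ) < η ^ 2)).exists
  refine ⟨n + 1, fun Z hZ => ?_⟩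
  obtain ⟨X, hX, hXg⟩ := exists_mem_Icc_of_periodic Z
  rw [hXg _ (hper.boxInt h)]
  have hY : -δ < ((X, Z.2) : Pt d).2 := by
    have : (0 : ℝ) ≤ n := n.cast_nonneg
    simp only
    linarith
  have hcw := integrableOn_box (h := h) hw hY
  have hcw2 := integrableOn_box (h := h) (w := fun Z => w Z ^ 2) (hw.pow 2) hY
  have hsq : ∫ s in box d h, w ((X, Z.2) + s) ^ 2 ≤ ∫ Z in doubleCell d n, w Z ^ 2 := by
    have hmp : MeasurePreserving (fun s : Pt d => (X, Z.2) + s) volume volume :=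
      measurePreserving_add_left _ _
    rw [← hmp.setIntegral_preimage_emb (measurableEmbedding_addLeft _) (fun Z => w Z ^ 2)
      (doubleCell d n)]
    refine setIntegral_mono_set (f := fun s => w ((X, Z.2) + s) ^ 2) ?_
      (ae_of_all _ fun s => sq_nonneg (w ((X, Z.2) + s))) (ae_of_all _ fun s hs => ?_)
    · have : IntegrableOn (fun Z => w Z ^ 2) (doubleCell d n) :=
        hint.mono_set (prod_mono le_rfl (Ioi_subset_Ioi n.cast_nonneg))
      exact (hmp.integrableOn_comp_preimage (measurableEmbedding_addLeft _)).2 this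
    · refine ⟨⟨fun l => ?_, fun l => ?_⟩, ?_⟩
      · exact add_nonneg (hX.1 l) (hs.1.1 l)
      · have h1 := hX.2 l
        have h2 := hs.1.2 l
        simp only [Pi.one_apply] at h1
        simp only [Prod.fst_add, Pi.add_apply]
        linarith
      · have : 0 ≤ s.2 := hs.2.1
        simp only [Prod.snd_add, mem_Ioi]
        linarith
  calc |boxInt h w (X, Z.2)| ≤ ∫ s in box d h, |w ((X, Z.2) + s)| :=
        abs_integral_le_integral_abs
    _ ≤ ∫ s in box d h, (η / 2 + (2 * η)⁻¹ * w ((X, Z.2) + s) ^ 2) := by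
        refine setIntegral_mono_on hcw.abs
          ((integrableOn_const (isCompact_box h).measure_lt_top.ne).add (hcw2.const_mul _))
          (measurableSet_box h) fun s _ => ?_
        have h1 := sq_nonneg (|w ((X, Z.2) + s)| - η)
        have h2 := sq_abs (w ((X, Z.2) + s))
        rw [← sub_nonneg]
        have : η / 2 + (2 * η)⁻¹ * w ((X, Z.2) + s) ^ 2 - |w ((X, Z.2) + s)|
            = (|w ((X, Z.2) + s)| - η) ^ 2 / (2 * η) := by
          rw [← h2]; field_simp; ring
        rw [this]
        positivity
    _ = h ^ (d + 1) * (η / 2) + (2 * η)⁻¹ * ∫ s in box d h, w ((X, Z.2) + s) ^ 2 := by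
        have hc : Integrable (fun _ => η / 2) (volume.restrict (box d h)) :=
          integrableOn_const (isCompact_box h).measure_lt_top.ne
        rw [integral_add hc (hcw2.const_mul _), integral_const_mul, setIntegral_const,
          volume_box hh, smul_eq_mul]
    _ ≤ 1 * (η / 2) + (2 * η)⁻¹ * η ^ 2 := by
        gcongr
        · exact pow_le_one₀ hh hh1
        · exact hsq.trans hn.le
    _ = η := by field_simp; ring

lemma le_of_boxInt_le {δ B : ℝ} {w : Pt d → ℝ} (hw : ContinuousOn w {Z | -δ < Z.2}) {Z : Pt d}
    (hZ : -δ < Z.2) (hB : ∀ h, 0 < h → h ≤ 1 → boxInt h w Z ≤ B * h ^ (d + 1)) : w Z ≤ B := by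
  by_contra! hlt
  obtain ⟨B', hB1, hB2⟩ := exists_between hlt
  have hc : ContinuousAt (fun s => w (Z + s)) 0 := by
    have h1 : ContinuousAt w (Z + 0) := by
      rw [add_zero]; exact hw.continuousAt ((isOpen_above δ).mem_nhds hZ)
    exact h1.comp (f := fun s => Z + s) (by fun_prop)
  have hev : ∀ᶠ s in 𝓝 (0 : Pt d), B' < w (Z + s) :=
    hc.eventually_const_lt (by simpa using hB2)
  obtain ⟨r, hr, hrs⟩ := Metric.eventually_nhds_iff_ball.1 hev
  set h := min (r / 2) 1 with hh
  have hpos : 0 < h := by positivity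
  have hle : ∀ s ∈ box d h, B' ≤ w (Z + s) := by
    intro s hs
    refine (hrs s ?_).le
    have h1 : ‖s‖ ≤ h := by
      rw [Prod.norm_def, max_le_iff, pi_norm_le_iff_of_nonneg hpos.le]
      refine ⟨fun l => ?_, ?_⟩
      · rw [Real.norm_of_nonneg (hs.1.1 l)]; exact hs.1.2 l
      · rw [Real.norm_of_nonneg hs.2.1]; exact hs.2.2
    rw [mem_ball_zero_iff]
    have : h ≤ r / 2 := min_le_left _ _
    linarith
  have h1 : ∫ _ in box d h, B' ≤ boxInt h w Z :=
    setIntegral_mono_on (integrableOn_const (isCompact_box h).measure_lt_top.ne)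
      (integrableOn_box hw hZ) (measurableSet_box h) hle
  rw [setIntegral_const, volume_box hpos.le, smul_eq_mul] at h1
  have h2 := hB h hpos (min_le_right _ _)
  have h3 : 0 < h ^ (d + 1) := by positivity
  nlinarith

/-- Square integrable periodic solutions of Poisson's equation on a half space decay exponentially
if the source does. -/
theorem decay_of_memLp {δ K : ℝ} {w : Pt d → ℝ} (hδ : 0 < δ)
    (hw : ContDiffOn ℝ 2 w {Z | -δ < Z.2}) (hper : XPeriodic w) (hK : 0 < K)
    (hlap : ∀ Z : Pt d, 0 ≤ Z.2 → |lap w Z| ≤ K * Real.exp (-Z.2))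
    (h1 : ∀ Z : Pt d, 0 ≤ Z.2 → Z.2 ≤ 1 → |w Z| ≤ K)
    (hL2 : MemLp w 2 (volume.restrict (halfCell d))) (Z : Pt d) (hZ : 0 ≤ Z.2) :
    |w Z| ≤ (8 * d + 3) * K * Real.exp (-Z.2) := by
  have hZδ : -δ < Z.2 := by linarith
  -- Box integrals commute with the Laplacian and all data scale like h^(d+1), so the estimate for
  -- averages has a constant free of h and survives h → 0. The bound on w up to height 1 controls
  -- boxes based at Y = 0.
  have main : ∀ h, 0 < h → h ≤ 1 →
      |boxInt h w Z| ≤ (8 * d + 3) * K * Real.exp (-Z.2) * h ^ (d + 1) := by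
    intro h hh hh1
    have := decay_of_tendsto (K := K * h ^ (d + 1)) hδ (twiceDiff_boxInt (h := h) hw)
      (hper.boxInt h) (by positivity) (fun Z' hZ' => ?_) (fun Z' hZ' => ?_)
      (boxInt_tendsto_zero hδ hh.le hh1 hw.continuousOn hper hL2) Z hZ
    · linarith
    · rw [lap_boxInt hw (by linarith), mul_right_comm]
      refine abs_boxInt_le hh.le fun s hs => ?_
      have hs2 : 0 ≤ s.2 := hs.2.1
      refine (hlap _ (by simpa using add_nonneg hZ' hs2)).trans ?_
      gcongr
      simpa using hs2
    · refine abs_boxInt_le hh.le fun s hs => ?_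
      have hs2 : 0 ≤ s.2 := hs.2.1
      have hs3 : s.2 ≤ h := hs.2.2
      refine h1 _ ?_ ?_
      · simpa [hZ'] using hs2
      · simpa [hZ'] using hs3.trans hh1
  rw [abs_le']
  refine ⟨le_of_boxInt_le hw.continuousOn hZδ fun h hh hh1 => (le_abs_self _).trans (main h hh hh1),
    le_of_boxInt_le (w := fun Z => -w Z) hw.continuousOn.neg hZδ fun h hh hh1 => ?_⟩
  refine le_trans ?_ (main h hh hh1)
  rw [boxInt, integral_neg]
  exact neg_le_abs _

end RoughChannel

noncomputable section

namespace RoughChannel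

variable {d : ℕ} {H : (Fin d → ℝ) → ℝ}

/-! ### Regularity and decay for Poisson's equation with parameters -/

/-- The microscopic Laplacian. -/
def lapX (W : MicS d) : MicS d := fun z Z => ∑ j, pdX j (pdX j W) z Z

/-- With δ = min H the flat half space Y > -δ lies inside the layer, which leaves room below Y = 0
for the half space estimates. -/
lemma Wall.exists_lower (hH : Wall H) : ∃ δ > 0, ∀ Z : Pt d, -δ < Z.2 → -H Z.1 < Z.2 := by
  obtain ⟨X0, hX0, hmin⟩ := (isCompact_Icc (a := (0 : Fin d → ℝ)) (b := 1)).exists_isMinOn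
    ⟨0, le_rfl, zero_le_one⟩ hH.cont.continuousOn
  refine ⟨H X0, hH.pos X0, fun Z hZ => ?_⟩
  obtain ⟨X, hX, hXg⟩ := exists_mem_Icc_of_periodic Z
  have h1 := hXg (fun Z => H Z.1) (fun Z l => by simp [hH.per])
  have h2 : H X0 ≤ H X := hmin hX
  simp only at h1
  linarith

lemma RegularMic.contDiffOn {W : MicS d} (h : RegularMic H W) {δ : ℝ}
    (hδ : ∀ Z : Pt d, -δ < Z.2 → -H Z.1 < Z.2) {z : Pt d} (hz : z ∈ slab d) :
    ContDiffOn ℝ ∞ (W z) {Z | -δ < Z.2} := fun Z hZ =>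
  (ContDiffAt.comp (g := unc W) (f := fun Z => (z, Z)) Z (h.contDiffAt hz (hδ Z hZ).le)
    (contDiffAt_const.prodMk contDiffAt_id)).contDiffWithinAt

lemma RegularMic.sum {ι : Type*} (s : Finset ι) {F : ι → MicS d}
    (h : ∀ i ∈ s, RegularMic H (F i)) : RegularMic H (fun z Z => ∑ i ∈ s, F i z Z) := by
  classical
  induction s using Finset.induction_on with
  | empty => simpa using RegularMic.const 0
  | insert a s ha ih =>
    simp only [Finset.sum_insert ha]
    exact (h a (by simp)).add (ih fun i hi => h i (by simp [hi]))

lemma RegularMic.lapX {W : MicS d} (h : RegularMic H W) : RegularMic H (lapX W) :=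
  RegularMic.sum _ fun j _ => (h.pdX j).pdX j

lemma Dv_sum {ι : Type*} (s : Finset ι) {F : ι → MicS d}
    (h : ∀ i ∈ s, RegularMic H (F i)) (v : Pt d × Pt d) :
    LEq H (Dv v fun z Z => ∑ i ∈ s, F i z Z) (fun z Z => ∑ i ∈ s, Dv v (F i) z Z) := by
  classical
  induction s using Finset.induction_on with
  | empty =>
    intro z _ Z _
    simp [Dv_const]
  | insert a s ha ih =>
    have h' : ∀ i ∈ s, RegularMic H (F i) := fun i hi => h i (by simp [hi])
    simp only [Finset.sum_insert ha]
    refine (Dv_add (h a (by simp)) (RegularMic.sum s h') v).trans fun z hz Z hZ => ?_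
    simp only [ih h' z hz Z hZ]

/-- Square integrability on a half space. -/
def L2half (W : MicS d) : Prop := ∀ z ∈ slab d, MemLp (W z) 2 (volume.restrict (halfCell d))

lemma L2half.of_layerCell (hH : Wall H) {W : MicS d}
    (h : ∀ z ∈ slab d, MemLp (W z) 2 (volume.restrict (layerCell H))) : L2half W := fun z hz =>
  (h z hz).mono_measure (Measure.restrict_mono (s := halfCell d) (fun Z hZ =>
    show _ ∧ _ from ⟨hZ.1, hH.lt_of_nonneg (le_of_lt (show 0 < Z.2 from hZ.2))⟩) le_rfl)

lemma measurableSet_halfCell : MeasurableSet (halfCell d) := measurableSet_Icc.prod measurableSet_Ioi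

lemma RegularMic.continuousOn (hH : Wall H) {W : MicS d} (h : RegularMic H W) {z : Pt d}
    (hz : z ∈ slab d) : ContinuousOn (W z) {Z : Pt d | 0 ≤ Z.2} := by
  obtain ⟨δ, hδ, hδH⟩ := hH.exists_lower
  exact (h.contDiffOn hδH hz).continuousOn.mono fun Z hZ => by
    have : 0 ≤ Z.2 := hZ
    simp only [mem_ofPred_eq]
    linarith

lemma integrable_exp_halfCell : IntegrableOn (fun Z : Pt d => Real.exp (-(2 * Z.2)))
    (halfCell d) := by
  rw [halfCell, IntegrableOn, Measure.volume_eq_prod, ← Measure.prod_restrict]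
  have h1 : Integrable (fun _ : Fin d → ℝ => (1 : ℝ)) (volume.restrict (Icc 0 1)) :=
    integrableOn_const isCompact_Icc.measure_lt_top.ne
  have h2 : Integrable (fun y : ℝ => Real.exp (-(2 * y))) (volume.restrict (Ioi 0)) := by
    have := integrableOn_exp_mul_Ioi (a := -2) (by norm_num) 0
    simpa [IntegrableOn, neg_mul] using this
  simpa using h1.mul_prod h2

lemma BddW.l2half (hH : Wall H) {W : MicS d} (hW : RegularMic H W) (h : BddW 1 W) : L2half W := by
  intro z hz
  obtain ⟨C, hC, h⟩ := h
  have hm : AEStronglyMeasurable (W z) (volume.restrict (halfCell d)) :=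
    ((hW.continuousOn hH hz).mono fun Z (hZ : Z ∈ halfCell d) =>
      le_of_lt (show 0 < Z.2 from hZ.2)).aestronglyMeasurable
      measurableSet_halfCell
  rw [memLp_two_iff_integrable_sq hm]
  refine Integrable.mono' (integrable_exp_halfCell.const_mul (C ^ 2)) (hm.pow 2) ?_
  refine (ae_restrict_mem measurableSet_halfCell).mono fun Z hZ => ?_
  have h1 := h z hz Z (le_of_lt hZ.2)
  rw [Real.norm_of_nonneg (sq_nonneg _), ← sq_abs]
  calc |W z Z| ^ 2 ≤ (C * Real.exp (-(1 * Z.2))) ^ 2 := by gcongr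
    _ = C ^ 2 * Real.exp (-(2 * Z.2)) := by
      rw [mul_pow, ← Real.exp_nat_mul]; congr 2; push_cast; ring

/-- By periodicity only the fractional part of the horizontal shift matters, and the shifted cell
then lies in two periods. -/
lemma memLp_shift {f : Pt d → ℝ} (hper : XPeriodic f)
    (hf : MemLp f 2 (volume.restrict (halfCell d))) (a : Pt d) (ha : 0 ≤ a.2) :
    MemLp (fun Z => f (Z + a)) 2 (volume.restrict (halfCell d)) := by
  set b : Pt d := (fun l => Int.fract (a.1 l), a.2) with hb
  have e : (fun Z => f (Z + a)) = fun Z => f (Z + b) := by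
    funext Z
    have := periodic_int_shift hper (fun l => ⌊a.1 l⌋) (Z + b)
    rw [← this]
    congr 1
    ext <;> simp [hb, add_assoc]
  have hT : IntegrableOn (fun Z => f Z ^ 2) (doubleCell d 0) :=
    integrableOn_doubleCell (fun Z l => congrArg (· ^ 2) (hper Z l)) hf.integrable_sq
  have hmeas : AEStronglyMeasurable f (volume.restrict (doubleCell d 0)) := by
    have h1 : ∀ e, AEStronglyMeasurable f (volume.restrict (intShift e ⁻¹' halfCell d)) := by
      intro e
      have := hf.1.comp_measurePreserving
        ((measurePreserving_intShift e).restrict_preimage measurableSet_halfCell)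
      rwa [hper.comp_intShift] at this
    exact (AEStronglyMeasurable.iUnion h1).mono_measure
      (Measure.restrict_mono doubleCell_subset le_rfl)
  have hmp : MeasurePreserving (fun Z : Pt d => Z + b) volume volume :=
    measurePreserving_add_right _ _
  have hsub : halfCell d ⊆ (fun Z : Pt d => Z + b) ⁻¹' doubleCell d 0 := by
    intro Z hZ
    refine ⟨⟨fun l => ?_, fun l => ?_⟩, ?_⟩
    · exact add_nonneg (hZ.1.1 l) (Int.fract_nonneg _)
    · have h1 := hZ.1.2 l
      have h2 := (Int.fract_lt_one (a.1 l)).le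
      simp only [Pi.one_apply] at h1
      simp only [hb, Prod.fst_add, Pi.add_apply]
      linarith
    · exact add_pos_of_pos_of_nonneg hZ.2 ha
  have hL : MemLp f 2 (volume.restrict (doubleCell d 0)) :=
    (memLp_two_iff_integrable_sq hmeas).2 hT
  rw [e]
  exact (hL.comp_measurePreserving
    (hmp.restrict_preimage (measurableSet_doubleCell 0))).mono_measure
    (Measure.restrict_mono hsub le_rfl)

lemma bddW_of_lapX (hH : Wall H) {W : MicS d} (hW : RegularMic H W) (hL2 : L2half W)
    (hlap : BddW 1 (lapX W)) : BddW 1 W := by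
  obtain ⟨δ, hδ, hδH⟩ := hH.exists_lower
  obtain ⟨C, hC, hlap⟩ := hlap
  obtain ⟨C', hC'⟩ := hW.exists_bound_slab hH.cont hH.per 1
  refine ⟨(8 * d + 3) * (C + |C'| + 1), by positivity, fun z hz Z hZ => ?_⟩
  rw [one_mul]
  refine decay_of_memLp hδ ((hW.contDiffOn hδH hz).of_le two_le_infty) (hW.1 z)
    (by positivity) (fun Z' hZ' => ?_) (fun Z' h0 h1 => ?_) (hL2 z hz) Z hZ
  · have := hlap z hz Z' hZ'
    rw [one_mul] at this
    refine this.trans ?_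
    gcongr
    linarith [abs_nonneg C']
  · have := hC' z hz Z' (hH.lt_of_nonneg h0).le h1
    linarith [le_abs_self C']

/-- The mean value inequality along a segment. -/
lemma abs_sub_le_of_Dv (hH : Wall H) {W : MicS d} (hW : RegularMic H W) {v : Pt d × Pt d}
    (hv : v.1.2 = 0) (hv2 : 0 ≤ v.2.2) {z Z : Pt d} (hz : z ∈ slab d) (hZ : 0 ≤ Z.2) {t B : ℝ}
    (ht : 0 ≤ t)
    (hB : ∀ s ∈ Icc 0 t, |Dv v W (z + s • v.1) (Z + s • v.2)| ≤ B) :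
    |W (z + t • v.1) (Z + t • v.2) - W z Z| ≤ B * t := by
  have := norm_image_sub_le_of_norm_deriv_le_segment' (C := B)
    (f := fun s : ℝ => W (z + s • v.1) (Z + s • v.2)) (a := 0) (b := t) (fun s hs =>
    (hasDerivAt_line v s (hW.differentiableAt (add_smul_mem_slab hz hv s)
      (hH.lt_of_nonneg (by simpa using add_nonneg hZ (mul_nonneg hs.1 hv2))).le)).hasDerivWithinAt)
    (fun s hs => hB s ⟨hs.1, hs.2.le⟩) t ⟨ht, le_rfl⟩
  simpa using this

/-- The difference quotients of W along v solve Poisson's equation with the difference quotients of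
the source, which the mean value inequality bounds by K exp(-Y) uniformly in the step;
`decay_of_memLp` applies with the same constant to each, and the step tends to 0. Only the
derivative of the Laplacian has to decay, not the Laplacian. The sign condition keeps shifted points
in the half space. -/
lemma bddW_Dv_of_nonneg (hH : Wall H) {W : MicS d} (hW : RegularMic H W) (hL2 : L2half W)
    {v : Pt d × Pt d} (hv : v.1.2 = 0) (hv2 : 0 ≤ v.2.2) (hlap : BddW 1 (Dv v (lapX W))) :
    BddW 1 (Dv v W) := by
  obtain ⟨δ, hδ, hδH⟩ := hH.exists_lower
  obtain ⟨C, hC, hlap⟩ := hlap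
  obtain ⟨C', hC'⟩ := (hW.Dv v).exists_bound_slab hH.cont hH.per (1 + v.2.2)
  set K := C + |C'| + 1 with hK
  have hKpos : 0 < K := by positivity
  refine ⟨(8 * d + 3) * K, by positivity, fun z hz Z hZ => ?_⟩
  rw [one_mul]
  have hmem : ∀ s : ℝ, z + s • v.1 ∈ slab d := add_smul_mem_slab hz hv
  have main : ∀ t : ℝ, 0 < t → t ≤ 1 → |t⁻¹ * (W (z + t • v.1) (Z + t • v.2) - W z Z)|
      ≤ (8 * d + 3) * K * Real.exp (-Z.2) := by
    intro t ht ht1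
    have hc1 : ContDiffOn ℝ 2 (W z) {Z | -δ < Z.2} :=
      (hW.contDiffOn hδH hz).of_le two_le_infty
    have hc2' : ContDiffOn ℝ 2 (W (z + t • v.1)) {Z | -δ < Z.2} :=
      (hW.contDiffOn hδH (hmem t)).of_le two_le_infty
    have hshift : ∀ Z : Pt d, -δ < Z.2 → -δ < (Z + t • v.2).2 := fun Z hZ => by
      have : 0 ≤ t * v.2.2 := mul_nonneg ht.le hv2
      simp only [Prod.snd_add, Prod.smul_snd, smul_eq_mul]
      linarith
    have hc2 : ContDiffOn ℝ 2 (fun Z => W (z + t • v.1) (Z + t • v.2)) {Z | -δ < Z.2} :=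
      hc2'.comp (by fun_prop) fun Z hZ => hshift Z hZ
    have hlapt : ∀ Z : Pt d, -δ < Z.2 →
        lap (fun Z => t⁻¹ * (W (z + t • v.1) (Z + t • v.2) - W z Z)) Z
        = t⁻¹ * (lapX W (z + t • v.1) (Z + t • v.2) - lapX W z Z) := by
      have hpd : ∀ (f g : Pt d → ℝ), ContDiffOn ℝ 1 f {Z | -δ < Z.2} →
          ContDiffOn ℝ 1 g {Z | -δ < Z.2} → ∀ (Z : Pt d) (j : Fin (d + 1)), -δ < Z.2 →
          pd j (fun Z => t⁻¹ * (f (Z + t • v.2) - g Z)) Z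
            = t⁻¹ * (pd j f (Z + t • v.2) - pd j g Z) := by
        intro f g hf hg Z j hZ
        have h1 := (hf.contDiffAt ((isOpen_above δ).mem_nhds (hshift Z hZ))).differentiableAt
          one_ne_zero
        have h2 := (hg.contDiffAt ((isOpen_above δ).mem_nhds hZ)).differentiableAt one_ne_zero
        have h3 := (hasFDerivAt_comp_add_right (t • v.2)).2 h1.hasFDerivAt
        have h4 : HasFDerivAt (fun Z => t⁻¹ * (f (Z + t • v.2) - g Z)) _ Z :=
          (h3.sub h2.hasFDerivAt).const_mul t⁻¹
        rw [pd, h4.fderiv]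
        simp [pd]
      intro Z hZ
      simp only [lapX, lap, ← Finset.sum_sub_distrib, Finset.mul_sum]
      refine Finset.sum_congr rfl fun j _ => ?_
      have he : pd j (fun Z => t⁻¹ * (W (z + t • v.1) (Z + t • v.2) - W z Z)) =ᶠ[𝓝 Z]
          fun Z => t⁻¹ * (pd j (W (z + t • v.1)) (Z + t • v.2) - pd j (W z) Z) := by
        filter_upwards [(isOpen_above δ).mem_nhds hZ] with Z' hZ'
        exact hpd _ _ (hc2'.of_le one_le_two) (hc1.of_le one_le_two) Z' j hZ'
      rw [pd, he.fderiv_eq]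
      exact hpd _ _ (contDiffOn_pd hc2' (by norm_num) j) (contDiffOn_pd hc1 (by norm_num) j) Z j hZ
    refine decay_of_memLp (w := fun Z => t⁻¹ * (W (z + t • v.1) (Z + t • v.2) - W z Z)) hδ
      (contDiffOn_const.mul (hc2.sub hc1)) (fun Z l => ?_) hKpos (fun Z' hZ' => ?_)
      (fun Z' h0 h1 => ?_) ?_ Z hZ
    · have h1 := hW.1 (z + t • v.1) (Z + t • v.2) l
      have h2 := hW.1 z Z l
      simp only
      rw [add_right_comm, h1, h2]
    · rw [hlapt Z' (by linarith), abs_mul, abs_of_pos (inv_pos.2 ht), inv_mul_le_iff₀ ht, mul_comm t]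
      refine abs_sub_le_of_Dv hH hW.lapX hv hv2 hz hZ' ht.le fun s hs => ?_
      have hs2 : 0 ≤ s * v.2.2 := mul_nonneg hs.1 hv2
      refine (hlap _ (hmem s) _ (by simpa using add_nonneg hZ' hs2)).trans ?_
      have : C ≤ K := by rw [hK]; linarith [abs_nonneg C']
      rw [one_mul]
      gcongr
      simpa using hs2
    · rw [abs_mul, abs_of_pos (inv_pos.2 ht), inv_mul_le_iff₀ ht, mul_comm t]
      refine abs_sub_le_of_Dv hH hW hv hv2 hz h0 ht.le fun s hs => ?_
      have hs2 : 0 ≤ s * v.2.2 := mul_nonneg hs.1 hv2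
      have hs3 : s * v.2.2 ≤ v.2.2 := mul_le_of_le_one_left hv2 (hs.2.trans ht1)
      have h2 : 0 ≤ (Z' + s • v.2).2 := by simpa using add_nonneg h0 hs2
      refine (hC' _ (hmem s) _ (hH.lt_of_nonneg h2).le ?_).trans ?_
      · simp only [Prod.snd_add, Prod.smul_snd, smul_eq_mul]
        linarith
      · rw [hK]; linarith [le_abs_self C']
    -- Membership in L² suffices here; its norm, which may depend on z and on the step, does not
    -- enter the constant.
    · exact ((memLp_shift (hW.1 _) (hL2 _ (hmem t)) (t • v.2)
        (mul_nonneg ht.le hv2)).sub (hL2 z hz)).const_mul t⁻¹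
  have hd := hasDerivAt_line (W := W) (z := z) (Z := Z) v 0
    (by simpa using hW.differentiableAt hz (hH.lt_of_nonneg hZ).le)
  rw [hasDerivAt_iff_tendsto_slope_zero] at hd
  have hd' := (hd.mono_left (nhdsGT_le_nhdsNE 0)).abs
  simp only [zero_smul, add_zero, zero_add, smul_eq_mul] at hd'
  refine le_of_tendsto hd' ?_
  filter_upwards [Ioc_mem_nhdsGT (zero_lt_one' ℝ)] with t ht using main t ht.1 ht.2

lemma bddW_Dv (hH : Wall H) {W : MicS d} (hW : RegularMic H W) (hL2 : L2half W)
    {v : Pt d × Pt d} (hv : v.1.2 = 0) (hlap : BddW 1 (Dv v (lapX W))) : BddW 1 (Dv v W) := by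
  rcases le_total 0 v.2.2 with h | h
  · exact bddW_Dv_of_nonneg hH hW hL2 hv h hlap
  · have hneg : ∀ W : MicS d, BddW 1 (Dv v W) → BddW 1 (Dv (-v) W) := by
      rintro W ⟨C, hC, h⟩
      refine ⟨C, hC, fun z hz Z hZ => ?_⟩
      have := h z hz Z hZ
      simpa [Dv] using this
    obtain ⟨C, hC, h⟩ := bddW_Dv_of_nonneg hH hW hL2 (v := -v) (by simp [hv]) (by simpa using h)
      (hneg _ hlap)
    refine ⟨C, hC, fun z hz Z hZ => ?_⟩
    have := h z hz Z hZ
    simpa [Dv] using this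

lemma lapX_leq (hH : Wall H) {W : MicS d} (hW : RegularMic H W) :
    LEq H (lapX W) (fun z Z => ∑ j : Fin (d + 1), Dv (0, dir j) (Dv (0, dir j) W) z Z) := by
  intro z hz Z hZ
  refine Finset.sum_congr rfl fun j _ => ?_
  rw [(hW.pdX j).pdX_leq j z hz Z hZ]
  exact (hW.pdX_leq j).Dv hH.cont (hW.pdX j) (hW.Dv _) rfl z hz Z hZ

lemma lapX_Dv (hH : Wall H) {W : MicS d} (hW : RegularMic H W) {v : Pt d × Pt d}
    (hv : v.1.2 = 0) : LEq H (lapX (Dv v W)) (Dv v (lapX W)) := by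
  have hsum : RegularMic H
      (fun z Z => ∑ j : Fin (d + 1), Dv (0, dir j) (Dv (0, dir j) W) z Z) :=
    RegularMic.sum _ fun j _ => (hW.Dv _).Dv _
  refine (lapX_leq hH (hW.Dv v)).trans (LEq.trans ?_
    ((lapX_leq hH hW).Dv hH.cont hW.lapX hsum hv).symm)
  refine LEq.trans ?_ (Dv_sum _ (fun j _ => (hW.Dv _).Dv _) v).symm
  intro z hz Z hZ
  refine Finset.sum_congr rfl fun j _ => ?_
  rw [(Dv_comm hW (0, dir j) v).Dv hH.cont ((hW.Dv _).Dv _) ((hW.Dv _).Dv _) rfl z hz Z hZ]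
  exact Dv_comm (hW.Dv _) _ _ z hz Z hZ

/-- A derivative of W solves the same equation with the differentiated source; the exponential bound
just obtained provides the square integrability needed at the next stage. -/
lemma decN_of_lapX (hH : Wall H) (n : ℕ) {W : MicS d} (hW : RegularMic H W)
    (hlap : Decays H 1 (lapX W)) (h0 : BddW 1 W) : DecN 1 n W := by
  induction n generalizing W with
  | zero => exact h0
  | succ n ih =>
    refine ⟨h0, fun v hv => ih (hW.Dv v) ((hlap.Dv hv).congr hH (hW.Dv v).lapX
      (lapX_Dv hH hW hv).symm) ?_⟩
    exact bddW_Dv hH hW (h0.l2half hH hW) hv (hlap.Dv hv).bddW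

/-- A square integrable field whose Laplacian converges exponentially decays exponentially. -/
theorem decays_of_l2half (hH : Wall H) {W : MicS d} (hW : RegularMic H W) (hL2 : L2half W)
    (hlap : ∀ b : Pt d, Decays H 1 (Dv (0, b) (lapX W))) : Decays H 1 W := by
  -- The Laplacian may still have a nonzero limit depending on z, so the gradient is treated first:
  -- its Laplacian decays.
  have h1 : ∀ b : Pt d, Decays H 1 (Dv (0, b) W) := fun b =>
    ⟨hW.Dv _, fun n => decN_of_lapX hH n (hW.Dv _) ((hlap b).congr hH (hW.Dv _).lapX
      (lapX_Dv hH hW rfl).symm) (bddW_Dv hH hW hL2 rfl (hlap b).bddW)⟩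
  -- Being a sum of second derivatives of W, the Laplacian decays after all, and the estimate for W
  -- itself becomes available.
  have h2 : Decays H 1 (lapX W) :=
    (Decays.sum hH Finset.univ fun j _ => (h1 (dir j)).Dv rfl).congr hH hW.lapX
      (lapX_leq hH hW).symm
  exact ⟨hW, fun n => decN_of_lapX hH n hW h2 (bddW_of_lapX hH hW hL2 h2.bddW)⟩

/-- Integrate the bound on ∂_Y W from Y upwards; the comparison function is C exp(-Y) - C exp(-(Y +
s)). The bound does not depend on t, so it gives convergence as well as boundedness. -/
lemma abs_sub_vertical_le (hH : Wall H) {W : MicS d} (hW : RegularMic H W) {C : ℝ}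
    (hC : ∀ z ∈ slab d, ∀ Z : Pt d, 0 ≤ Z.2 →
      |Dv (0, ((0 : Fin d → ℝ), (1 : ℝ))) W z Z| ≤ C * Real.exp (-(1 * Z.2)))
    {z : Pt d} (hz : z ∈ slab d) (X : Fin d → ℝ) {Y t : ℝ} (hY : 0 ≤ Y) (ht : 0 ≤ t) :
    |W z (X, Y + t) - W z (X, Y)| ≤ C * Real.exp (-Y) := by
  set v : Pt d × Pt d := (0, ((0 : Fin d → ℝ), (1 : ℝ))) with hv
  have hC0 : 0 ≤ C := by
    have := (abs_nonneg _).trans (hC z hz (0, 0) le_rfl)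
    simpa using this
  have hd : ∀ s : ℝ, 0 ≤ s → HasDerivAt (fun s : ℝ => W z (X, Y + s) - W z (X, Y))
      (Dv v W z (X, Y + s)) s := by
    intro s hs
    have h := hasDerivAt_line (W := W) (z := z) (Z := (X, Y)) v s
      (hW.differentiableAt (by simpa [hv] using hz)
        (hH.lt_of_nonneg (by simpa [hv] using add_nonneg hY hs)).le)
    simp only [hv, smul_zero, add_zero, Prod.smul_mk, smul_eq_mul, mul_one, Prod.mk_add_mk] at h
    exact h.sub_const _
  have hB : ∀ s : ℝ, HasDerivAt (fun s => C * Real.exp (-Y) - C * Real.exp (-(Y + s)))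
      (C * Real.exp (-(Y + s))) s := by
    intro s
    have h1 : HasDerivAt (fun s : ℝ => Real.exp (-(Y + s))) (Real.exp (-(Y + s)) * -1) s :=
      (((hasDerivAt_id s).const_add Y).neg).exp
    exact ((h1.const_mul C).const_sub _).congr_deriv (by ring)
  have := image_norm_le_of_norm_deriv_right_le_deriv_boundary (a := 0) (b := t)
    (f := fun s : ℝ => W z (X, Y + s) - W z (X, Y)) (f' := fun s => Dv v W z (X, Y + s))
    (fun s hs => (hd s hs.1).continuousAt.continuousWithinAt)
    (fun s hs => (hd s hs.1).hasDerivWithinAt) (by simp) (fun s => hB s)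
    (fun s hs => by simpa using hC z hz (X, Y + s) (add_nonneg hY hs.1)) ⟨ht, le_rfl⟩
  refine this.trans ?_
  have : 0 ≤ C * Real.exp (-(Y + t)) := by positivity
  linarith

/-- A field with decaying microscopic gradient is bounded with all its derivatives. -/
theorem tame_of_gradient (hH : Wall H) {W : MicS d} (hW : RegularMic H W)
    (h : ∀ b : Pt d, Decays H 1 (Dv (0, b) W)) : Tame H W := by
  have hb : ∀ {W : MicS d}, RegularMic H W → (∀ b : Pt d, Decays H 1 (Dv (0, b) W)) →
      BddW 0 W := by
    intro W hW h
    obtain ⟨C, hC, hd⟩ := (h (0, 1)).bddW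
    obtain ⟨C', hC'⟩ := hW.exists_bound_slab hH.cont hH.per 0
    refine ⟨C + |C'|, by positivity, fun z hz Z hZ => ?_⟩
    have h1 := abs_sub_vertical_le hH hW hd hz Z.1 le_rfl hZ
    have h2 := hC' z hz (Z.1, 0) (hH.lt_of_nonneg (Z := (Z.1, 0)) le_rfl).le le_rfl
    have h3 := abs_sub_abs_le_abs_sub (W z Z) (W z (Z.1, 0))
    simp only [zero_add, neg_zero, Real.exp_zero, mul_one] at h1
    simp only [zero_mul, neg_zero, Real.exp_zero, mul_one]
    linarith [le_abs_self C']
  have hn : ∀ (n : ℕ) {W : MicS d}, RegularMic H W → (∀ b : Pt d, Decays H 1 (Dv (0, b) W)) →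
      DecN 0 n W := by
    intro n
    induction n with
    | zero => intro W hW h; exact hb hW h
    | succ n ih =>
      intro W hW h
      exact ⟨hb hW h, fun v hv => ih (hW.Dv v) fun b => ((h b).Dv hv).congr hH ((hW.Dv v).Dv _)
        (Dv_comm hW _ _)⟩
  exact ⟨⟨hW, fun n => hn n hW h⟩, h⟩

end RoughChannel

end

noncomputable section

namespace RoughChannel

variable {d : ℕ} {H : (Fin d → ℝ) → ℝ}

/-! ### Decay of the boundary layer correctors -/

lemma sym_apply (L : Ten d) (i j : Fin (d + 1)) : sym L i j = 1 / 2 * (L i j + L j i) := by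
  simp [sym]

lemma skew_apply (L : Ten d) (i j : Fin (d + 1)) : skew L i j = 1 / 2 * (L i j - L j i) := by
  simp [skew]

lemma gA_apply (a : ℝ) (L s : Ten d) (i j : Fin (d + 1)) :
    gA a L s i j = (∑ l, s i l * skew L l j) - (∑ l, skew L i l * s l j)
      - a * ((∑ l, s i l * sym L l j) + ∑ l, sym L i l * s l j) := by
  simp [gA, Matrix.mul_apply, mul_add]

lemma Tame.symPart (hH : Wall H) {L : Pt d → Pt d → Ten d}
    (hL : ∀ i j, Tame H fun z Z => L z Z i j) (i j : Fin (d + 1)) :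
    Tame H fun z Z => sym (L z Z) i j := by
  simp only [sym_apply]
  exact ((hL i j).add hH (hL j i)).const_mul hH _

lemma Tame.skewPart (hH : Wall H) {L : Pt d → Pt d → Ten d}
    (hL : ∀ i j, Tame H fun z Z => L z Z i j) (i j : Fin (d + 1)) :
    Tame H fun z Z => skew (L z Z) i j := by
  simp only [skew_apply]
  exact ((hL i j).sub hH (hL j i)).const_mul hH _

lemma Tame.gA (hH : Wall H) {L s : Pt d → Pt d → Ten d}
    (hL : ∀ i j, Tame H fun z Z => L z Z i j) (hs : ∀ i j, Tame H fun z Z => s z Z i j) (a : ℝ)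
    (i j : Fin (d + 1)) : Tame H fun z Z => gA a (L z Z) (s z Z) i j := by
  simp only [gA_apply]
  have h1 := Tame.symPart hH hL
  have h2 := Tame.skewPart hH hL
  refine ((Tame.sum hH _ fun l _ => (hs i l).mul hH (h2 l j)).sub hH
    (Tame.sum hH _ fun l _ => (h2 i l).mul hH (hs l j))).sub hH (Tame.const_mul hH a ?_)
  exact (Tame.sum hH _ fun l _ => (hs i l).mul hH (h1 l j)).add hH
    (Tame.sum hH _ fun l _ => (h1 i l).mul hH (hs l j))

/-- The term c z stands for a compensator: it needs no regularity in z, since a microscopic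
derivative annihilates it. -/
lemma pdX_leq_of_affine (hH : Wall H) {W A B : MicS d} (hA : RegularMic H A)
    (hB : RegularMic H B) {α β : ℝ} {c : MacS d}
    (h : ∀ z ∈ slab d, ∀ Z : Pt d, -H Z.1 < Z.2 → W z Z = α * A z Z + β * B z Z + c z)
    (j : Fin (d + 1)) : LEq H (pdX j W) (fun z Z => α * pdX j A z Z + β * pdX j B z Z) := by
  intro z hz Z hZ
  have hdiff : ∀ {A : MicS d}, RegularMic H A → DifferentiableAt ℝ (A z) Z := fun hA =>
    DifferentiableAt.comp (g := unc _) (f := fun Z => (z, Z)) Z (hA.differentiableAt hz hZ.le)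
      (by fun_prop)
  have ho : IsOpen {Z : Pt d | -H Z.1 < Z.2} :=
    isOpen_lt (hH.cont.comp continuous_fst).neg continuous_snd
  have he : W z =ᶠ[𝓝 Z] fun Z => α * A z Z + β * B z Z + c z := by
    filter_upwards [ho.mem_nhds hZ] with Z' hZ' using h z hz Z' hZ'
  have hd : HasFDerivAt (fun Z => α * A z Z + β * B z Z + c z) _ Z :=
    (((hdiff hA).hasFDerivAt.const_mul α).add ((hdiff hB).hasFDerivAt.const_mul β)).add_const (c z)
  simp only [pdX, pd]
  rw [he.fderiv_eq, hd.fderiv]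
  simp

lemma LEq.pdX (hH : Wall H) {W W' : MicS d} (h : LEq H W W') (j : Fin (d + 1)) :
    LEq H (pdX j W) (pdX j W') := by
  intro z hz Z hZ
  have ho : IsOpen {Z : Pt d | -H Z.1 < Z.2} :=
    isOpen_lt (hH.cont.comp continuous_fst).neg continuous_snd
  have he : W z =ᶠ[𝓝 Z] W' z := by
    filter_upwards [ho.mem_nhds hZ] with Z' hZ' using h z hz Z' hZ'
  simp only [RoughChannel.pdX, pd]
  rw [he.fderiv_eq]

lemma LEq.lapX (hH : Wall H) {W W' : MicS d} (h : LEq H W W') : LEq H (lapX W) (lapX W') :=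
  fun z hz Z hZ => Finset.sum_congr rfl fun j _ => ((h.pdX hH j).pdX hH j) z hz Z hZ

lemma lapX_pdX (hH : Wall H) {W : MicS d} (hW : RegularMic H W) (j : Fin (d + 1)) :
    LEq H (lapX (pdX j W)) (pdX j (lapX W)) :=
  (((hW.pdX_leq j).lapX hH).trans (lapX_Dv hH hW rfl)).trans (hW.lapX.pdX_leq j).symm

/-- The divergence commutes with the Laplacian, and div U = 0. -/
lemma sum_pdX_lapX (hH : Wall H) {U : MicV d} (hU : ∀ i, RegularMic H (U i))
    (hdiv : ∀ z ∈ slab d, ∀ Z : Pt d, -H Z.1 < Z.2 → ∑ j, pdX j (U j) z Z = 0) :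
    LEq H (fun z Z => ∑ i, pdX i (lapX (U i)) z Z) (fun _ _ => 0) := by
  have hs : RegularMic H (fun z Z => ∑ i, pdX i (U i) z Z) := RegularMic.sum _ fun i _ => (hU i).pdX i
  have h1 : LEq H (lapX fun z Z => ∑ i, pdX i (U i) z Z)
      (fun z Z => ∑ i, lapX (pdX i (U i)) z Z) := by
    refine (lapX_leq hH hs).trans fun z hz Z hZ => ?_
    simp only
    have h2 : ∀ j : Fin (d + 1), Dv (0, dir j) (Dv (0, dir j) fun z Z => ∑ i, pdX i (U i) z Z) z Z
        = ∑ i, Dv (0, dir j) (Dv (0, dir j) (pdX i (U i))) z Z := fun j => by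
      rw [(Dv_sum (Finset.univ) (fun i _ => (hU i).pdX i) (0, dir j)).Dv hH.cont (hs.Dv _)
        (RegularMic.sum _ fun i _ => ((hU i).pdX i).Dv _) rfl z hz Z hZ]
      exact Dv_sum _ (fun i _ => ((hU i).pdX i).Dv _) _ z hz Z hZ
    simp only [h2]
    rw [Finset.sum_comm]
    exact Finset.sum_congr rfl fun i _ => (lapX_leq hH ((hU i).pdX i) z hz Z hZ).symm
  have h0 : LEq H (lapX fun z Z => ∑ i, pdX i (U i) z Z) (fun _ _ => 0) := by
    have h3 : LEq H (fun z Z => ∑ i, pdX i (U i) z Z) (fun _ _ => 0) := hdiv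
    refine (h3.lapX hH).trans fun z _ Z _ => ?_
    have : ∀ j, pdX (d := d) j (fun _ _ => 0) = fun _ _ => 0 := fun j => by
      funext z Z
      simp [pdX, pd]
    simp [lapX, this]
  refine LEq.trans (fun z hz Z hZ => ?_) (h1.symm.trans h0)
  exact Finset.sum_congr rfl fun i _ => (lapX_pdX hH (hU i) i).symm z hz Z hZ

lemma decays_Dv_of_pdX (hH : Wall H) {κ : ℝ} {W : MicS d} (hW : RegularMic H W)
    (h : ∀ j, Decays H κ (pdX j W)) (b : Pt d) :
    Decays H κ (Dv (0, b) W) := by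
  have e : ((0, b) : Pt d × Pt d) = (∑ l : Fin d, b.1 l • ((0 : Pt d), (dir l.castSucc : Pt d)))
      + b.2 • ((0 : Pt d), (dir (Fin.last d) : Pt d)) := by
    refine Prod.ext ?_ (Prod.ext (funext fun l => ?_) ?_)
    · simp [Prod.fst_sum]
    · simp [Prod.fst_sum, Prod.snd_sum, Finset.sum_apply, Pi.single_apply]
    · simp [Prod.snd_sum]
  have h1 : Dv (0, b) W = fun z Z => (∑ l : Fin d, b.1 l * Dv (0, dir l.castSucc) W z Z)
      + b.2 * Dv (0, dir (Fin.last d)) W z Z := by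
    funext z Z
    simp only [RoughChannel.Dv, e, map_add, map_sum, map_smul, smul_eq_mul]
  have h2 : ∀ j, Decays H κ (RoughChannel.Dv (0, dir j) W) := fun j =>
    (h j).congr hH (hW.Dv _) (hW.pdX_leq j)
  rw [h1]
  exact (Decays.sum hH _ fun l _ => (h2 l.castSucc).const_mul hH _).add hH
    ((h2 (Fin.last d)).const_mul hH _)

namespace Expansion

variable {par : Params} {E : Expansion d} {f : MacV d}

/-- The correctors of order `k` converge, together with all derivatives, exponentially. -/
structure LayerDecay (H : (Fin d → ℝ) → ℝ) (E : Expansion d) (k : ℕ) : Prop where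
  U : ∀ i, Tame H (E.U k i)
  P : Decays H 1 (E.P k)
  S : ∀ i j, Decays H 1 (E.S k i j)

/-- The source is polynomial in the macroscopic fields and in derivatives of correctors whose
indices are all below k, and tame fields are stable under these operations. -/
lemma tame_layerF (hH : Wall H) (hE : E.IsElementary par H f) (k : ℕ)
    (ih : ∀ m < k, LayerDecay H E m) (i : Fin (d + 1)) : Tame H (E.layerF par k i) := by
  match k with
  | 0 => exact Tame.const 0
  | 1 => exact Tame.const 0
  | k + 2 =>
    have hU : ∀ m < k + 2, ∀ i, Tame H (E.U m i) := fun m hm => (ih m hm).U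
    have hS : ∀ m < k + 2, ∀ i j, Tame H (E.S m i j) := fun m hm i j => ((ih m hm).S i j).tame
    have hP : ∀ m < k + 2, Tame H (E.P m) := fun m hm => (ih m hm).P.tame
    have hu : ∀ m i, Tame H (fun z _ => E.u m i z) := fun m i => (hE.u_regular m i).tame hH
    have hdu : ∀ m i j, Tame H (fun z _ => pd j (E.u m i) z) := fun m i j =>
      ((hE.u_regular m i).pd j).tame hH
    unfold layerF
    refine ((((((Tame.sum hH _ fun j _ => ?_).add hH ?_).add hH ?_).sub hH ?_).add hH
      (Tame.sum hH _ fun j _ => ?_)).sub hH (Tame.const_mul hH _ (Tame.sum hH _ fun m hm => ?_)))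
    · exact (hS _ (by omega) _ _).pdX hH _
    · exact Tame.const_mul hH _ (Tame.sum hH _ fun j _ =>
        ((hU _ (by omega) _).pdX hH _).pdx hH _)
    · exact Tame.const_mul hH _ (Tame.sum hH _ fun j _ =>
        ((hU _ (by omega) _).pdx hH _).pdx hH _)
    · exact (hP _ (by omega)).pdx hH _
    · exact (hS _ (by omega) _ _).pdx hH _
    · have hm := Finset.mem_range.1 hm
      refine (Tame.sum hH _ fun j _ => ?_).add hH (Tame.sum hH _ fun j _ => ?_)
      · exact ((hu _ _).add hH (hU _ (by omega) _)).mul hH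
          (((hU _ (by omega) _).pdX hH _).add hH ((hU _ (by omega) _).pdx hH _))
      · exact (hU _ (by omega) _).mul hH (hdu _ _ _)

lemma tame_layerG (hH : Wall H) (hE : E.IsElementary par H f) (k : ℕ)
    (ih : ∀ m < k, LayerDecay H E m) (i j : Fin (d + 1)) : Tame H (E.layerG par k i j) := by
  match k with
  | 0 => exact Tame.const 0
  | 1 => exact Tame.const 0
  | k + 2 =>
    have hU : ∀ m < k + 2, ∀ i, Tame H (E.U m i) := fun m hm => (ih m hm).U
    have hS : ∀ m < k + 2, ∀ i j, Tame H (E.S m i j) := fun m hm i j => ((ih m hm).S i j).tame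
    have hu : ∀ m i, Tame H (fun z _ => E.u m i z) := fun m i => (hE.u_regular m i).tame hH
    have hdu : ∀ m i j, Tame H (fun z _ => pd j (E.u m i) z) := fun m i j =>
      ((hE.u_regular m i).pd j).tame hH
    have hs : ∀ m i j, Tame H (fun z _ => E.σ m i j z) := fun m i j => (hE.σ_regular m i j).tame hH
    have hds : ∀ m i j l, Tame H (fun z _ => pd l (E.σ m i j) z) := fun m i j l =>
      ((hE.σ_regular m i j).pd l).tame hH
    unfold layerG
    refine (((((Tame.const_mul hH _ (Tame.symPart hH (fun i j => ?_) i j)).add hH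
      (Tame.const_mul hH _ (Tame.symPart hH (fun i j => ?_) i j))).sub hH ?_).add hH ?_).add hH
      ?_).sub hH (Tame.const_mul hH _ (Tame.sum hH _ fun m hm => ?_))
    · exact (hU _ (by omega) i).pdX hH j
    · exact (hU _ (by omega) i).pdx hH j
    · exact hS _ (by omega) _ _
    · exact Tame.const_mul hH _ (Tame.sum hH _ fun j _ =>
        ((hS _ (by omega) _ _).pdX hH _).pdx hH _)
    · exact Tame.const_mul hH _ (Tame.sum hH _ fun j _ =>
        ((hS _ (by omega) _ _).pdx hH _).pdx hH _)
    · have hm := Finset.mem_range.1 hm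
      refine (((Tame.sum hH _ fun l _ => ?_).add hH (Tame.sum hH _ fun l _ => ?_)).add hH
        (Tame.gA hH (fun i j => ?_) (fun i j => ?_) _ i j)).add hH
        (Tame.gA hH (fun i j => ?_) (fun i j => ?_) _ i j)
      · exact (hu _ _).mul hH
          (((hS _ (by omega) _ _).pdX hH _).add hH ((hS _ (by omega) _ _).pdx hH _))
      · exact (hU _ (by omega) _).mul hH (((hds _ _ _ _).add hH
          ((hS _ (by omega) _ _).pdX hH _)).add hH ((hS _ (by omega) _ _).pdx hH _))
      · exact hdu m i j
      · exact hS (k - m) (by omega) i j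
      · exact ((hU (m + 1) (by omega) i).pdX hH j).add hH ((hU m (by omega) i).pdx hH j)
      · exact (hs (k - m) i j).add hH (hS (k - m) (by omega) i j)

/-- The divergence of the momentum equation eliminates both the velocity and the compensator: ΔP =
div F decays, and P is in L². -/
lemma decays_P (hH : Wall H) (hE : E.IsElementary par H f) {k : ℕ} (hk : 1 ≤ k)
    (hF : ∀ i, Tame H (E.layerF par k i)) : Decays H 1 (E.P k) := by
  have L := hE.layer k hk
  have hr : 0 < 1 - par.r := sub_pos.2 par.r_lt_one
  have h1 : ∀ i, LEq H (pdX i (pdX i (E.P k)))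
      (fun z Z => 1 * pdX i (E.layerF par k i) z Z + (1 - par.r) * pdX i (lapX (E.U k i)) z Z) :=
    fun i => pdX_leq_of_affine hH (hF i).bdd.reg (hE.U_regular k i).lapX
      (c := fun z => -lag E.a k i z) (fun z hz Z hZ => by
        have := L.momentum z hz Z hZ i
        simp only [lapX]
        linarith) i
  have h2 : LEq H (lapX (E.P k)) (fun z Z => ∑ i, pdX i (E.layerF par k i) z Z) := by
    intro z hz Z hZ
    have h3 := sum_pdX_lapX hH (hE.U_regular k) L.incompressible z hz Z hZ
    simp only at h3
    simp only [lapX] at h1 h3 ⊢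
    rw [Finset.sum_congr rfl fun i _ => h1 i z hz Z hZ, Finset.sum_add_distrib, ← Finset.mul_sum,
      ← Finset.mul_sum, h3]
    ring
  have h3 : Decays H 1 (lapX (E.P k)) :=
    (Decays.sum hH _ fun i _ => (hF i).decays_pdX hH i).congr hH (hE.P_regular k).lapX h2.symm
  exact decays_of_l2half hH (hE.P_regular k) (L2half.of_layerCell hH L.P_memLp) fun b => h3.Dv rfl

/-- With the pressure known to decay, Δ∂_jU decays, and ∂_jU is in L². Only the gradient is square
integrable, so the velocity converges without having to vanish at infinity. -/
lemma tame_U (hH : Wall H) (hE : E.IsElementary par H f) {k : ℕ} (hk : 1 ≤ k)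
    (hF : ∀ i, Tame H (E.layerF par k i)) (i : Fin (d + 1)) : Tame H (E.U k i) := by
  have L := hE.layer k hk
  have hr : 0 < 1 - par.r := sub_pos.2 par.r_lt_one
  have hP := decays_P hH hE hk hF
  have hU := hE.U_regular k i
  have h1 : ∀ j, LEq H (pdX j (lapX (E.U k i))) (fun z Z => (1 - par.r)⁻¹ * pdX j (pdX i (E.P k)) z Z
      + (-(1 - par.r)⁻¹) * pdX j (E.layerF par k i) z Z) := fun j =>
    pdX_leq_of_affine hH ((hE.P_regular k).pdX i) (hF i).bdd.reg
      (c := fun z => (1 - par.r)⁻¹ * lag E.a k i z) (fun z hz Z hZ => by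
        have := L.momentum z hz Z hZ i
        simp only [lapX]
        field_simp
        linarith) j
  have h2 : ∀ j, Decays H 1 (lapX (pdX j (E.U k i))) := fun j =>
    ((((hP.pdX hH i).pdX hH j).const_mul hH _).add hH
      (((hF i).decays_pdX hH j).const_mul hH _)).congr hH (hU.pdX j).lapX
      ((lapX_pdX hH hU j).trans (h1 j)).symm
  refine tame_of_gradient hH hU (decays_Dv_of_pdX hH hU fun j => ?_)
  exact decays_of_l2half hH (hU.pdX j)
    (L2half.of_layerCell hH fun z hz => L.gradU_memLp z hz i j) fun b => (h2 j).Dv rfl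

lemma decays_S (hH : Wall H) (hE : E.IsElementary par H f) {k : ℕ} (hk : 1 ≤ k)
    {i j : Fin (d + 1)} (hG : Tame H (E.layerG par k i j)) : Decays H 1 (E.S k i j) := by
  have L := hE.layer k hk
  have hD := par.D_pos
  have hS := hE.S_regular k i j
  -- The summand with coefficient 0 only fits the equation into the two-field form of
  -- `pdX_leq_of_affine`.
  have h1 : ∀ l, LEq H (pdX l (lapX (E.S k i j))) (fun z Z =>
      (-par.D⁻¹) * pdX l (E.layerG par k i j) z Z + 0 * pdX l (E.layerG par k i j) z Z) := fun l =>
    pdX_leq_of_affine hH hG.bdd.reg hG.bdd.reg (c := fun z => par.D⁻¹ * lag E.c k i j z)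
      (fun z hz Z hZ => by
        have := L.stress z hz Z hZ i j
        simp only [lapX]
        field_simp
        linarith) l
  have hd : ∀ l, Decays H 1 (pdX l (lapX (E.S k i j))) := fun l =>
    (((hG.decays_pdX hH l).const_mul hH _).add hH
      ((hG.decays_pdX hH l).const_mul hH _)).congr hH (hS.lapX.pdX l) (h1 l).symm
  exact decays_of_l2half hH hS (L2half.of_layerCell hH fun z hz => L.S_memLp z hz i j)
    (decays_Dv_of_pdX hH hS.lapX hd)

/-- Exponential convergence of all boundary layer correctors. -/
theorem layerDecay (hH : Wall H) (hE : E.IsElementary par H f) (k : ℕ) : LayerDecay H E k := by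
  induction k using Nat.strong_induction_on with
  | _ k ih =>
    rcases Nat.eq_zero_or_pos k with rfl | hk
    · refine ⟨fun i => ?_, ?_, fun i j => ?_⟩
      · rw [hE.U_zero]; exact Tame.const 0
      · rw [hE.P_zero]; exact Decays.zero 1
      · rw [hE.S_zero]; exact Decays.zero 1
    · have hF := tame_layerF hH hE k ih
      have hG := tame_layerG hH hE k ih
      exact ⟨tame_U hH hE hk hF, decays_P hH hE hk hF, fun i j => decays_S hH hE hk (hG i j)⟩

end Expansion

end RoughChannel

end

namespace RoughChannel

variable {d : ℕ} {H : (Fin d → ℝ) → ℝ}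

/-! ### Bounds for the source terms of the remainder -/

namespace Expansion

variable {par : Params} {E : Expansion d} {f : MacV d}

lemma tame_srcF (hH : Wall H) (hE : E.IsElementary par H f) (N : ℕ) (i : Fin (d + 1)) :
    Tame H (E.srcF par N i) := by
  have hU : ∀ m i, Tame H (E.U m i) := fun m => (layerDecay hH hE m).U
  have hS : ∀ m i j, Tame H (E.S m i j) := fun m i j => ((layerDecay hH hE m).S i j).tame
  have hP : ∀ m, Tame H (E.P m) := fun m => (layerDecay hH hE m).P.tame
  have hu : ∀ m i, Tame H (fun z _ => E.u m i z) := fun m i => (hE.u_regular m i).tame hH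
  have hdu : ∀ m i j, Tame H (fun z _ => pd j (E.u m i) z) := fun m i j =>
    ((hE.u_regular m i).pd j).tame hH
  have hddu : ∀ m i j, Tame H (fun z _ => pd j (pd j (E.u m i)) z) := fun m i j =>
    (((hE.u_regular m i).pd j).pd j).tame hH
  have hds : ∀ m i j l, Tame H (fun z _ => pd l (E.σ m i j) z) := fun m i j l =>
    ((hE.σ_regular m i j).pd l).tame hH
  have hdp : Tame H (fun z _ => pd i (E.p N) z) := ((hE.p_regular N).pd i).tame hH
  unfold srcF
  refine ((((((((Tame.const_mul hH _ (Tame.sum hH _ fun k _ => Tame.sum hH _ fun j _ => ?_)).sub hH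
    (Tame.const_mul hH _ (Tame.sum hH _ fun j _ => ?_))).add hH
    (Tame.const_mul hH _ (Tame.sum hH _ fun j _ => hddu _ _ _))).add hH
    (Tame.const_mul hH _ (Tame.sum hH _ fun j _ => ((hU _ _).pdx hH _).pdx hH _))).sub hH hdp).sub hH
    ((hP _).pdx hH _)).add hH (Tame.sum hH _ fun j _ => hds _ _ _ _)).add hH
    (Tame.sum hH _ fun j _ => (hS _ _ _).pdx hH _))
  · exact ((hu _ _).add hH (hU _ _)).mul hH
      (((hdu _ _ _).add hH ((hU _ _).pdx hH _)).add hH ((hU _ _).pdX hH _))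
  · exact (hu _ _).mul hH ((hdu _ _ _).add hH ((hU _ _).pdx hH _))

lemma tame_srcG (hH : Wall H) (hE : E.IsElementary par H f) (N : ℕ) (i j : Fin (d + 1)) :
    Tame H (E.srcG par N i j) := by
  have hU : ∀ m i, Tame H (E.U m i) := fun m => (layerDecay hH hE m).U
  have hS : ∀ m i j, Tame H (E.S m i j) := fun m i j => ((layerDecay hH hE m).S i j).tame
  have hu : ∀ m i, Tame H (fun z _ => E.u m i z) := fun m i => (hE.u_regular m i).tame hH
  have hdu : ∀ m i j, Tame H (fun z _ => pd j (E.u m i) z) := fun m i j =>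
    ((hE.u_regular m i).pd j).tame hH
  have hs : ∀ m i j, Tame H (fun z _ => E.σ m i j z) := fun m i j => (hE.σ_regular m i j).tame hH
  have hds : ∀ m i j l, Tame H (fun z _ => pd l (E.σ m i j) z) := fun m i j l =>
    ((hE.σ_regular m i j).pd l).tame hH
  have hdds : ∀ m i j l, Tame H (fun z _ => pd l (pd l (E.σ m i j)) z) := fun m i j l =>
    (((hE.σ_regular m i j).pd l).pd l).tame hH
  unfold srcG
  refine (((((((((Tame.const_mul hH _ (Tame.symPart hH (fun i j => hdu N i j) i j)).add hH
    (Tame.const_mul hH _ (Tame.symPart hH (fun i j => (hU N i).pdx hH j) i j))).sub hH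
    (hs _ _ _)).sub hH (hS _ _ _)).add hH
    (Tame.const_mul hH _ (Tame.sum hH _ fun l _ => hdds _ _ _ _))).add hH
    (Tame.const_mul hH _ (Tame.sum hH _ fun l _ => ((hS _ _ _).pdx hH _).pdx hH _))).sub hH
    (Tame.const_mul hH _ (Tame.sum hH _ fun k _ => Tame.sum hH _ fun l _ => ?_))).sub hH
    (Tame.const_mul hH _ (Tame.sum hH _ fun l _ => ?_))).sub hH
    (Tame.const_mul hH _ (Tame.sum hH _ fun k _ =>
      Tame.gA hH (fun i j => ?_) (fun i j => ?_) _ i j))).sub hH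
    (Tame.const_mul hH _ (Tame.gA hH (fun i j => ?_) (fun i j => hs 0 i j) _ i j))
  · exact ((hu _ _).add hH (hU _ _)).mul hH
      (((hds _ _ _ _).add hH ((hS _ _ _).pdx hH _)).add hH ((hS _ _ _).pdX hH _))
  · exact (hu _ _).mul hH ((hds _ _ _ _).add hH ((hS _ _ _).pdx hH _))
  · exact ((hdu k i j).add hH ((hU k i).pdx hH j)).add hH ((hU (k + 1) i).pdX hH j)
  · exact (hs (N - k) i j).add hH (hS (N - k) i j)
  · exact (hdu N i j).add hH ((hU N i).pdx hH j)

end Expansion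

/-! ### From pointwise bounds to L² bounds in the rough channel -/

lemma Wall.exists_upper (hH : Wall H) : ∃ M > 0, ∀ X, H X ≤ M := by
  obtain ⟨M, hM⟩ := (isCompact_Icc (a := (0 : Fin d → ℝ)) (b := 1)).bddAbove_image hH.cont.continuousOn
  have hle : ∀ X, H X ≤ M := by
    intro X
    obtain ⟨X', hX', hg⟩ := exists_mem_Icc_of_periodic ((X, 0) : Pt d)
    have h1 := hg (fun Z => H Z.1) (fun Z l => by simp [hH.per])
    simp only at h1
    rw [h1]
    exact hM (mem_image_of_mem H hX')
  exact ⟨M, (hH.pos 0).trans_le (hle 0), hle⟩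

/-- For y ≥ 0 the global bound of tame fields applies. For y < 0 the microscopic height lies between
the wall and 0, and εM < δ places y in the neighbourhood of the slab given by compactness. -/
lemma Tame.exists_bound_roughCell (hH : Wall H) {W : MicS d} (hW : Tame H W) :
    ∃ C, 0 ≤ C ∧ ∀ᶠ ε in 𝓝[>] (0 : ℝ), ∀ z ∈ roughCell H ε,
      ContinuousAt (fun z => W z (ε⁻¹ • z)) z ∧ |W z (ε⁻¹ • z)| ≤ C := by
  obtain ⟨δ, hδ, C₁, hC₁⟩ := hW.bdd.reg.exists_bound hH.cont hH.per 0
  obtain ⟨C₂, hC₂, hb⟩ := hW.bdd.bddW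
  obtain ⟨M, hM, hHM⟩ := hH.exists_upper
  refine ⟨max C₁ C₂, hC₂.trans (le_max_right _ _), ?_⟩
  filter_upwards [Ioo_mem_nhdsGT (show (0 : ℝ) < δ / M by positivity)] with ε hε z hz
  have hε0 : 0 < ε := hε.1
  have hεM : ε * M < δ := (lt_div_iff₀ hM).1 hε.2
  have hcomp : ContinuousAt (unc W) (z, ε⁻¹ • z) → ContinuousAt (fun z => W z (ε⁻¹ • z)) z :=
    fun h => ContinuousAt.comp (g := unc W) (f := fun z : Pt d => (z, ε⁻¹ • z)) h (by fun_prop)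
  obtain ⟨_, hz1, hz2⟩ := hz
  have hwall : -H (ε⁻¹ • z).1 ≤ (ε⁻¹ • z).2 := by
    simp only [Prod.smul_fst, Prod.smul_snd, smul_eq_mul]
    rw [← div_eq_inv_mul, le_div_iff₀ hε0]
    linarith
  rcases le_or_gt 0 z.2 with h | h
  · have h2 : 0 ≤ (ε⁻¹ • z).2 := mul_nonneg (inv_pos.2 hε0).le h
    refine ⟨hcomp (hW.bdd.reg.contDiffAt ⟨h, hz2.le⟩ hwall).continuousAt, ?_⟩
    have := hb z ⟨h, hz2.le⟩ _ h2
    simp only [zero_mul, neg_zero, Real.exp_zero, mul_one] at this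
    exact this.trans (le_max_right _ _)
  · have h2 : (ε⁻¹ • z).2 ≤ 0 := mul_nonpos_of_nonneg_of_nonpos (inv_pos.2 hε0).le h.le
    have h3 : ε * H (ε⁻¹ • z.1) ≤ ε * M := by gcongr; exact hHM _
    obtain ⟨h4, h5⟩ := hC₁ z (by linarith) hz2.le _ hwall h2
    exact ⟨hcomp h4, h5.trans (le_max_left _ _)⟩

lemma measurableSet_roughCell (hH : Wall H) (ε : ℝ) : MeasurableSet (roughCell H ε) := by
  have hc := hH.cont
  refine MeasurableSet.inter (measurableSet_Icc.preimage measurable_fst) (MeasurableSet.inter ?_ ?_)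
  · exact (isOpen_lt (f := fun z : Pt d => -(ε * H (ε⁻¹ • z.1))) (by fun_prop)
      continuous_snd).measurableSet
  · exact (isOpen_lt continuous_snd continuous_const).measurableSet

/-- Fields built from exponentially convergent ones are bounded in `L²` of the rough channel. -/
theorem exists_eLpNorm_le (hH : Wall H) {F : Type*} [NormedAddCommGroup F] (Φ : ℝ → Pt d → F)
    {C : ℝ} (h : ∀ᶠ ε in 𝓝[>] (0 : ℝ), ∀ z ∈ roughCell H ε,
      ContinuousAt (Φ ε) z ∧ ‖Φ ε z‖ ≤ C) :
    ∃ C', 0 ≤ C' ∧ ∀ᶠ ε in 𝓝[>] (0 : ℝ), MemLp (Φ ε) 2 (volume.restrict (roughCell H ε)) ∧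
      eLpNorm (Φ ε) 2 (volume.restrict (roughCell H ε)) ≤ ENNReal.ofReal C' := by
  obtain ⟨M, hM, hHM⟩ := hH.exists_upper
  -- All cells with ε ≤ 1 lie in this one box of finite volume, so a uniform sup bound is a uniform
  -- L² bound.
  set B : Set (Pt d) := Icc (0 : Fin d → ℝ) 1 ×ˢ Icc (-M) 1 with hB
  have hBfin : volume B < ⊤ := (isCompact_Icc.prod isCompact_Icc).measure_lt_top
  set K : ENNReal := volume B ^ (2 : ENNReal).toReal⁻¹ * ENNReal.ofReal C with hK
  have hKfin : K ≠ ⊤ :=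
    ENNReal.mul_ne_top (ENNReal.rpow_ne_top_of_nonneg (by simp) hBfin.ne) ENNReal.ofReal_ne_top
  refine ⟨K.toReal, ENNReal.toReal_nonneg, ?_⟩
  filter_upwards [h, Ioc_mem_nhdsGT (zero_lt_one' ℝ)] with ε hε hε1
  have hms := measurableSet_roughCell hH ε
  have hsub : roughCell H ε ⊆ B := by
    rintro z ⟨h1, h2, h3⟩
    refine ⟨h1, ?_, h3.le⟩
    have h4 : ε * H (ε⁻¹ • z.1) ≤ 1 * M :=
      mul_le_mul hε1.2 (hHM _) (hH.pos _).le zero_le_one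
    linarith
  have hmeas : AEStronglyMeasurable (Φ ε) (volume.restrict (roughCell H ε)) :=
    ContinuousOn.aestronglyMeasurable
      (fun z hz => ((hε z hz).1).continuousWithinAt) hms
  have hae : ∀ᵐ z ∂(volume.restrict (roughCell H ε)), ‖Φ ε z‖ ≤ C :=
    (ae_restrict_mem hms).mono fun z hz => (hε z hz).2
  have hle : eLpNorm (Φ ε) 2 (volume.restrict (roughCell H ε)) ≤ K := by
    refine (eLpNorm_le_of_ae_bound hae).trans ?_
    rw [hK, Measure.restrict_apply_univ]
    gcongr
  refine ⟨⟨hmeas, hle.trans_lt hKfin.lt_top⟩, ?_⟩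
  rwa [ENNReal.ofReal_toReal hKfin]

namespace Expansion

variable {par : Params} {E : Expansion d} {f : MacV d}

theorem exists_eLpNorm_Fε (hH : Wall H) (hE : E.IsElementary par H f) (N : ℕ) :
    ∃ C, 0 ≤ C ∧ ∀ᶠ ε in 𝓝[>] (0 : ℝ), MemLp (E.Fε par N ε) 2 (volume.restrict (roughCell H ε)) ∧
      eLpNorm (E.Fε par N ε) 2 (volume.restrict (roughCell H ε)) ≤ ENNReal.ofReal C := by
  choose C hC hb using fun i => (tame_srcF hH hE N i).exists_bound_roughCell hH
  refine exists_eLpNorm_le hH (C := ∑ i, C i) (E.Fε par N) ?_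
  filter_upwards [eventually_all.2 hb] with ε hε z hz
  refine ⟨continuousAt_pi.2 fun i => (hε i z hz).1, ?_⟩
  refine (pi_norm_le_iff_of_nonneg (Finset.sum_nonneg fun i _ => hC i)).2 fun i => ?_
  exact (hε i z hz).2.trans (Finset.single_le_sum (fun i _ => hC i) (Finset.mem_univ i))

theorem exists_eLpNorm_Gε (hH : Wall H) (hE : E.IsElementary par H f) (N : ℕ) :
    ∃ C, 0 ≤ C ∧ ∀ᶠ ε in 𝓝[>] (0 : ℝ), MemLp (E.Gε par N ε) 2 (volume.restrict (roughCell H ε)) ∧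
      eLpNorm (E.Gε par N ε) 2 (volume.restrict (roughCell H ε)) ≤ ENNReal.ofReal C := by
  choose C hC hb using fun p : Fin (d + 1) × Fin (d + 1) =>
    (tame_srcG hH hE N p.1 p.2).exists_bound_roughCell hH
  refine exists_eLpNorm_le hH (C := ∑ p, C p) (E.Gε par N) ?_
  filter_upwards [eventually_all.2 hb] with ε hε z hz
  have h0 : 0 ≤ ∑ p, C p := Finset.sum_nonneg fun p _ => hC p
  refine ⟨continuousAt_pi.2 fun i => continuousAt_pi.2 fun j => (hε (i, j) z hz).1, ?_⟩
  refine (pi_norm_le_iff_of_nonneg h0).2 fun i => (pi_norm_le_iff_of_nonneg h0).2 fun j => ?_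
  exact (hε (i, j) z hz).2.trans (Finset.single_le_sum (fun p _ => hC p) (Finset.mem_univ (i, j)))

end Expansion

end RoughChannel

namespace RoughChannel

variable {d : ℕ} {H : (Fin d → ℝ) → ℝ}

/-! ### Iterated derivatives of functions of the horizontal variable -/

lemma natCast_le_infty (n : ℕ) : (n : ℕ∞ω) ≤ ∞ := by exact_mod_cast (le_top (a := (n : ℕ∞)))

lemma norm_iteratedFDeriv_sum_le {ι E F : Type*} [NormedAddCommGroup E] [NormedSpace ℝ E]
    [NormedAddCommGroup F] [NormedSpace ℝ F] (s : Finset ι) {f : ι → E → F}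
    (hf : ∀ i ∈ s, ContDiff ℝ ∞ (f i)) (n : ℕ) (x : E) :
    ‖iteratedFDeriv ℝ n (fun x => ∑ i ∈ s, f i x) x‖ ≤ ∑ i ∈ s, ‖iteratedFDeriv ℝ n (f i) x‖ := by
  rw [iteratedFDeriv_sum fun i hi => (hf i hi).of_le (natCast_le_infty n), Finset.sum_apply]
  exact norm_sum_le _ _

lemma norm_iteratedFDeriv_const_mul {E : Type*} [NormedAddCommGroup E] [NormedSpace ℝ E]
    {f : E → ℝ} (hf : ContDiff ℝ ∞ f) (c : ℝ) (n : ℕ) (x : E) :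
    ‖iteratedFDeriv ℝ n (fun x => c * f x) x‖ = |c| * ‖iteratedFDeriv ℝ n f x‖ := by
  have := iteratedFDeriv_const_smul_apply' (𝕜 := ℝ) (a := c) (x := x)
    ((hf.of_le (natCast_le_infty n)).contDiffAt)
  simp only [smul_eq_mul] at this
  rw [this, norm_smul, Real.norm_eq_abs]

/-- Since dφ = Σ_l ψ_l dx_l, and the maps t ↦ t dx_l have norm at most 1 for the sup norm, estimates
of multilinear derivatives reduce to partial derivatives. -/
lemma norm_iteratedFDeriv_succ_le {φ : (Fin d → ℝ) → ℝ} {ψ : Fin d → (Fin d → ℝ) → ℝ}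
    (hφ : ContDiff ℝ ∞ φ) (hψ : ∀ l x, fderiv ℝ φ x (Pi.single l 1) = ψ l x) (n : ℕ)
    (x : Fin d → ℝ) :
    ‖iteratedFDeriv ℝ (n + 1) φ x‖ ≤ ∑ l, ‖iteratedFDeriv ℝ n (ψ l) x‖ := by
  have hψc : ∀ l, ContDiff ℝ ∞ (ψ l) := fun l => by
    rw [show ψ l = fun x => fderiv ℝ φ x (Pi.single l 1) from funext fun x => (hψ l x).symm]
    exact (hφ.fderiv_right (m := ∞) (by simp)).clm_apply contDiff_const
  set L : Fin d → ℝ →L[ℝ] ((Fin d → ℝ) →L[ℝ] ℝ) := fun l =>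
    ContinuousLinearMap.toSpanSingleton ℝ (ContinuousLinearMap.proj l) with hL
  have hLn : ∀ l, ‖L l‖ ≤ 1 := by
    intro l
    refine ContinuousLinearMap.opNorm_le_bound _ zero_le_one fun t => ?_
    rw [one_mul, hL, ContinuousLinearMap.toSpanSingleton_apply, norm_smul]
    refine mul_le_of_le_one_right (norm_nonneg _) ?_
    refine ContinuousLinearMap.opNorm_le_bound _ zero_le_one fun y => ?_
    rw [one_mul]
    exact norm_le_pi_norm y l
  have he : fderiv ℝ φ = fun x => ∑ l, (L l ∘ ψ l) x := by
    funext x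
    ext y
    simp only [_root_.sum_apply, Function.comp, hL,
      ContinuousLinearMap.toSpanSingleton_apply, _root_.smul_apply,
      ContinuousLinearMap.proj_apply, smul_eq_mul, ← hψ]
    conv_lhs => rw [pi_eq_sum_univ' y, map_sum]
    refine Finset.sum_congr rfl fun l _ => ?_
    rw [map_smul, smul_eq_mul, mul_comm]
  rw [← norm_iteratedFDeriv_fderiv, he]
  refine (norm_iteratedFDeriv_sum_le _ (fun l _ => (L l).contDiff.comp (hψc l)) n x).trans ?_
  refine Finset.sum_le_sum fun l _ => ?_
  refine ((L l).norm_iteratedFDeriv_comp_left (hψc l).contDiffAt (natCast_le_infty n)).trans ?_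
  exact mul_le_of_le_one_left (norm_nonneg _) (hLn l)

/-- Families of smooth functions whose derivatives of order `ℓ ≤ n` are bounded by multiples of
`ρ(ε) ε^{-ℓ}`. -/
def Osc {F : Type*} [NormedAddCommGroup F] [NormedSpace ℝ F] (S : Set ℝ) (ρ : ℝ → ℝ) (n : ℕ)
    (φ : ℝ → (Fin d → ℝ) → F) : Prop :=
  (∀ ε ∈ S, ContDiff ℝ ∞ (φ ε)) ∧ ∀ ℓ ≤ n, ∃ C, 0 ≤ C ∧ ∀ ε ∈ S, ∀ x,
    ‖iteratedFDeriv ℝ ℓ (φ ε) x‖ ≤ C * ρ ε * ε⁻¹ ^ ℓ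

namespace Osc

variable {S : Set ℝ} {ρ ρ' : ℝ → ℝ} {n : ℕ}

lemma sum {ι : Type*} {F : Type*} [NormedAddCommGroup F] [NormedSpace ℝ F] (s : Finset ι)
    {φ : ι → ℝ → (Fin d → ℝ) → F} (h : ∀ i ∈ s, Osc S ρ n (φ i)) :
    Osc S ρ n (fun ε x => ∑ i ∈ s, φ i ε x) := by
  classical
  refine ⟨fun ε hε => ContDiff.sum fun i hi => (h i hi).1 ε hε, fun ℓ hℓ => ?_⟩
  have : ∀ i, ∃ C, 0 ≤ C ∧ (i ∈ s → ∀ ε ∈ S, ∀ x,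
      ‖iteratedFDeriv ℝ ℓ (φ i ε) x‖ ≤ C * ρ ε * ε⁻¹ ^ ℓ) := by
    intro i
    by_cases hi : i ∈ s
    · obtain ⟨C, hC, hb⟩ := (h i hi).2 ℓ hℓ
      exact ⟨C, hC, fun _ => hb⟩
    · exact ⟨0, le_rfl, fun h => absurd h hi⟩
  choose C hC hb using this
  refine ⟨∑ i ∈ s, C i, Finset.sum_nonneg fun i _ => hC i, fun ε hε x => ?_⟩
  refine (norm_iteratedFDeriv_sum_le s (fun i hi => (h i hi).1 ε hε) ℓ x).trans ?_
  rw [Finset.sum_mul, Finset.sum_mul]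
  exact Finset.sum_le_sum fun i hi => hb i hi ε hε x

lemma scale {φ : ℝ → (Fin d → ℝ) → ℝ} (h : Osc S ρ n φ) {c : ℝ → ℝ} (hS : ∀ ε ∈ S, 0 < ε)
    (hc : ∀ ε ∈ S, |c ε| * ρ ε ≤ ρ' ε) : Osc S ρ' n (fun ε x => c ε * φ ε x) := by
  refine ⟨fun ε hε => contDiff_const.mul (h.1 ε hε), fun ℓ hℓ => ?_⟩
  obtain ⟨C, hC, hb⟩ := h.2 ℓ hℓ
  refine ⟨C, hC, fun ε hε x => ?_⟩
  have hε0 := hS ε hε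
  rw [norm_iteratedFDeriv_const_mul (h.1 ε hε)]
  calc |c ε| * ‖iteratedFDeriv ℝ ℓ (φ ε) x‖ ≤ |c ε| * (C * ρ ε * ε⁻¹ ^ ℓ) := by
        gcongr; exact hb ε hε x
    _ = C * (|c ε| * ρ ε) * ε⁻¹ ^ ℓ := by ring
    _ ≤ C * ρ' ε * ε⁻¹ ^ ℓ := by gcongr; exact hc ε hε

lemma mul {φ ψ : ℝ → (Fin d → ℝ) → ℝ} (h : Osc S ρ n φ) (h' : Osc S ρ' n ψ)
    (hS : ∀ ε ∈ S, 0 < ε) (hρ : ∀ ε ∈ S, 0 ≤ ρ ε) :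
    Osc S (fun ε => ρ ε * ρ' ε) n (fun ε x => φ ε x * ψ ε x) := by
  refine ⟨fun ε hε => (h.1 ε hε).mul (h'.1 ε hε), fun ℓ hℓ => ?_⟩
  have h1 : ∀ i, ∃ C, 0 ≤ C ∧ (i ≤ n → ∀ ε ∈ S, ∀ x,
      ‖iteratedFDeriv ℝ i (φ ε) x‖ ≤ C * ρ ε * ε⁻¹ ^ i) := fun i => by
    by_cases hi : i ≤ n
    · obtain ⟨C, hC, hb⟩ := h.2 i hi
      exact ⟨C, hC, fun _ => hb⟩
    · exact ⟨0, le_rfl, fun h => absurd h hi⟩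
  have h2 : ∀ i, ∃ C, 0 ≤ C ∧ (i ≤ n → ∀ ε ∈ S, ∀ x,
      ‖iteratedFDeriv ℝ i (ψ ε) x‖ ≤ C * ρ' ε * ε⁻¹ ^ i) := fun i => by
    by_cases hi : i ≤ n
    · obtain ⟨C, hC, hb⟩ := h'.2 i hi
      exact ⟨C, hC, fun _ => hb⟩
    · exact ⟨0, le_rfl, fun h => absurd h hi⟩
  choose C hC hb using h1
  choose C' hC' hb' using h2
  refine ⟨∑ i ∈ Finset.range (ℓ + 1), (ℓ.choose i : ℝ) * C i * C' (ℓ - i),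
    Finset.sum_nonneg fun i _ => by have := hC i; have := hC' (ℓ - i); positivity,
    fun ε hε x => ?_⟩
  have hε0 := hS ε hε
  refine (norm_iteratedFDeriv_mul_le (h.1 ε hε) (h'.1 ε hε) x (natCast_le_infty ℓ)).trans ?_
  rw [Finset.sum_mul, Finset.sum_mul]
  refine Finset.sum_le_sum fun i hi => ?_
  have hi' : i ≤ ℓ := Nat.lt_succ_iff.1 (Finset.mem_range.1 hi)
  have b1 := hb i (hi'.trans hℓ) ε hε x
  have b2 := hb' (ℓ - i) ((Nat.sub_le _ _).trans hℓ) ε hε x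
  calc (ℓ.choose i : ℝ) * ‖iteratedFDeriv ℝ i (φ ε) x‖ * ‖iteratedFDeriv ℝ (ℓ - i) (ψ ε) x‖
      ≤ (ℓ.choose i : ℝ) * (C i * ρ ε * ε⁻¹ ^ i) * (C' (ℓ - i) * ρ' ε * ε⁻¹ ^ (ℓ - i)) := by
        have := hC i
        have := hρ ε hε
        gcongr
    _ = (ℓ.choose i : ℝ) * C i * C' (ℓ - i) * (ρ ε * ρ' ε) * (ε⁻¹ ^ i * ε⁻¹ ^ (ℓ - i)) := by ring
    _ = _ := by rw [← pow_add, Nat.add_sub_cancel' hi']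

lemma pi {ι F : Type*} [Fintype ι] [NormedAddCommGroup F] [NormedSpace ℝ F]
    {φ : ι → ℝ → (Fin d → ℝ) → F} (h : ∀ i, Osc S ρ n (φ i)) :
    Osc S ρ n (fun ε x i => φ i ε x) := by
  classical
  have h1 : ∀ i, Osc S ρ n (fun ε x => (ContinuousLinearMap.single ℝ (fun _ : ι => F) i) (φ i ε x)) := by
    intro i
    refine ⟨fun ε hε => (ContinuousLinearMap.contDiff _).comp ((h i).1 ε hε), fun ℓ hℓ => ?_⟩
    obtain ⟨C, hC, hb⟩ := (h i).2 ℓ hℓ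
    set L := ContinuousLinearMap.single ℝ (fun _ : ι => F) i
    refine ⟨‖L‖ * C, by positivity, fun ε hε x => ?_⟩
    refine (L.norm_iteratedFDeriv_comp_left ((h i).1 ε hε).contDiffAt (natCast_le_infty ℓ)).trans ?_
    rw [mul_assoc, mul_assoc, ← mul_assoc C]
    gcongr
    exact hb ε hε x
  have := Osc.sum Finset.univ fun i _ => h1 i
  convert this using 3 with ε x
  funext i
  simp [Finset.sum_apply, Pi.single_apply]

/-- The induction scheme for traces: a size bound, plus partial derivatives of the same type that
are worse by one factor 1/ε. Capping the order at n makes the induction possible. -/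
lemma of_succ {φ : ℝ → (Fin d → ℝ) → ℝ} {ψ : Fin d → ℝ → (Fin d → ℝ) → ℝ}
    (hφ : ∀ ε ∈ S, ContDiff ℝ ∞ (φ ε)) (h0 : ∃ C, 0 ≤ C ∧ ∀ ε ∈ S, ∀ x, |φ ε x| ≤ C * ρ ε)
    (hψ : ∀ ε ∈ S, ∀ l x, fderiv ℝ (φ ε) x (Pi.single l 1) = ψ l ε x)
    (h : ∀ l, Osc S (fun ε => ρ ε * ε⁻¹) n (ψ l)) : Osc S ρ (n + 1) φ := by
  refine ⟨hφ, fun ℓ hℓ => ?_⟩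
  cases ℓ with
  | zero =>
    obtain ⟨C, hC, hb⟩ := h0
    exact ⟨C, hC, fun ε hε x => by simpa using hb ε hε x⟩
  | succ ℓ =>
    choose C hC hb using fun l => (h l).2 ℓ (by omega)
    refine ⟨∑ l, C l, Finset.sum_nonneg fun l _ => hC l, fun ε hε x => ?_⟩
    refine (norm_iteratedFDeriv_succ_le (hφ ε hε) (hψ ε hε) ℓ x).trans ?_
    rw [Finset.sum_mul, Finset.sum_mul]
    refine Finset.sum_le_sum fun l _ => (hb l ε hε x).trans (le_of_eq ?_)
    rw [pow_succ]
    ring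

end Osc

/-! ### Boundary data at the upper boundary -/

lemma mem_slab_top (x : Fin d → ℝ) : ((x, 1) : Pt d) ∈ slab d := ⟨zero_le_one, le_rfl⟩

lemma contDiff_trace (hH : Wall H) {W : MicS d} (hW : RegularMic H W) (s : ℝ) {τ : ℝ}
    (hτ : 0 ≤ τ) : ContDiff ℝ ∞ (fun x : Fin d → ℝ => W (x, 1) (s • x, τ)) :=
  contDiff_iff_contDiffAt.2 fun x => ContDiffAt.comp (g := unc W)
    (f := fun x : Fin d → ℝ => (((x, 1), (s • x, τ)) : Pt d × Pt d)) x
    (hW.contDiffAt (mem_slab_top x) (hH.lt_of_nonneg (Z := (s • x, τ)) hτ).le) (by fun_prop)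

lemma fderiv_trace (hH : Wall H) {W : MicS d} (hW : RegularMic H W) (s : ℝ) {τ : ℝ}
    (hτ : 0 ≤ τ) (l : Fin d) (x : Fin d → ℝ) :
    fderiv ℝ (fun x : Fin d → ℝ => W (x, 1) (s • x, τ)) x (Pi.single l 1)
      = Dv ((Pi.single l 1, 0), 0) W (x, 1) (s • x, τ)
        + s * Dv (0, (Pi.single l 1, 0)) W (x, 1) (s • x, τ) := by
  have h1 := (hW.differentiableAt (mem_slab_top x)
    (hH.lt_of_nonneg (Z := (s • x, τ)) hτ).le).hasFDerivAt
  have a1 : HasFDerivAt (fun x : Fin d → ℝ => x) (ContinuousLinearMap.id ℝ _) x :=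
    hasFDerivAt_id x
  have a2 : HasFDerivAt (fun x : Fin d → ℝ => s • x) (s • ContinuousLinearMap.id ℝ _) x :=
    a1.const_smul s
  have h2 : HasFDerivAt (fun x : Fin d → ℝ => (((x, 1), (s • x, τ)) : Pt d × Pt d)) _ x :=
    (a1.prodMk (hasFDerivAt_const (1 : ℝ) x)).prodMk (a2.prodMk (hasFDerivAt_const τ x))
  have h3 := HasFDerivAt.comp (g := unc W) x h1 h2
  rw [show (fun x : Fin d → ℝ => W (x, 1) (s • x, τ))
    = unc W ∘ fun x : Fin d → ℝ => (((x, 1), (s • x, τ)) : Pt d × Pt d) from rfl, h3.fderiv]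
  simp only [Dv]
  rw [← smul_eq_mul, ← map_smul, ← map_add]
  simp

/-- An x-derivative of W((x,1), (x/ε, τ)) is a macroscopic derivative plus 1/ε times a microscopic
one, both of decaying fields. The height τ is left free because it is needed at 1/ε + m for every
integer m ≥ 0. -/
theorem exists_trace_bound (hH : Wall H) (ℓ : ℕ) {W : MicS d} (hW : Decays H 1 W) :
    ∃ C, 0 ≤ C ∧ ∀ ε ∈ Ioc (0 : ℝ) 1, ∀ τ, 0 ≤ τ → ∀ x : Fin d → ℝ,
      ‖iteratedFDeriv ℝ ℓ (fun x : Fin d → ℝ => W (x, 1) (ε⁻¹ • x, τ)) x‖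
        ≤ C * ε⁻¹ ^ ℓ * Real.exp (-τ) := by
  induction ℓ generalizing W with
  | zero =>
    obtain ⟨C, hC, hb⟩ := hW.bddW
    refine ⟨C, hC, fun ε _ τ hτ x => ?_⟩
    have := hb (x, 1) (mem_slab_top x) (ε⁻¹ • x, τ) hτ
    simpa using this
  | succ ℓ ih =>
    choose A hA hAb using fun l : Fin d => ih (hW.Dv (v := ((Pi.single l 1, 0), 0)) rfl)
    choose B hB hBb using fun l : Fin d => ih (hW.Dv (v := (0, (Pi.single l 1, 0))) rfl)
    refine ⟨∑ l, (A l + B l), Finset.sum_nonneg fun l _ => add_nonneg (hA l) (hB l),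
      fun ε hε τ hτ x => ?_⟩
    have hε0 : 0 < ε := hε.1
    have hε1 : 1 ≤ ε⁻¹ := one_le_inv₀ hε0 |>.2 hε.2
    refine (norm_iteratedFDeriv_succ_le (contDiff_trace hH hW.reg _ hτ)
      (fderiv_trace hH hW.reg ε⁻¹ hτ) ℓ x).trans ?_
    rw [Finset.sum_mul, Finset.sum_mul]
    refine Finset.sum_le_sum fun l _ => ?_
    have c1 := contDiff_trace hH (hW.reg.Dv ((Pi.single l 1, 0), 0)) ε⁻¹ hτ
    have c2 := contDiff_trace hH (hW.reg.Dv (0, (Pi.single l 1, 0))) ε⁻¹ hτ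
    rw [fun_iteratedFDeriv_add_apply ((c1.of_le (natCast_le_infty ℓ)).contDiffAt)
      (((contDiff_const (c := ε⁻¹)).mul c2).of_le (natCast_le_infty ℓ)).contDiffAt]
    refine (norm_add_le _ _).trans ?_
    rw [norm_iteratedFDeriv_const_mul c2, abs_of_pos (inv_pos.2 hε0)]
    have b1 := hAb l ε hε τ hτ x
    have b2 := hBb l ε hε τ hτ x
    have hE : 0 ≤ ε⁻¹ ^ ℓ * Real.exp (-τ) := by positivity
    calc _ ≤ A l * ε⁻¹ ^ ℓ * Real.exp (-τ) + ε⁻¹ * (B l * ε⁻¹ ^ ℓ * Real.exp (-τ)) := by gcongr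
      _ ≤ ε⁻¹ * (A l * ε⁻¹ ^ ℓ * Real.exp (-τ)) + ε⁻¹ * (B l * ε⁻¹ ^ ℓ * Real.exp (-τ)) := by
        have : 0 ≤ A l * ε⁻¹ ^ ℓ * Real.exp (-τ) := by have := hA l; positivity
        exact add_le_add (le_mul_of_one_le_left this hε1) le_rfl
      _ = (A l + B l) * ε⁻¹ ^ (ℓ + 1) * Real.exp (-τ) := by ring

end RoughChannel

namespace RoughChannel

variable {d : ℕ} {H : (Fin d → ℝ) → ℝ}

/-! ### The far field -/

lemma tendsto_mul_exp_neg_atTop (C : ℝ) :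
    Tendsto (fun Y : ℝ => C * Real.exp (-Y)) atTop (𝓝 0) := by
  simpa using (Real.tendsto_exp_neg_atTop_nhds_zero).const_mul C

/-- The vertical estimate gives a limit along X = 0, at a rate uniform in X and z; horizontal
differences decay too, so the limit is the same for every X. -/
lemma Tame.exists_limit (hH : Wall H) {W : MicS d} (hW : Tame H W) : ∃ C, 0 ≤ C ∧ ∀ z ∈ slab d,
    ∃ L : ℝ, ∀ Z : Pt d, 0 ≤ Z.2 → |W z Z - L| ≤ C * Real.exp (-Z.2) := by
  obtain ⟨C, hC, hb⟩ := (hW.dec (0, 1)).bddW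
  refine ⟨C, hC, fun z hz => ?_⟩
  have hv := fun X {Y t : ℝ} => abs_sub_vertical_le hH hW.bdd.reg hb hz X (Y := Y) (t := t)
  have hcau : CauchySeq fun n : ℕ => W z (0, (n : ℝ)) := by
    refine cauchySeq_of_le_tendsto_0 (fun n : ℕ => 2 * C * Real.exp (-(n : ℝ)))
      (fun n m k hn hm => ?_)
      ((tendsto_mul_exp_neg_atTop (2 * C)).comp tendsto_natCast_atTop_atTop)
    have key : ∀ n, k ≤ n → |W z (0, (n : ℝ)) - W z (0, (k : ℝ))| ≤ C * Real.exp (-(k : ℝ)) := by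
      intro n hn
      have := hv 0 (Y := k) (t := (n : ℝ) - k) (by positivity) (by simpa using hn)
      simpa using this
    have h1 := key n hn
    have h2 := key m hm
    rw [Real.dist_eq]
    rw [abs_sub_comm] at h2
    have := abs_sub_le (W z (0, (n : ℝ))) (W z (0, (k : ℝ))) (W z (0, (m : ℝ)))
    linarith
  obtain ⟨L, hL⟩ := cauchySeq_tendsto_of_complete hcau
  refine ⟨L, fun Z hZ => ?_⟩
  -- B depends on the horizontal position, but it serves only to identify the limit and does not
  -- enter the final constant.
  obtain ⟨B, hB, hbB⟩ := (hW.dec (Z.1, 0)).bddW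
  have hdiff : ∀ Y, 0 ≤ Y → |W z (Z.1, Y) - W z (0, Y)| ≤ B * Real.exp (-Y) := by
    intro Y hY
    have := abs_sub_le_of_Dv hH hW.bdd.reg (v := (0, (Z.1, 0))) rfl le_rfl (z := z) (Z := (0, Y))
      hz hY (t := 1) (B := B * Real.exp (-Y)) zero_le_one fun s _ => by
        simpa using hbB z hz (s • Z.1, Y) hY
    simpa using this
  have hlim : Tendsto (fun n : ℕ => W z (Z.1, (n : ℝ))) atTop (𝓝 L) := by
    have h0 : Tendsto (fun n : ℕ => W z (Z.1, (n : ℝ)) - W z (0, (n : ℝ))) atTop (𝓝 0) :=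
      squeeze_zero_norm (fun n => hdiff n (by positivity))
        ((tendsto_mul_exp_neg_atTop B).comp tendsto_natCast_atTop_atTop)
    simpa using h0.add hL
  have h1 : Tendsto (fun n : ℕ => |W z (Z.1, (n : ℝ)) - W z Z|) atTop (𝓝 |L - W z Z|) :=
    (hlim.sub_const _).abs
  rw [abs_sub_comm]
  refine le_of_tendsto h1 ?_
  filter_upwards [eventually_ge_atTop ⌈Z.2⌉₊] with n hn
  have := hv Z.1 (Y := Z.2) (t := (n : ℝ) - Z.2) hZ (by simpa using Nat.ceil_le.1 hn)
  simpa using this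

/-- The horizontal means converge to the limit of the field itself. -/
theorem Tame.farField (hH : Wall H) {W : MicS d} (hW : Tame H W) : ∃ C, 0 ≤ C ∧ ∀ z ∈ slab d,
    Tendsto (meanX W z) atTop (𝓝 (farField W z)) ∧
      ∀ Z : Pt d, 0 ≤ Z.2 → |W z Z - farField W z| ≤ C * Real.exp (-Z.2) := by
  obtain ⟨C, hC, h⟩ := hW.exists_limit hH
  refine ⟨C, hC, fun z hz => ?_⟩
  obtain ⟨L, hL⟩ := h z hz
  have hvol : volume.real (Icc (0 : Fin d → ℝ) 1) = 1 := by
    simp [Measure.real, Real.volume_Icc_pi]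
  have hmean : ∀ Y, 0 ≤ Y → ‖meanX W z Y - L‖ ≤ C * Real.exp (-Y) := by
    intro Y hY
    have hcont : Continuous fun X : Fin d → ℝ => W z (X, Y) :=
      continuous_iff_continuousAt.2 fun X => ContinuousAt.comp (g := unc W)
        (f := fun X : Fin d → ℝ => (z, (X, Y))) (hW.bdd.reg.contDiffAt hz
          (hH.lt_of_nonneg (Z := (X, Y)) hY).le).continuousAt (by fun_prop)
    have hint : IntegrableOn (fun X : Fin d → ℝ => W z (X, Y)) (Icc 0 1) :=
      hcont.continuousOn.integrableOn_compact isCompact_Icc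
    have : meanX W z Y - L = ∫ X in Icc (0 : Fin d → ℝ) 1, (W z (X, Y) - L) := by
      rw [integral_sub hint (integrableOn_const isCompact_Icc.measure_lt_top.ne), setIntegral_const, hvol, one_smul]
      rfl
    rw [this]
    refine (norm_setIntegral_le_of_norm_le_const (C := C * Real.exp (-Y))
      isCompact_Icc.measure_lt_top fun X _ => hL (X, Y) hY).trans ?_
    rw [hvol, mul_one]
  have ht : Tendsto (meanX W z) atTop (𝓝 L) := by
    have : Tendsto (fun Y => meanX W z Y - L) atTop (𝓝 0) :=
      squeeze_zero_norm' ((eventually_ge_atTop 0).mono hmean) (tendsto_mul_exp_neg_atTop C)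
    simpa using this.add_const L
  have he : RoughChannel.farField W z = L := ht.limUnder_eq
  rw [he]
  exact ⟨ht, hL⟩

/-! ### Smoothness of the far field and the upper boundary data -/

/-- The increment of a microscopic field over a unit of height. -/
def vertInc (W : MicS d) : MicS d := fun z Z => W z (Z + (0, 1)) - W z Z

lemma Dv_shift (v : Pt d × Pt d) (W : MicS d) (c : Pt d) :
    Dv v (fun z Z => W z (Z + c)) = fun z Z => Dv v W z (Z + c) := by
  funext z Z
  have h := fderiv_comp_add_right (𝕜 := ℝ) (f := unc W) (x := (z, Z)) (0, c)
  have he : (fun q : Pt d × Pt d => unc W (q + (0, c))) = unc fun z Z => W z (Z + c) := by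
    funext q
    simp [unc]
  rw [he] at h
  simp [Dv, h]

lemma RegularMic.shift_up {W : MicS d} (hW : RegularMic H W) :
    RegularMic H fun z Z => W z (Z + (0, 1)) := by
  refine ⟨fun z Z l => ?_, fun Z z l => hW.2.1 _ z l, fun z hz Z hZ => ?_⟩
  · change W z (Z + dir l.castSucc + (0, 1)) = _
    rw [add_right_comm]
    exact hW.1 z _ l
  · refine ContDiffAt.comp (g := unc W) (f := fun q : Pt d × Pt d => (q.1, q.2 + (0, 1))) (z, Z)
      (hW.contDiffAt hz ?_) (by fun_prop)
    change -H (Z.1 + 0) ≤ Z.2 + 1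
    rw [add_zero]
    linarith

lemma RegularMic.vertInc {W : MicS d} (hW : RegularMic H W) :
    RegularMic H (vertInc W) := by
  have := (hW.shift_up).add ((RegularMic.const (-1)).mul hW)
  simp only [neg_one_mul, ← sub_eq_add_neg] at this
  exact this

lemma Dv_vertInc {W : MicS d} (hW : RegularMic H W) (v : Pt d × Pt d) :
    LEq H (Dv v (vertInc W)) (vertInc (Dv v W)) := by
  intro z hz Z hZ
  have h := ((hW.shift_up).differentiableAt hz hZ.le).hasFDerivAt.sub
    (hW.differentiableAt hz hZ.le).hasFDerivAt
  change fderiv ℝ (unc (fun z Z => W z (Z + (0, 1))) - unc W) (z, Z) v = _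
  rw [h.fderiv, sub_apply]
  change Dv v (fun z Z => W z (Z + (0, 1))) z Z - Dv v W z Z = _
  rw [Dv_shift]
  rfl

lemma Tame.decays_vertInc (hH : Wall H) {W : MicS d} (hW : Tame H W) :
    Decays H 1 (vertInc W) := by
  refine ⟨hW.bdd.reg.vertInc, fun n => ?_⟩
  have hb : ∀ {W : MicS d}, Tame H W → BddW 1 (vertInc W) := fun {W} hW => by
    obtain ⟨C, hC, hb⟩ := (hW.dec (0, 1)).bddW
    refine ⟨C, hC, fun z hz Z hZ => ?_⟩
    have := abs_sub_vertical_le hH hW.bdd.reg hb hz Z.1 hZ zero_le_one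
    rw [one_mul, vertInc, show Z + (0, 1) = (Z.1, Z.2 + 1) from Prod.ext (add_zero _) rfl]
    exact this
  induction n generalizing W with
  | zero => exact hb hW
  | succ n ih =>
    exact ⟨hb hW, fun v hv => (ih (hW.Dv hH hv)).congr hH ((hW.Dv hH hv).bdd.reg.vertInc)
      ((hW.bdd.reg.vertInc).Dv v) (Dv_vertInc hW.bdd.reg v).symm⟩

/-- Telescoping: the partial sums are W(X, Y + n) - W(X, Y). -/
lemma Tame.hasSum_vertInc (hH : Wall H) {W : MicS d} (hW : Tame H W) {z : Pt d} (hz : z ∈ slab d)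
    (X : Fin d → ℝ) {Y : ℝ} (hY : 0 ≤ Y) :
    HasSum (fun n : ℕ => vertInc W z (X, Y + n)) (RoughChannel.farField W z - W z (X, Y)) := by
  obtain ⟨C, hC, h⟩ := hW.farField hH
  obtain ⟨B, hB, hb⟩ := (hW.decays_vertInc hH).bddW
  have hs : Summable fun n : ℕ => vertInc W z (X, Y + n) := by
    refine Summable.of_norm_bounded (Real.summable_exp_neg_nat.mul_left B) fun n => ?_
    refine (hb z hz (X, Y + n) (by positivity)).trans ?_
    gcongr
    change (n : ℝ) ≤ 1 * (Y + n)
    linarith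
  have ht : Tendsto (fun n : ℕ => W z (X, Y + n)) atTop (𝓝 (RoughChannel.farField W z)) := by
    have h0 : Tendsto (fun n : ℕ => W z (X, Y + n) - RoughChannel.farField W z) atTop (𝓝 0) := by
      refine squeeze_zero_norm (fun n => (h z hz).2 (X, Y + n) (by positivity)) ?_
      exact (tendsto_mul_exp_neg_atTop C).comp
        (tendsto_atTop_add_const_left _ _ tendsto_natCast_atTop_atTop)
    simpa using h0.add_const (RoughChannel.farField W z)
  have h1 := hs.hasSum.tendsto_sum_nat
  have h2 : ∀ n : ℕ, ∑ i ∈ Finset.range n, vertInc W z (X, Y + i)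
      = W z (X, Y + n) - W z (X, Y) := by
    intro n
    have := Finset.sum_range_sub (fun n : ℕ => W z (X, Y + n)) n
    simp only [Nat.cast_zero, add_zero] at this
    rw [← this]
    refine Finset.sum_congr rfl fun i _ => ?_
    simp [vertInc, add_assoc]
  simp only [h2] at h1
  rw [← tendsto_nhds_unique h1 (ht.sub_const _)]
  exact hs.hasSum

/-- The far field is only a pointwise limit, with no evident regularity in x. Written as the
telescoping series of unit increments, its distance to W is a sum of smooth traces whose derivatives
of every order are dominated by a geometric series with common factor exp(-1/ε). -/
theorem Tame.osc_farField (hH : Wall H) {W : MicS d} (hW : Tame H W) (n : ℕ) :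
    Osc (Ioc (0 : ℝ) 1) (fun ε => Real.exp (-ε⁻¹)) n
      (fun ε x => RoughChannel.farField W (x, 1) - W (x, 1) (ε⁻¹ • x, ε⁻¹)) := by
  have hV := hW.decays_vertInc hH
  have he : ∀ ε ∈ Ioc (0 : ℝ) 1, (fun x : Fin d → ℝ =>
      RoughChannel.farField W (x, 1) - W (x, 1) (ε⁻¹ • x, ε⁻¹))
      = fun x => ∑' m : ℕ, vertInc W (x, 1) (ε⁻¹ • x, ε⁻¹ + m) := fun ε hε => by
    funext x
    exact (hW.hasSum_vertInc hH (mem_slab_top x) _ (inv_pos.2 hε.1).le).tsum_eq.symm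
  choose C hC hb using fun ℓ : ℕ => exists_trace_bound hH ℓ hV
  have hc : ∀ ε ∈ Ioc (0 : ℝ) 1, ∀ m : ℕ,
      ContDiff ℝ ∞ fun x : Fin d → ℝ => vertInc W (x, 1) (ε⁻¹ • x, ε⁻¹ + m) := fun ε hε m =>
    contDiff_trace hH hV.reg _ (by have := hε.1; positivity)
  have hv : ∀ ε : ℝ, ∀ ℓ : ℕ, Summable fun m : ℕ =>
      C ℓ * ε⁻¹ ^ ℓ * Real.exp (-ε⁻¹) * Real.exp (-(m : ℝ)) := fun ε ℓ =>
    Real.summable_exp_neg_nat.mul_left _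
  have hbd : ∀ ε ∈ Ioc (0 : ℝ) 1, ∀ (ℓ m : ℕ) (x : Fin d → ℝ),
      ‖iteratedFDeriv ℝ ℓ (fun x : Fin d → ℝ => vertInc W (x, 1) (ε⁻¹ • x, ε⁻¹ + m)) x‖
        ≤ C ℓ * ε⁻¹ ^ ℓ * Real.exp (-ε⁻¹) * Real.exp (-(m : ℝ)) := by
    intro ε hε ℓ m x
    refine (hb ℓ ε hε (ε⁻¹ + m) (by have := hε.1; positivity) x).trans (le_of_eq ?_)
    rw [neg_add, Real.exp_add]
    ring
  refine ⟨fun ε hε => ?_, fun ℓ _ => ⟨C ℓ * ∑' m : ℕ, Real.exp (-(m : ℝ)), ?_, fun ε hε x => ?_⟩⟩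
  · beta_reduce
    rw [he ε hε]
    exact contDiff_tsum (N := ⊤) (hc ε hε) (fun ℓ _ => hv ε ℓ) fun ℓ m x _ => hbd ε hε ℓ m x
  · exact mul_nonneg (hC ℓ) (tsum_nonneg fun m => (Real.exp_pos _).le)
  · beta_reduce
    rw [he ε hε, iteratedFDeriv_tsum_apply (N := ⊤) (hc ε hε) (fun ℓ _ => hv ε ℓ)
      (fun ℓ m x _ => hbd ε hε ℓ m x) le_top]
    refine (tsum_of_norm_bounded (hv ε ℓ).hasSum fun m => hbd ε hε ℓ m x).trans (le_of_eq ?_)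
    rw [tsum_mul_left]
    ring

namespace Expansion

variable {par : Params} {E : Expansion d} {f : MacV d}

lemma abs_zpow_sub_mul_le {ε : ℝ} (hε : ε ∈ Ioc (0 : ℝ) 1) {k N : ℕ} {b : ℝ} (hb : 0 ≤ b) :
    |ε ^ ((k : ℤ) - N)| * b ≤ ε⁻¹ ^ N * b := by
  have hε0 : 0 < ε := hε.1
  rw [abs_of_pos (by positivity), zpow_sub₀ hε0.ne', zpow_natCast, zpow_natCast, inv_pow]
  refine mul_le_mul_of_nonneg_right ?_ hb
  rw [div_eq_mul_inv]
  exact mul_le_of_le_one_left (by positivity) (pow_le_one₀ hε0.le hε.2)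

/-- The weights ε^(k-N) are all at most ε^(-N), which is absorbed by the polynomial in 1/ε. -/
theorem osc_Dplus (hH : Wall H) (hE : E.IsElementary par H f) (N n : ℕ) :
    Osc (Ioc (0 : ℝ) 1) (fun ε => ε⁻¹ ^ N * Real.exp (-ε⁻¹)) n (fun ε => E.Dplus N ε) :=
  Osc.pi fun i => Osc.sum _ fun k _ =>
    (((E.layerDecay hH hE k).U i).osc_farField hH n).scale (fun _ hε => hε.1)
      fun _ hε => abs_zpow_sub_mul_le hε (Real.exp_pos _).le

theorem osc_Nplus (hH : Wall H) (hE : E.IsElementary par H f) (N n : ℕ) :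
    Osc (Ioc (0 : ℝ) 1) (fun ε => ε⁻¹ ^ N * Real.exp (-ε⁻¹)) n (fun ε => E.Nplus N ε) := by
  refine Osc.pi fun i => Osc.pi fun j => ?_
  have h : Osc (Ioc (0 : ℝ) 1) (fun ε => ε⁻¹ ^ N * Real.exp (-ε⁻¹)) n (fun ε x =>
      ∑ k ∈ Finset.range N, ε ^ ((k : ℤ) - N)
        * pdX (Fin.last d) (E.S (k + 1) i j) (x, 1) (ε⁻¹ • x, ε⁻¹)) := by
    refine Osc.sum _ fun k _ => Osc.scale (ρ := fun ε => Real.exp (-ε⁻¹)) ?_ (fun _ hε => hε.1)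
      fun _ hε => abs_zpow_sub_mul_le hε (Real.exp_pos _).le
    have hW := ((E.layerDecay hH hE (k + 1)).S i j).pdX hH (Fin.last d)
    refine ⟨fun ε hε => contDiff_trace hH hW.reg _ (inv_pos.2 hε.1).le, fun ℓ _ => ?_⟩
    obtain ⟨C, hC, hb⟩ := exists_trace_bound hH ℓ hW
    exact ⟨C, hC, fun ε hε x => (hb ε hε ε⁻¹ (inv_pos.2 hε.1).le x).trans (by rw [mul_right_comm])⟩
  have := h.scale (c := fun _ => -1) (fun _ hε => hε.1)
    (ρ' := fun ε => ε⁻¹ ^ N * Real.exp (-ε⁻¹)) fun ε _ => by simp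
  simp only [neg_one_mul] at this
  exact this

end Expansion

end RoughChannel

noncomputable section

namespace RoughChannel

variable {d : ℕ} {H : (Fin d → ℝ) → ℝ}

/-! ### Taylor series at the lower boundary of the channel -/

/-- The field is analytic at the points of height less than `δ` and is there the sum of its
vertical Taylor series. -/
def TaylorAt (δ : ℝ) (g : MacS d) (x : Fin d → ℝ) : Prop :=
  ∀ t : ℝ, |t| < δ → AnalyticAt ℝ g (x, t) ∧
    HasSum (fun q : ℕ => t ^ q / (q.factorial : ℝ) * iteratedDeriv q (fun s => g (x, s)) 0)
      (g (x, t))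

lemma TaylorAt.mono {δ δ' : ℝ} {g : MacS d} {x : Fin d → ℝ} (h : TaylorAt δ g x) (hδ : δ' ≤ δ) :
    TaylorAt δ' g x := fun t ht => h t (ht.trans_le hδ)

/-- Restricting the power series to the vertical line does not shrink its radius, since the
inclusion of the line has norm at most 1. -/
lemma HasFPowerSeriesOnBall.taylorAt {g : MacS d}
    {p : FormalMultilinearSeries ℝ (Pt d) ℝ} {x : Fin d → ℝ} {δ : ℝ}
    (h : HasFPowerSeriesOnBall g p (x, 0) (ENNReal.ofReal δ)) : TaylorAt δ g x := by
  intro t ht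
  refine ⟨h.analyticAt_of_mem ?_, ?_⟩
  · rw [Metric.mem_eball, edist_dist, Prod.dist_eq]
    simp only [dist_self, Real.dist_eq, sub_zero]
    rw [max_eq_right (abs_nonneg _)]
    exact (ENNReal.ofReal_lt_ofReal_iff ((abs_nonneg t).trans_lt ht)).2 ht
  -- The centre is translated to the origin so that the restriction to the line is composition with
  -- a linear map.
  · have h1 := h.comp_sub (-(x, 0))
    set u := ContinuousLinearMap.inr ℝ (Fin d → ℝ) ℝ
    have h2 : HasFPowerSeriesOnBall (fun z => g (z - -(x, 0))) p (u 0) (ENNReal.ofReal δ) := by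
      rwa [map_zero, ← add_neg_cancel ((x, 0) : Pt d)]
    have h3 := h2.compContinuousLinearMap
    have hfun : (fun z => g (z - -(x, 0))) ∘ u = fun s : ℝ => g (x, s) := by
      funext s
      simp [u]
    rw [hfun] at h3
    have hle : ENNReal.ofReal δ ≤ ENNReal.ofReal δ / ‖u‖ₑ := by
      rw [ENNReal.le_div_iff_mul_le (Or.inr h.r_pos.ne') (Or.inr ENNReal.ofReal_ne_top)]
      refine mul_le_of_le_one_right' ?_
      rw [← ofReal_norm, ENNReal.ofReal_le_one]
      exact ContinuousLinearMap.norm_inr_le_one ℝ _ _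
    have hpos := h.r_pos
    have ht' : t ∈ Metric.eball (0 : ℝ) (ENNReal.ofReal δ) := by
      rw [Metric.mem_eball, edist_dist, Real.dist_eq, sub_zero]
      exact (ENNReal.ofReal_lt_ofReal_iff ((abs_nonneg t).trans_lt ht)).2 ht
    have h4 := (h3.mono hpos hle).hasSum_iteratedFDeriv ht'
    rw [zero_add] at h4
    refine h4.congr_fun fun q => ?_
    rw [iteratedFDeriv_apply_eq_iteratedDeriv_mul_prod]
    simp only [Finset.prod_const, Finset.card_univ, Fintype.card_fin, smul_eq_mul]
    ring

/-- Re-expanding at a centre within R/2 leaves radius at least R/2, so one δ serves a whole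
neighbourhood; compactness and periodicity then make it global. -/
lemma RegularMac.eventually_taylorAt {g : MacS d} (hg : RegularMac g) (x₀ : Fin d → ℝ) :
    ∃ δ > 0, ∀ᶠ x in 𝓝 x₀, TaylorAt δ g x := by
  obtain ⟨p, r, hp⟩ := hg.2 (x₀, 0) ⟨le_rfl, zero_le_one⟩
  obtain ⟨R, hR0, hRr⟩ : ∃ R : ℝ, 0 < R ∧ ENNReal.ofReal R ≤ r := by
    rcases eq_or_ne r ⊤ with rfl | hr
    · exact ⟨1, one_pos, le_top⟩
    · exact ⟨r.toReal, ENNReal.toReal_pos hp.r_pos.ne' hr, ENNReal.ofReal_toReal_le⟩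
  have hp' := hp.mono (ENNReal.ofReal_pos.2 hR0) hRr
  refine ⟨R / 2, by positivity, ?_⟩
  filter_upwards [Metric.ball_mem_nhds x₀ (half_pos hR0)] with x hx
  have hy : ‖((x - x₀, 0) : Pt d)‖ < R / 2 := by
    rw [Prod.norm_mk, norm_zero, max_eq_left (norm_nonneg _), ← dist_eq_norm]
    exact hx
  have hyR : (‖((x - x₀, 0) : Pt d)‖₊ : ENNReal) = ENNReal.ofReal ‖((x - x₀, 0) : Pt d)‖ := by
    rw [ofReal_norm]; rfl
  have h1 := hp'.changeOrigin (y := (x - x₀, 0)) (by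
    rw [hyR]
    exact (ENNReal.ofReal_lt_ofReal_iff hR0).2 (by linarith))
  rw [hyR, ← ENNReal.ofReal_sub _ (norm_nonneg _)] at h1
  have h2 := h1.mono (ENNReal.ofReal_pos.2 (half_pos hR0))
    (ENNReal.ofReal_le_ofReal (by linarith))
  rw [show ((x₀, 0) : Pt d) + (x - x₀, 0) = (x, 0) by simp] at h2
  exact HasFPowerSeriesOnBall.taylorAt h2

theorem RegularMac.exists_taylorAt {g : MacS d} (hg : RegularMac g) :
    ∃ δ > 0, ∀ x, TaylorAt δ g x := by
  have hK : ∃ δ > 0, ∀ x ∈ Icc (0 : Fin d → ℝ) 1, TaylorAt δ g x := by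
    refine isCompact_Icc.induction_on (p := fun s => ∃ δ > 0, ∀ x ∈ s, TaylorAt δ g x)
      ⟨1, one_pos, fun x hx => hx.elim⟩ ?_ ?_ ?_
    · rintro s t hst ⟨δ, hδ, h⟩
      exact ⟨δ, hδ, fun x hx => h x (hst hx)⟩
    · rintro s t ⟨δ, hδ, h⟩ ⟨δ', hδ', h'⟩
      refine ⟨min δ δ', lt_min hδ hδ', fun x hx => ?_⟩
      rcases hx with hx | hx
      · exact (h x hx).mono (min_le_left _ _)
      · exact (h' x hx).mono (min_le_right _ _)
    · intro x _
      obtain ⟨δ, hδ, h⟩ := hg.eventually_taylorAt x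
      exact ⟨_, mem_nhdsWithin_of_mem_nhds h, δ, hδ, fun x hx => hx⟩
  obtain ⟨δ, hδ, h⟩ := hK
  refine ⟨δ, hδ, fun x => ?_⟩
  obtain ⟨X, hX, hper⟩ := exists_mem_Icc_of_periodic ((x, 0) : Pt d)
  have hsh : ∀ l : Fin d, (fun z => g (z + dir l.castSucc)) = g := fun l => funext fun z => hg.1 z l
  have := hper (fun z => TaylorAt δ g z.1) fun z l => by
    have hd : ∀ s : ℝ, ((z.1 + Pi.single l 1, s) : Pt d) = (z.1, s) + dir l.castSucc := fun s => by
      rw [dir_castSucc]; simp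
    have ha : ∀ s : ℝ, AnalyticAt ℝ g ((z.1, s) + dir l.castSucc) ↔ AnalyticAt ℝ g (z.1, s) := by
      intro s
      constructor <;> intro h
      · have := h.comp_sub (-dir l.castSucc)
        simp only [sub_neg_eq_add, hsh, add_neg_cancel_right] at this
        exact this
      · have := h.comp_sub (dir l.castSucc)
        have he : (fun w => g (w - dir l.castSucc)) = g := by
          funext w
          rw [← hg.1 (w - dir l.castSucc) l, sub_add_cancel]
        rwa [he] at this
    have he : (z + dir l.castSucc).1 = z.1 + Pi.single l 1 := by rw [dir_castSucc]; rfl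
    simp only [TaylorAt, he, hd, hg.1 _ l, ha]
  rw [show TaylorAt δ g x = TaylorAt δ g X from this]
  exact h X hX

/-! ### Fields that are smooth near the lower boundary -/

/-- Periodic fields that are smooth for `|y| < δ`. -/
structure NearWall (δ : ℝ) (g : MacS d) : Prop where
  per : XPeriodic g
  smooth : ∀ z : Pt d, |z.2| < δ → ContDiffAt ℝ ∞ g z

lemma eventually_abs_snd_lt {δ : ℝ} {z : Pt d} (hz : |z.2| < δ) : ∀ᶠ w : Pt d in 𝓝 z, |w.2| < δ :=
  (continuous_snd.abs.continuousAt (x := z)).eventually_lt_const hz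

namespace NearWall

variable {δ : ℝ} {g : MacS d}

lemma pd (h : NearWall δ g) (j : Fin (d + 1)) : NearWall δ (pd j g) :=
  ⟨h.per.pd j, fun z hz =>
    ((h.smooth z hz).fderiv_right (m := ∞) (by simp)).clm_apply contDiffAt_const⟩

lemma iterate_pd (h : NearWall δ g) (j : Fin (d + 1)) (q : ℕ) :
    NearWall δ ((RoughChannel.pd j)^[q] g) := by
  induction q generalizing g with
  | zero => exact h
  | succ q ih => exact ih (h.pd j)

lemma differentiableAt (h : NearWall δ g) {z : Pt d} (hz : |z.2| < δ) : DifferentiableAt ℝ g z :=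
  (h.smooth z hz).differentiableAt (by simp)

lemma hasDerivAt_vert (h : NearWall δ g) (x : Fin d → ℝ) {t : ℝ} (ht : |t| < δ) :
    HasDerivAt (fun s => g (x, s)) (RoughChannel.pd (Fin.last d) g (x, t)) t := by
  have h1 := (h.differentiableAt (z := (x, t)) ht).hasFDerivAt
  have h2 : HasDerivAt (fun s : ℝ => ((x, s) : Pt d)) (0, 1) t :=
    (hasDerivAt_const t x).prodMk (hasDerivAt_id t)
  have := h1.comp_hasDerivAt t h2
  rwa [← dir_last] at this

lemma iteratedDeriv_eq (h : NearWall δ g) (hδ : 0 < δ) (q : ℕ) (x : Fin d → ℝ) :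
    iteratedDeriv q (fun s => g (x, s)) 0 = (RoughChannel.pd (Fin.last d))^[q] g (x, 0) := by
  induction q generalizing g with
  | zero => simp
  | succ q ih =>
    rw [iteratedDeriv_succ', Function.iterate_succ_apply, ← ih (h.pd _)]
    refine Filter.EventuallyEq.iteratedDeriv_eq q ?_
    have : ∀ᶠ s : ℝ in 𝓝 0, |s| < δ :=
      continuous_abs.continuousAt.eventually_lt_const (by simpa using hδ)
    filter_upwards [this] with s hs
    exact (h.hasDerivAt_vert x hs).deriv

lemma exists_bound (h : NearWall δ g) (hδ : 0 < δ) :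
    ∃ C, 0 ≤ C ∧ ∀ z : Pt d, |z.2| ≤ δ / 2 → |g z| ≤ C := by
  have hK : IsCompact (Icc (0 : Fin d → ℝ) 1 ×ˢ Icc (-(δ / 2)) (δ / 2)) :=
    isCompact_Icc.prod isCompact_Icc
  obtain ⟨C, hC⟩ := hK.exists_bound_of_continuousOn (f := g) fun z hz =>
    (h.smooth z ((abs_le.2 hz.2).trans_lt (half_lt_self hδ))).continuousAt.continuousWithinAt
  refine ⟨|C|, abs_nonneg _, fun z hz => ?_⟩
  obtain ⟨X, hX, hper⟩ := exists_mem_Icc_of_periodic z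
  rw [hper g h.per]
  exact (hC (X, z.2) ⟨hX, abs_le.1 hz⟩).trans (le_abs_self C)

lemma pd_comm (h : NearWall δ g) (i j : Fin (d + 1)) {z : Pt d} (hz : |z.2| < δ) :
    RoughChannel.pd i (RoughChannel.pd j g) z = RoughChannel.pd j (RoughChannel.pd i g) z := by
  have hc := h.smooth z hz
  have hd : DifferentiableAt ℝ (fderiv ℝ g) z :=
    (hc.fderiv_right (m := ∞) (by simp)).differentiableAt (by simp)
  have key : ∀ i j : Fin (d + 1), RoughChannel.pd i (RoughChannel.pd j g) z
      = fderiv ℝ (fderiv ℝ g) z (dir i) (dir j) := by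
    intro i j
    have : HasFDerivAt (RoughChannel.pd j g)
        ((ContinuousLinearMap.apply ℝ ℝ (dir j)).comp (fderiv ℝ (fderiv ℝ g) z)) z :=
      ((ContinuousLinearMap.apply ℝ ℝ (dir j)).hasFDerivAt).comp z hd.hasFDerivAt
    change fderiv ℝ (RoughChannel.pd j g) z (dir i) = _
    rw [this.fderiv]
    rfl
  rw [key, key]
  exact (hc.isSymmSndFDerivAt (by
    rw [minSmoothness_of_isRCLikeNormedField]; exact two_le_infty)) _ _

end NearWall

/-- Equality of fields for `|y| < δ`. -/
def NearEq (δ : ℝ) (g g' : MacS d) : Prop := ∀ z : Pt d, |z.2| < δ → g z = g' z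

lemma NearEq.pd {δ : ℝ} {g g' : MacS d} (h : NearEq δ g g') (j : Fin (d + 1)) :
    NearEq δ (pd j g) (pd j g') := fun z hz => by
  simp only [RoughChannel.pd]
  rw [Filter.EventuallyEq.fderiv_eq ((eventually_abs_snd_lt hz).mono h)]

lemma NearEq.iterate_pd {δ : ℝ} {g g' : MacS d} (h : NearEq δ g g') (j : Fin (d + 1)) (q : ℕ) :
    NearEq δ ((RoughChannel.pd j)^[q] g) ((RoughChannel.pd j)^[q] g') := by
  induction q generalizing g g' with
  | zero => exact h
  | succ q ih => exact ih (h.pd j)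

lemma NearWall.iterate_pd_comm {δ : ℝ} {g : MacS d} (h : NearWall δ g) (i j : Fin (d + 1))
    (q : ℕ) : NearEq δ ((RoughChannel.pd j)^[q] (RoughChannel.pd i g))
      (RoughChannel.pd i ((RoughChannel.pd j)^[q] g)) := by
  induction q generalizing g with
  | zero => exact fun _ _ => rfl
  | succ q ih =>
    intro z hz
    rw [Function.iterate_succ_apply, Function.iterate_succ_apply, ← ih (h.pd j) z hz]
    exact NearEq.iterate_pd (fun w hw => h.pd_comm j i hw) j q z hz

/-- Fields vanishing to the order `m` at the lower boundary. -/
structure Flat (δ : ℝ) (m : ℕ) (g : MacS d) : Prop where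
  near : NearWall δ g
  zero : ∀ q < m, ∀ x, (pd (Fin.last d))^[q] g (x, 0) = 0

namespace Flat

variable {δ : ℝ} {m : ℕ} {g : MacS d}

lemma pd_last (h : Flat δ m g) : Flat δ (m - 1) (pd (Fin.last d) g) :=
  ⟨h.near.pd _, fun q hq x => h.zero (q + 1) (by omega) x⟩

/-- The traces at y = 0 vanish for all x, hence so do their tangential derivatives: no order of
vanishing is lost, unlike for ∂_y. -/
lemma pd_castSucc (hδ : 0 < δ) (h : Flat δ m g) (l : Fin d) : Flat δ m (pd l.castSucc g) := by
  refine ⟨h.near.pd _, fun q hq x => ?_⟩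
  have h0 : |((x, 0) : Pt d).2| < δ := by simpa using hδ
  rw [h.near.iterate_pd_comm _ _ q (x, 0) h0]
  set F := (pd (Fin.last d))^[q] g
  have h1 := ((h.near.iterate_pd (Fin.last d) q).differentiableAt h0).hasFDerivAt
  have h2 : HasDerivAt (fun t : ℝ => ((x + t • Pi.single l 1, 0) : Pt d)) (Pi.single l 1, 0) 0 := by
    have a1 : HasDerivAt (fun t : ℝ => x + t • (Pi.single l 1 : Fin d → ℝ)) (Pi.single l 1) 0 := by
      simpa using ((hasDerivAt_id (0 : ℝ)).smul_const (Pi.single l 1 : Fin d → ℝ)).const_add x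
    exact a1.prodMk (hasDerivAt_const _ _)
  have h3 := HasFDerivAt.comp_hasDerivAt_of_eq (0 : ℝ) h1 h2 (by simp)
  have h4 : F ∘ (fun t : ℝ => ((x + t • Pi.single l 1, 0) : Pt d)) = fun _ => 0 :=
    funext fun t => h.zero q hq _
  rw [h4, ← dir_castSucc] at h3
  exact h3.unique (hasDerivAt_const _ _)

/-- Integrate from y = 0 once for each order of vanishing. The strip is halved so that its closure
over a period is compact inside the region of smoothness. -/
lemma exists_bound (hδ : 0 < δ) (h : Flat δ m g) :
    ∃ C, 0 ≤ C ∧ ∀ z : Pt d, |z.2| ≤ δ / 2 → |g z| ≤ C * |z.2| ^ m := by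
  induction m generalizing g with
  | zero => simpa using h.near.exists_bound hδ
  | succ m ih =>
    obtain ⟨C, hC, hb⟩ := ih h.pd_last
    refine ⟨C, hC, fun z hz => ?_⟩
    have hle : ∀ s ∈ uIcc 0 z.2, |s| ≤ |z.2| := fun s hs => by
      simpa using abs_sub_left_of_mem_uIcc hs
    have := (convex_uIcc (0 : ℝ) z.2).norm_image_sub_le_of_norm_hasDerivWithin_le
      (f := fun s => g (z.1, s)) (f' := fun s => pd (Fin.last d) g (z.1, s)) (C := C * |z.2| ^ m)
      (fun s hs => (h.near.hasDerivAt_vert z.1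
        ((hle s hs).trans_lt (hz.trans_lt (half_lt_self hδ)))).hasDerivWithinAt)
      (fun s hs => (hb (z.1, s) ((hle s hs).trans hz)).trans (by
        have := hle s hs
        change C * |s| ^ m ≤ _
        gcongr)) left_mem_uIcc right_mem_uIcc
    have h0 : g (z.1, 0) = 0 := h.zero 0 (Nat.succ_pos m) z.1
    rw [h0, sub_zero, sub_zero, Real.norm_eq_abs, Real.norm_eq_abs] at this
    rwa [pow_succ, ← mul_assoc]

end Flat

/-- The remainder of the vertical Taylor expansion at `y = 0`. -/
def taylorTail (m : ℕ) (g : MacS d) (z : Pt d) : ℝ :=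
  g z - ∑ q ∈ Finset.range m, z.2 ^ q / (q.factorial : ℝ) * (pd (Fin.last d))^[q] g (z.1, 0)

lemma NearWall.taylorTail {δ : ℝ} (hδ : 0 < δ) {g : MacS d} (h : NearWall δ g) (m : ℕ) :
    NearWall δ (taylorTail m g) := by
  have hper : ∀ q, XPeriodic fun z : Pt d => (RoughChannel.pd (Fin.last d))^[q] g (z.1, 0) :=
    fun q z l => by
      have := (h.iterate_pd (Fin.last d) q).per (z.1, 0) l
      rw [dir_castSucc] at this ⊢
      simpa using this
  refine ⟨fun z l => ?_, fun z hz => ?_⟩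
  · have h2 : (z + dir l.castSucc).2 = z.2 := by simp [dir_castSucc]
    simp only [RoughChannel.taylorTail, h.per z l, h2]
    congr 1
    exact Finset.sum_congr rfl fun q _ => congrArg _ (hper q z l)
  · refine (h.smooth z hz).sub (ContDiffAt.sum fun q _ => ?_)
    refine ContDiffAt.mul (by fun_prop) ?_
    exact ContDiffAt.comp (g := (RoughChannel.pd (Fin.last d))^[q] g)
      (f := fun z : Pt d => ((z.1, 0) : Pt d)) z
      ((h.iterate_pd (Fin.last d) q).smooth (z.1, 0) (by simpa using hδ)) (by fun_prop)

/-- Termwise differentiation of the Taylor polynomial shifts its index by one; this drives the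
induction showing that the remainder is flat. -/
lemma pd_taylorTail {δ : ℝ} (hδ : 0 < δ) {g : MacS d} (h : NearWall δ g) (m : ℕ) :
    NearEq δ (pd (Fin.last d) (taylorTail (m + 1) g)) (taylorTail m (pd (Fin.last d) g)) := by
  intro z hz
  have h1 := (h.taylorTail hδ (m + 1)).hasDerivAt_vert z.1 hz
  refine h1.unique ?_
  have h2 : ∀ q : ℕ, HasDerivAt (fun s : ℝ => s ^ (q + 1) / ((q + 1).factorial : ℝ)
      * (pd (Fin.last d))^[q + 1] g (z.1, 0)) (z.2 ^ q / (q.factorial : ℝ)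
        * (pd (Fin.last d))^[q + 1] g (z.1, 0)) z.2 := fun q => by
    refine (((hasDerivAt_pow (q + 1) z.2).div_const _).mul_const _).congr_deriv ?_
    rw [Nat.factorial_succ]
    have : (q.factorial : ℝ) ≠ 0 := by positivity
    push_cast
    field_simp
  have h3 := (h.hasDerivAt_vert z.1 hz).sub
    ((HasDerivAt.fun_sum fun q (_ : q ∈ Finset.range m) => h2 q).add_const (g (z.1, 0)))
  refine h3.congr_of_eventuallyEq (Eventually.of_forall fun s => ?_)
  simp [taylorTail, Finset.sum_range_succ']

theorem NearWall.flat_taylorTail {δ : ℝ} (hδ : 0 < δ) {g : MacS d} (h : NearWall δ g) (m : ℕ) :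
    Flat δ m (RoughChannel.taylorTail m g) := by
  refine ⟨h.taylorTail hδ m, fun q hq x => ?_⟩
  induction q generalizing g m with
  | zero =>
    obtain ⟨m, rfl⟩ : ∃ k, m = k + 1 := ⟨m - 1, by omega⟩
    simp [RoughChannel.taylorTail, Finset.sum_range_succ']
  | succ q ih =>
    obtain ⟨m, rfl⟩ : ∃ k, m = k + 1 := ⟨m - 1, by omega⟩
    rw [Function.iterate_succ_apply, (pd_taylorTail hδ h m).iterate_pd _ q (x, 0) (by simpa using hδ)]
    exact ih (h.pd _) m (by omega)

end RoughChannel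

end

noncomputable section

namespace RoughChannel

variable {d : ℕ} {H : (Fin d → ℝ) → ℝ}

/-! ### Traces on the oscillating boundary -/

lemma Osc.add {S : Set ℝ} {ρ : ℝ → ℝ} {n : ℕ} {φ ψ : ℝ → (Fin d → ℝ) → ℝ} (h : Osc S ρ n φ)
    (h' : Osc S ρ n ψ) : Osc S ρ n (fun ε x => φ ε x + ψ ε x) := by
  have := Osc.sum (Finset.univ : Finset Bool) (φ := fun b => cond b φ ψ) (S := S) (ρ := ρ) (n := n)
    fun b _ => by cases b; exacts [h', h]
  simpa using this

lemma contDiff_dH (hHs : ContDiff ℝ ∞ H) (l : Fin d) : ContDiff ℝ ∞ (dH H l) :=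
  (hHs.fderiv_right (m := ∞) (by simp)).clm_apply contDiff_const

lemma dH_add_single (hper : ∀ X (l : Fin d), H (X + Pi.single l 1) = H X) (l : Fin d)
    (X : Fin d → ℝ) (l' : Fin d) : dH H l (X + Pi.single l' 1) = dH H l X := by
  have := fderiv_comp_add_right (𝕜 := ℝ) (f := H) (x := X) (Pi.single l' 1)
  rw [show (fun x => H (x + Pi.single l' 1)) = H from funext fun x => hper x l'] at this
  rw [dH, dH, this]

lemma osc_rescaled {S : Set ℝ} (hS : ∀ ε ∈ S, 0 < ε) (n : ℕ) {ψ : (Fin d → ℝ) → ℝ}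
    (hψ : ContDiff ℝ ∞ ψ) (hper : ∀ X (l : Fin d), ψ (X + Pi.single l 1) = ψ X) :
    Osc S (fun _ => 1) n (fun ε x => ψ (ε⁻¹ • x)) := by
  have hc : ∀ {ψ : (Fin d → ℝ) → ℝ}, ContDiff ℝ ∞ ψ → ∀ ε : ℝ,
      ContDiff ℝ ∞ fun x : Fin d → ℝ => ψ (ε⁻¹ • x) := fun hψ ε =>
    hψ.comp (contDiff_const_smul _)
  have hb : ∀ {ψ : (Fin d → ℝ) → ℝ}, ContDiff ℝ ∞ ψ →
      (∀ X (l : Fin d), ψ (X + Pi.single l 1) = ψ X) →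
      ∃ C, 0 ≤ C ∧ ∀ ε ∈ S, ∀ x : Fin d → ℝ, |ψ (ε⁻¹ • x)| ≤ C * 1 := by
    intro ψ hψ hper
    obtain ⟨C, hC⟩ := (isCompact_Icc (a := (0 : Fin d → ℝ)) (b := 1)).exists_bound_of_continuousOn
      hψ.continuous.continuousOn
    refine ⟨|C|, abs_nonneg _, fun ε _ x => ?_⟩
    obtain ⟨X', hX', hg⟩ := exists_mem_Icc_of_periodic ((ε⁻¹ • x, 0) : Pt d)
    have h1 := hg (fun Z => ψ Z.1) (fun Z l => by simp [dir_castSucc, hper])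
    simp only at h1
    rw [h1, mul_one]
    exact (hC X' hX').trans (le_abs_self C)
  induction n generalizing ψ with
  | zero =>
    refine ⟨fun ε _ => hc hψ ε, fun ℓ hℓ => ?_⟩
    obtain rfl : ℓ = 0 := by omega
    obtain ⟨C, hC, h⟩ := hb hψ hper
    exact ⟨C, hC, fun ε hε x => by simpa using h ε hε x⟩
  | succ n ih =>
    refine Osc.of_succ (ψ := fun l ε x => ε⁻¹ * dH ψ l (ε⁻¹ • x))
      (fun ε _ => hc hψ ε) (hb hψ hper) (fun ε _ l x => ?_) fun l => ?_
    · have h1 : HasFDerivAt (fun x : Fin d → ℝ => ε⁻¹ • x) (ε⁻¹ • ContinuousLinearMap.id ℝ _) x :=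
        (hasFDerivAt_id x).const_smul ε⁻¹
      have h2 := HasFDerivAt.comp (g := ψ) x
        ((hψ.differentiable (by simp)) (ε⁻¹ • x)).hasFDerivAt h1
      change fderiv ℝ (ψ ∘ fun x : Fin d → ℝ => ε⁻¹ • x) x _ = _
      rw [h2.fderiv]
      simp [dH]
    · exact (ih (contDiff_dH hψ l) (dH_add_single hper l)).scale hS fun ε hε => by rw [abs_of_pos (inv_pos.2 (hS ε hε))]; simp

/-- The trace of a macroscopic field on the oscillating boundary. -/
def wallTrace (H : (Fin d → ℝ) → ℝ) (g : MacS d) (ε : ℝ) (x : Fin d → ℝ) : ℝ :=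
  g (x, -(ε * H (ε⁻¹ • x)))

lemma contDiff_wallTrace (hHs : ContDiff ℝ ∞ H) {δ : ℝ} {g : MacS d} (hg : NearWall δ g) {ε : ℝ}
    (hε : ∀ X, |ε * H X| < δ) : ContDiff ℝ ∞ (wallTrace H g ε) := by
  have hH' : ContDiff ℝ ∞ fun x : Fin d → ℝ => H (ε⁻¹ • x) := hHs.comp (contDiff_const_smul _)
  refine contDiff_iff_contDiffAt.2 fun x => ContDiffAt.comp (g := g)
    (f := fun x : Fin d → ℝ => ((x, -(ε * H (ε⁻¹ • x))) : Pt d)) x (hg.smooth _ ?_) ?_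
  · simpa [abs_neg] using hε (ε⁻¹ • x)
  · exact contDiffAt_id.prodMk (contDiffAt_const.mul hH'.contDiffAt).neg

/-- The amplitude ε of the wall cancels the 1/ε of its oscillation, so no negative power of ε
appears explicitly. -/
lemma fderiv_wallTrace (hHs : ContDiff ℝ ∞ H) {δ : ℝ} {g : MacS d} (hg : NearWall δ g) {ε : ℝ}
    (hε0 : 0 < ε) (hε : ∀ X, |ε * H X| < δ) (l : Fin d) (x : Fin d → ℝ) :
    fderiv ℝ (wallTrace H g ε) x (Pi.single l 1) = wallTrace H (pd l.castSucc g) ε x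
      + -1 * (wallTrace H (pd (Fin.last d) g) ε x * dH H l (ε⁻¹ • x)) := by
  have h1 := (hg.differentiableAt (z := (x, -(ε * H (ε⁻¹ • x))))
    (by simpa [abs_neg] using hε (ε⁻¹ • x))).hasFDerivAt
  have a1 : HasFDerivAt (fun x : Fin d → ℝ => x) (ContinuousLinearMap.id ℝ _) x := hasFDerivAt_id x
  have a2 : HasFDerivAt (fun x : Fin d → ℝ => ε⁻¹ • x) (ε⁻¹ • ContinuousLinearMap.id ℝ _) x :=
    a1.const_smul ε⁻¹
  have a3 := HasFDerivAt.comp (g := H) x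
    ((hHs.differentiable (by simp)) (ε⁻¹ • x)).hasFDerivAt a2
  have h2 := HasFDerivAt.comp (g := g) (f := fun x : Fin d → ℝ => ((x, -(ε * H (ε⁻¹ • x))) : Pt d))
    x h1 (a1.prodMk (a3.const_mul ε).neg)
  change fderiv ℝ (g ∘ fun x : Fin d → ℝ => ((x, -(ε * H (ε⁻¹ • x))) : Pt d)) x _ = _
  rw [h2.fderiv]
  have hv : ((Pi.single l 1, -dH H l (ε⁻¹ • x)) : Pt d)
      = dir l.castSucc + (-dH H l (ε⁻¹ • x)) • dir (Fin.last d) := by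
    rw [dir_castSucc, dir_last]
    simp
  simp only [wallTrace, pd]
  rw [show ∀ (a b c : ℝ), a + -1 * (b * c) = a + (-c) * b by intros; ring, ← smul_eq_mul (-dH _ _ _),
    ← map_smul, ← map_add, ← hv]
  simp only [ContinuousLinearMap.comp_apply, ContinuousLinearMap.prod_apply]
  congr 2
  simp [dH, hε0.ne']

/-- The trace is O(ε^m) because |y| ≤ εM on the wall. Differentiating gives traces of a field of the
same flatness and of ∂_y g, flat to order m - 1; the latter costs the one factor 1/ε allowed per
derivative, and the coefficients ∂_lH(x/ε) cost no more. -/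
theorem Flat.osc_wallTrace (hHs : ContDiff ℝ ∞ H) (hH : Wall H) {δ ε₀ : ℝ} (hδ : 0 < δ)
    (hε₁ : ε₀ ≤ 1) (hε₀ : ∀ ε ∈ Ioc 0 ε₀, ∀ X, ε * H X ≤ δ / 2) (n m : ℕ) {g : MacS d}
    (hg : Flat δ m g) : Osc (Ioc 0 ε₀) (fun ε => ε ^ m) n (wallTrace H g) := by
  obtain ⟨M, hM, hHM⟩ := hH.exists_upper
  have habs : ∀ ε ∈ Ioc 0 ε₀, ∀ X, |ε * H X| ≤ δ / 2 := fun ε hε X => by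
    rw [abs_of_pos (mul_pos hε.1 (hH.pos X))]
    exact hε₀ ε hε X
  have hlt : ∀ ε ∈ Ioc 0 ε₀, ∀ X, |ε * H X| < δ := fun ε hε X =>
    (habs ε hε X).trans_lt (half_lt_self hδ)
  have hb : ∀ {m : ℕ} {g : MacS d}, Flat δ m g →
      ∃ C, 0 ≤ C ∧ ∀ ε ∈ Ioc 0 ε₀, ∀ x, |wallTrace H g ε x| ≤ C * ε ^ m := by
    intro m g hg
    obtain ⟨C, hC, h⟩ := hg.exists_bound hδ
    refine ⟨C * M ^ m, by positivity, fun ε hε x => ?_⟩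
    have := h (x, -(ε * H (ε⁻¹ • x))) (by simpa [abs_neg] using habs ε hε (ε⁻¹ • x))
    refine this.trans ?_
    have hp := hH.pos (ε⁻¹ • x)
    have hε0 : 0 < ε := hε.1
    rw [mul_assoc, ← mul_pow, abs_neg, abs_of_pos (mul_pos hε0 hp), mul_comm M]
    gcongr
    exact hHM _
  have hpos : ∀ ε ∈ Ioc 0 ε₀, 0 < ε := fun ε hε => hε.1
  induction n generalizing m g with
  | zero =>
    refine ⟨fun ε hε => contDiff_wallTrace hHs hg.near (hlt ε hε), fun ℓ hℓ => ?_⟩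
    obtain rfl : ℓ = 0 := by omega
    obtain ⟨C, hC, h⟩ := hb hg
    exact ⟨C, hC, fun ε hε x => by simpa using h ε hε x⟩
  | succ n ih =>
    refine Osc.of_succ (fun ε hε => contDiff_wallTrace hHs hg.near (hlt ε hε)) (hb hg)
      (fun ε hε l x => fderiv_wallTrace hHs hg.near hε.1 (hlt ε hε) l x) fun l => Osc.add ?_ ?_
    · have := (ih m (hg.pd_castSucc hδ l)).scale (c := fun _ => 1) (ρ' := fun ε => ε ^ m * ε⁻¹) hpos
        fun ε hε => by
          have hε0 : 0 < ε := hε.1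
          rw [abs_one, one_mul]
          exact le_mul_of_one_le_right (by positivity) (one_le_inv₀ hε0 |>.2 (hε.2.trans hε₁))
      simpa only [one_mul] using this
    · have h1 : Osc (Ioc 0 ε₀) (fun _ => 1) n fun ε x => dH H l (ε⁻¹ • x) :=
        osc_rescaled hpos n (contDiff_dH hHs l) (dH_add_single hH.per l)
      refine ((ih (m - 1) hg.pd_last).mul h1 hpos
        fun ε hε => by have := hε.1; positivity).scale hpos fun ε hε => ?_
      have hε0 : 0 < ε := hε.1
      rw [abs_neg, abs_one, one_mul, mul_one]
      -- For m = 0 the truncated m - 1 is again 0, and 1 ≤ 1/ε suffices; otherwise ε^(m-1) = ε^m /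
      -- ε.
      rcases m with _ | m
      · simpa using one_le_inv₀ hε0 |>.2 (hε.2.trans hε₁)
      · rw [pow_succ, mul_assoc, mul_inv_cancel₀ hε0.ne', mul_one]
        simp

lemma TaylorAt.analyticAt {δ : ℝ} {g : MacS d} {x : Fin d → ℝ} (h : TaylorAt δ g x) {t : ℝ}
    (ht : |t| < δ) : AnalyticAt ℝ g (x, t) := (h t ht).1

lemma RegularMac.nearWall {δ : ℝ} {g : MacS d} (hg : RegularMac g) (h : ∀ x, TaylorAt δ g x) :
    NearWall δ g := ⟨hg.1, fun z hz => ((h z.1).analyticAt hz).contDiffAt⟩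

/-- The tails of the vertical Taylor series. -/
lemma TaylorAt.hasSum_tail {δ : ℝ} (hδ : 0 < δ) {g : MacS d} (hg : NearWall δ g)
    {x : Fin d → ℝ} (h : TaylorAt δ g x) (m : ℕ) {t : ℝ} (ht : |t| < δ) :
    HasSum (fun n : ℕ => t ^ (m + n) / ((m + n).factorial : ℝ)
      * iteratedDeriv (m + n) (fun s => g (x, s)) 0) (taylorTail m g (x, t)) := by
  have h1 := (hasSum_nat_add_iff' m).2 (h t ht).2
  have h2 : taylorTail m g (x, t) = g (x, t) - ∑ q ∈ Finset.range m,
      t ^ q / (q.factorial : ℝ) * iteratedDeriv q (fun s => g (x, s)) 0 := by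
    simp only [taylorTail, hg.iteratedDeriv_eq hδ]
  rw [h2]
  exact h1.congr_fun fun n => by rw [add_comm m n]

end RoughChannel

end

noncomputable section

namespace RoughChannel

variable {d : ℕ} {H : (Fin d → ℝ) → ℝ}

/-! ### Boundary data at the oscillating boundary -/

lemma Osc.congr {F : Type*} [NormedAddCommGroup F] [NormedSpace ℝ F] {S : Set ℝ} {ρ : ℝ → ℝ}
    {n : ℕ} {φ ψ : ℝ → (Fin d → ℝ) → F} (h : Osc S ρ n φ) (he : ∀ ε ∈ S, ψ ε = φ ε) :
    Osc S ρ n ψ := by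
  refine ⟨fun ε hε => by rw [he ε hε]; exact h.1 ε hε, fun ℓ hℓ => ?_⟩
  obtain ⟨C, hC, hb⟩ := h.2 ℓ hℓ
  exact ⟨C, hC, fun ε hε x => by rw [he ε hε]; exact hb ε hε x⟩

lemma iteratedDeriv_finset_sum {ι : Type*} (s : Finset ι) {F : ι → ℝ → ℝ} {t : ℝ}
    (hF : ∀ i ∈ s, ContDiffAt ℝ ∞ (F i) t) (q : ℕ) :
    iteratedDeriv q (fun t => ∑ i ∈ s, F i t) t = ∑ i ∈ s, iteratedDeriv q (F i) t := by
  classical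
  induction s using Finset.induction_on with
  | empty => simp
  | insert a s ha ih =>
    have h1 : ContDiffAt ℝ ∞ (fun t => ∑ i ∈ s, F i t) t :=
      ContDiffAt.sum fun i hi => hF i (Finset.mem_insert_of_mem hi)
    simp only [Finset.sum_insert ha]
    rw [iteratedDeriv_fun_add ((hF a (Finset.mem_insert_self a s)).of_le (natCast_le_infty q))
      (h1.of_le (natCast_le_infty q)), ih fun i hi => hF i (Finset.mem_insert_of_mem hi)]

/-- The coefficients of the slope operator: `∂_l H` for the horizontal directions, `1` for the
vertical one. -/
def slopeCoeff (H : (Fin d → ℝ) → ℝ) (X : Fin d → ℝ) (m : Fin (d + 1)) : ℝ :=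
  Fin.lastCases (motive := fun _ => ℝ) 1 (fun l => dH H l X) m

lemma osc_slopeCoeff {S : Set ℝ} (hS : ∀ ε ∈ S, 0 < ε) (n : ℕ) (hHs : ContDiff ℝ ∞ H)
    (hper : ∀ X (l : Fin d), H (X + Pi.single l 1) = H X) (m : Fin (d + 1)) :
    Osc S (fun _ => 1) n (fun ε x => slopeCoeff H (ε⁻¹ • x) m) := by
  refine Fin.lastCases ?_ (fun l => ?_) m
  · simpa [slopeCoeff] using osc_rescaled hS n (contDiff_const (c := (1 : ℝ))) fun _ _ => rfl
  · simpa [slopeCoeff] using osc_rescaled hS n (contDiff_dH hHs l) (dH_add_single hper l)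

lemma exists_uniform_taylorAt {ι : Type*} [Finite ι] {g : ι → MacS d}
    (hg : ∀ i, RegularMac (g i)) : ∀ᶠ δ in 𝓝[>] (0 : ℝ), ∀ i x, TaylorAt δ (g i) x := by
  refine eventually_all.2 fun i => ?_
  obtain ⟨δ, hδ, h⟩ := (hg i).exists_taylorAt
  filter_upwards [Ioc_mem_nhdsGT hδ] with δ' hδ' x
  exact (h x).mono hδ'.2

namespace Expansion

variable {par : Params} {E : Expansion d} {f : MacV d}

/-- The fields that enter the boundary data of order at most `N` are sums of their Taylor series
for `|y| < δ`. -/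
structure TaylorUpTo (E : Expansion d) (N : ℕ) (δ : ℝ) : Prop where
  u : ∀ k ≤ N, ∀ i x, TaylorAt δ (E.u k i) x
  σ : ∀ k ≤ N, ∀ i j m x, TaylorAt δ (pd m (E.σ k i j)) x

theorem exists_taylorUpTo (hE : E.IsElementary par H f) (N : ℕ) : ∃ δ > 0, E.TaylorUpTo N δ := by
  have h1 := exists_uniform_taylorAt (g := fun p : Fin (N + 1) × Fin (d + 1) => E.u p.1 p.2)
    fun p => hE.u_regular _ _
  have h2 := exists_uniform_taylorAt
    (g := fun p : Fin (N + 1) × Fin (d + 1) × Fin (d + 1) × Fin (d + 1) =>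
      pd p.2.2.2 (E.σ p.1 p.2.1 p.2.2.1)) fun p => (hE.σ_regular _ _ _).pd _
  obtain ⟨δ, ⟨h3, h4⟩, hδ⟩ := ((h1.and h2).and self_mem_nhdsWithin).exists
  exact ⟨δ, hδ, fun k hk i x => h3 (⟨k, by omega⟩, i) x,
    fun k hk i j m x => h4 (⟨k, by omega⟩, i, j, m) x⟩

lemma slopeσ_eq (k : ℕ) (i j : Fin (d + 1)) (X x : Fin d → ℝ) (t : ℝ) :
    E.slopeσ H k i j X x t = ∑ m, slopeCoeff H X m * pd m (E.σ k i j) (x, t) := by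
  rw [Fin.sum_univ_castSucc]
  simp [slopeσ, slopeCoeff]

section

variable {N : ℕ} {δ ε₀ : ℝ}

lemma hasSum_taylorU (hE : E.IsElementary par H f) (hδ : 0 < δ) (hT : E.TaylorUpTo N δ) {ε : ℝ}
    (hε : ∀ X, |ε * H X| < δ) {k : ℕ} (hk : k ≤ N) (i : Fin (d + 1)) (x : Fin d → ℝ) (m : ℕ) :
    HasSum (fun n => E.taylorU H ε k i x (m + n)) (wallTrace H (taylorTail m (E.u k i)) ε x) :=
  (hT.u k hk i x).hasSum_tail hδ ((hE.u_regular k i).nearWall (hT.u k hk i)) m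
    (by simpa [abs_neg] using hε (ε⁻¹ • x))

/-- The slope coefficients are constant in the height, so the Taylor tail of the combination is the
combination of the tails of the partial derivatives of σ. -/
lemma hasSum_taylorσ (hE : E.IsElementary par H f) (hδ : 0 < δ) (hT : E.TaylorUpTo N δ) {ε : ℝ}
    (hε : ∀ X, |ε * H X| < δ) {k : ℕ} (hk : k ≤ N) (i j : Fin (d + 1)) (x : Fin d → ℝ) (m : ℕ) :
    HasSum (fun n => E.taylorσ H ε k i j x (m + n)) (∑ b, slopeCoeff H (ε⁻¹ • x) b
      * wallTrace H (taylorTail m (pd b (E.σ k i j))) ε x) := by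
  have hnear := fun b => ((hE.σ_regular k i j).pd b).nearWall (hT.σ k hk i j b)
  have h1 := fun b => (hT.σ k hk i j b x).hasSum_tail hδ (hnear b) m
    (t := -(ε * H (ε⁻¹ • x))) (by simpa [abs_neg] using hε (ε⁻¹ • x))
  have h2 := hasSum_sum fun b (_ : b ∈ Finset.univ) => (h1 b).mul_left (slopeCoeff H (ε⁻¹ • x) b)
  refine h2.congr_fun fun n => ?_
  have hc : ∀ b, ContDiffAt ℝ ∞ (fun s => pd b (E.σ k i j) (x, s)) 0 := fun b =>
    ContDiffAt.comp (g := pd b (E.σ k i j)) (f := fun s : ℝ => ((x, s) : Pt d)) 0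
      ((hnear b).smooth (x, 0) (by simpa using hδ)) (by fun_prop)
  rw [taylorσ, show E.slopeσ H k i j (ε⁻¹ • x) x = fun t =>
    ∑ b, slopeCoeff H (ε⁻¹ • x) b * pd b (E.σ k i j) (x, t) from funext fun t => slopeσ_eq ..,
    iteratedDeriv_finset_sum _ (fun b _ => contDiffAt_const.mul (hc b)), Finset.mul_sum]
  refine Finset.sum_congr rfl fun b _ => ?_
  rw [iteratedDeriv_const_mul _ ((hc b).of_le (natCast_le_infty _))]
  ring

/-- The series at order k starts at index N - k + 1, one beyond the orders matched by the expansion;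
this is the origin of the single remaining factor ε. -/
lemma abs_zpow_mul_pow {ε : ℝ} (hε : 0 < ε) {k N : ℕ} (hk : k ≤ N) :
    |-(ε ^ (-(N : ℤ)) * ε ^ k)| * ε ^ (N - k + 1) = ε := by
  rw [abs_neg, abs_of_pos (by positivity), zpow_neg, zpow_natCast, mul_assoc, ← pow_add,
    show k + (N - k + 1) = N + 1 by omega, pow_succ]
  field_simp

lemma abs_mul_wall_lt (hH : Wall H) (hδ : 0 < δ) (hε₀ : ∀ ε ∈ Ioc 0 ε₀, ∀ X, ε * H X ≤ δ / 2)
    {ε : ℝ} (hε : ε ∈ Ioc 0 ε₀) (X : Fin d → ℝ) : |ε * H X| < δ := by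
  rw [abs_of_pos (mul_pos hε.1 (hH.pos X))]
  exact (hε₀ ε hε X).trans_lt (half_lt_self hδ)

theorem osc_Dminus (hHs : ContDiff ℝ ∞ H) (hH : Wall H) (hE : E.IsElementary par H f)
    (hδ : 0 < δ) (hT : E.TaylorUpTo N δ) (hε₁ : ε₀ ≤ 1)
    (hε₀ : ∀ ε ∈ Ioc 0 ε₀, ∀ X, ε * H X ≤ δ / 2) (n : ℕ) :
    Osc (Ioc 0 ε₀) (fun ε => ε) n (fun ε => E.Dminus H N ε) := by
  have hpos : ∀ ε ∈ Ioc 0 ε₀, 0 < ε := fun ε hε => hε.1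
  have h : ∀ i, Osc (Ioc 0 ε₀) (fun ε => ε) n fun ε x => ∑ k ∈ Finset.range (N + 1),
      -(ε ^ (-(N : ℤ)) * ε ^ k) * wallTrace H (taylorTail (N - k + 1) (E.u k i)) ε x :=
    fun i => Osc.sum _ fun k hk => by
      have hk' : k ≤ N := Nat.lt_succ_iff.1 (Finset.mem_range.1 hk)
      exact ((((hE.u_regular k i).nearWall (hT.u k hk' i)).flat_taylorTail hδ
        (N - k + 1)).osc_wallTrace hHs hH hδ hε₁ hε₀ n _).scale hpos fun ε hε =>
          (abs_zpow_mul_pow (hpos ε hε) hk').le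
  refine (Osc.pi h).congr fun ε hε => funext fun x => funext fun i => ?_
  rw [Dminus, Finset.mul_sum, ← Finset.sum_neg_distrib]
  refine Finset.sum_congr rfl fun k hk => ?_
  rw [(hasSum_taylorU hE hδ hT (abs_mul_wall_lt hH hδ hε₀ hε)
    (Nat.lt_succ_iff.1 (Finset.mem_range.1 hk)) i x _).tsum_eq]
  ring

theorem osc_Nminus (hHs : ContDiff ℝ ∞ H) (hH : Wall H) (hE : E.IsElementary par H f)
    (hδ : 0 < δ) (hT : E.TaylorUpTo N δ) (hε₁ : ε₀ ≤ 1)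
    (hε₀ : ∀ ε ∈ Ioc 0 ε₀, ∀ X, ε * H X ≤ δ / 2) (n : ℕ) :
    Osc (Ioc 0 ε₀) (fun ε => ε) n (fun ε => E.Nminus H N ε) := by
  have hpos : ∀ ε ∈ Ioc 0 ε₀, 0 < ε := fun ε hε => hε.1
  have h : ∀ i j, Osc (Ioc 0 ε₀) (fun ε => ε) n fun ε x => ∑ k ∈ Finset.range (N + 1),
      -(ε ^ (-(N : ℤ)) * ε ^ k) * ∑ b, slopeCoeff H (ε⁻¹ • x) b
        * wallTrace H (taylorTail (N - k + 1) (pd b (E.σ k i j))) ε x :=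
    fun i j => Osc.sum _ fun k hk => by
      have hk' : k ≤ N := Nat.lt_succ_iff.1 (Finset.mem_range.1 hk)
      refine Osc.scale (ρ := fun ε => 1 * ε ^ (N - k + 1)) (Osc.sum _ fun b _ => ?_) hpos
        fun ε hε => by rw [one_mul]; exact (abs_zpow_mul_pow (hpos ε hε) hk').le
      exact (osc_slopeCoeff hpos n hHs hH.per b).mul
        (((((hE.σ_regular k i j).pd b).nearWall (hT.σ k hk' i j b)).flat_taylorTail hδ
          (N - k + 1)).osc_wallTrace hHs hH hδ hε₁ hε₀ n _) hpos fun _ _ => zero_le_one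
  refine (Osc.pi fun i => Osc.pi (h i)).congr fun ε hε => funext fun x => funext fun i =>
    funext fun j => ?_
  rw [Nminus, Finset.mul_sum, ← Finset.sum_neg_distrib]
  refine Finset.sum_congr rfl fun k hk => ?_
  rw [(hasSum_taylorσ hE hδ hT (abs_mul_wall_lt hH hδ hε₀ hε)
    (Nat.lt_succ_iff.1 (Finset.mem_range.1 hk)) i j x _).tsum_eq]
  ring

end

end Expansion

end RoughChannel

end


/-! ### The proposition -/

open RoughChannel in
theorem proposition3 {d : ℕ} (hd : d = 1 ∨ d = 2) (par : Params)
    (H : (Fin d → ℝ) → ℝ) (hH_smooth : ContDiff ℝ ∞ H)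
    (hH_periodic : ∀ (X : Fin d → ℝ) (l : Fin d), H (X + Pi.single l 1) = H X)
    (hH_pos : ∀ X, 0 < H X)
    (f : MacV d) (E : Expansion d) (hE : E.IsElementary par H f) (N : ℕ) :
    ∃ ε₀ : ℝ, 0 < ε₀ ∧ ε₀ ≤ 1 ∧
      -- the source terms are bounded in `L²` of the rough channel
      (∃ C : ℝ, 0 ≤ C ∧ ∀ ε ∈ Ioc 0 ε₀,
        MemLp (E.Fε par N ε) 2 (volume.restrict (roughCell H ε)) ∧
        MemLp (E.Gε par N ε) 2 (volume.restrict (roughCell H ε)) ∧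
        eLpNorm (E.Fε par N ε) 2 (volume.restrict (roughCell H ε)) ≤ ENNReal.ofReal C ∧
        eLpNorm (E.Gε par N ε) 2 (volume.restrict (roughCell H ε)) ≤ ENNReal.ofReal C) ∧
      -- the limits and the series in the boundary data converge, and the data are smooth
      (∀ k ≤ N, ∀ i x,
        Tendsto (meanX (E.U k i) (x, 1)) atTop (𝓝 (farField (E.U k i) (x, 1)))) ∧
      (∀ ε ∈ Ioc 0 ε₀, ∀ k ≤ N, ∀ x i,
        Summable (E.taylorU H ε k i x) ∧ ∀ j, Summable (E.taylorσ H ε k i j x)) ∧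
      (∀ ε ∈ Ioc 0 ε₀,
        ContDiff ℝ ∞ (E.Dplus N ε) ∧ ContDiff ℝ ∞ (E.Nplus N ε) ∧
        ContDiff ℝ ∞ (E.Dminus H N ε) ∧ ContDiff ℝ ∞ (E.Nminus H N ε)) ∧
      -- the boundary data, with all their derivatives
      (∀ ℓ : ℕ, ∃ (C : ℝ) (Q : Polynomial ℝ), ∀ ε ∈ Ioc 0 ε₀, ∀ x : Fin d → ℝ,
        ‖iteratedFDeriv ℝ ℓ (E.Dplus N ε) x‖ ≤ Q.eval (1 / ε) * Real.exp (-(1 / ε)) ∧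
        ‖iteratedFDeriv ℝ ℓ (E.Nplus N ε) x‖ ≤ Q.eval (1 / ε) * Real.exp (-(1 / ε)) ∧
        ‖iteratedFDeriv ℝ ℓ (E.Dminus H N ε) x‖ ≤ C * ε ^ (1 - (ℓ : ℤ)) ∧
        ‖iteratedFDeriv ℝ ℓ (E.Nminus H N ε) x‖ ≤ C * ε ^ (1 - (ℓ : ℤ))) := by
  have hH : Wall H := ⟨hH_smooth.continuous, hH_periodic, hH_pos⟩
  obtain ⟨M, hM, hHM⟩ := hH.exists_upper
  obtain ⟨δ, hδ, hT⟩ := Expansion.exists_taylorUpTo hE N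
  obtain ⟨CF, hCF, hF⟩ := Expansion.exists_eLpNorm_Fε hH hE N
  obtain ⟨CG, hCG, hG⟩ := Expansion.exists_eLpNorm_Gε hH hE N
  obtain ⟨ε₁, hε₁, hFG⟩ := mem_nhdsGT_iff_exists_Ioc_subset.1 (hF.and hG)
  -- δ / 2 / M keeps the wall within |y| ≤ δ/2, where the Taylor series converge and flat fields are
  -- bounded; ε₁ is the range of the L² bounds. None of this involves ℓ, so one threshold serves all
  -- derivatives.
  set ε₀ : ℝ := min (min 1 (δ / 2 / M)) ε₁ with hε₀
  have hpos : 0 < ε₀ := lt_min (lt_min one_pos (by positivity)) hε₁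
  have h1 : ε₀ ≤ 1 := (min_le_left _ _).trans (min_le_left _ _)
  have hsmall : ∀ ε ∈ Ioc 0 ε₀, ∀ X, ε * H X ≤ δ / 2 := by
    intro ε hε X
    have h2 : ε ≤ δ / 2 / M := hε.2.trans ((min_le_left _ _).trans (min_le_right _ _))
    calc ε * H X ≤ ε * M := mul_le_mul_of_nonneg_left (hHM X) hε.1.le
      _ ≤ δ / 2 := (le_div_iff₀ hM).1 h2
  have hlt := fun ε (hε : ε ∈ Ioc 0 ε₀) => Expansion.abs_mul_wall_lt hH hδ hsmall hε
  have hsub : ∀ ε ∈ Ioc 0 ε₀, ε ∈ Ioc (0 : ℝ) 1 := fun ε hε => ⟨hε.1, hε.2.trans h1⟩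
  refine ⟨ε₀, hpos, h1, ⟨max CF CG, hCF.trans (le_max_left _ _), fun ε hε => ?_⟩, ?_, ?_, ?_, ?_⟩
  · obtain ⟨⟨hF1, hF2⟩, hG1, hG2⟩ := hFG ⟨hε.1, hε.2.trans (min_le_right _ _)⟩
    exact ⟨hF1, hG1, hF2.trans (ENNReal.ofReal_le_ofReal (le_max_left _ _)),
      hG2.trans (ENNReal.ofReal_le_ofReal (le_max_right _ _))⟩
  · intro k _ i x
    obtain ⟨C, _, h⟩ := ((Expansion.layerDecay hH hE k).U i).farField hH
    exact (h (x, 1) (mem_slab_top x)).1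
  · intro ε hε k hk x i
    refine ⟨?_, fun j => ?_⟩
    · simpa using (Expansion.hasSum_taylorU hE hδ hT (hlt ε hε) hk i x 0).summable
    · simpa using (Expansion.hasSum_taylorσ hE hδ hT (hlt ε hε) hk i j x 0).summable
  · intro ε hε
    exact ⟨(Expansion.osc_Dplus hH hE N 0).1 ε (hsub ε hε),
      (Expansion.osc_Nplus hH hE N 0).1 ε (hsub ε hε),
      (Expansion.osc_Dminus hH_smooth hH hE hδ hT h1 hsmall 0).1 ε hε,
      (Expansion.osc_Nminus hH_smooth hH hE hδ hT h1 hsmall 0).1 ε hε⟩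
  · intro ℓ
    obtain ⟨C₁, hC₁, hb₁⟩ := (Expansion.osc_Dplus hH hE N ℓ).2 ℓ le_rfl
    obtain ⟨C₂, hC₂, hb₂⟩ := (Expansion.osc_Nplus hH hE N ℓ).2 ℓ le_rfl
    obtain ⟨C₃, hC₃, hb₃⟩ :=
      (Expansion.osc_Dminus hH_smooth hH hE hδ hT h1 hsmall ℓ).2 ℓ le_rfl
    obtain ⟨C₄, hC₄, hb₄⟩ :=
      (Expansion.osc_Nminus hH_smooth hH hE hδ hT h1 hsmall ℓ).2 ℓ le_rfl
    -- The degree is N from the weights ε^(k-N) plus ℓ from the derivatives; sums of constants cover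
    -- both data at each boundary.
    refine ⟨C₃ + C₄, Polynomial.C (C₁ + C₂) * Polynomial.X ^ (N + ℓ), fun ε hε x => ?_⟩
    have hε0 : 0 < ε := hε.1
    have hQ : ∀ C ≤ C₁ + C₂, C * (ε⁻¹ ^ N * Real.exp (-ε⁻¹)) * ε⁻¹ ^ ℓ
        ≤ (Polynomial.C (C₁ + C₂) * Polynomial.X ^ (N + ℓ)).eval (1 / ε)
          * Real.exp (-(1 / ε)) := by
      intro C hC
      simp only [Polynomial.eval_mul, Polynomial.eval_C, Polynomial.eval_pow, Polynomial.eval_X,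
        one_div]
      calc _ = C * (ε⁻¹ ^ (N + ℓ) * Real.exp (-ε⁻¹)) := by rw [pow_add]; ring
        _ ≤ (C₁ + C₂) * (ε⁻¹ ^ (N + ℓ) * Real.exp (-ε⁻¹)) := by gcongr
        _ = _ := by ring
    have hR : ∀ C ≤ C₃ + C₄, C * ε * ε⁻¹ ^ ℓ ≤ (C₃ + C₄) * ε ^ (1 - (ℓ : ℤ)) := by
      intro C hC
      rw [zpow_sub₀ hε0.ne', zpow_one, zpow_natCast, inv_pow, mul_assoc, ← div_eq_mul_inv]
      gcongr
    exact ⟨(hb₁ ε (hsub ε hε) x).trans (hQ _ (by linarith)),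
      (hb₂ ε (hsub ε hε) x).trans (hQ _ (by linarith)),
      (hb₃ ε hε x).trans (hR _ (by linarith)), (hb₄ ε hε x).trans (hR _ (by linarith))⟩
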